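/- **Setting.** Let $X$ be a Polish space and let $V$ be a finite or countable set, the vertex set of a (simple) graph with $\sup_{v\in V}\deg(v)<\infty$. Give $X^V$ the product topology and its Borel $\sigma$-field. For $v\in V$ let $\mathcal N_v$ consist of $v$ and all vertices adjacent to $v$. For each $v\in V$ let $\alpha_v^*(x,dy)$ be a measurable kernel of measures on $X^{\mathcal N_v}$ (the jump rate kernel at $v$), and assume that the total rates are uniformly bounded: $\sup\{\alpha_v^*(x,X^{\mathcal N_v}) : v\in V,\ x\in X^{\mathcal N_v}\}<\infty$. For $x\in X^V$ and $y\in X^{\mathcal N_v}$ let $x|v|y\in X^V$ be the configuration equal to $y$ on $\mathcal N_v$ and to $x$ off $\mathcal N_v$, and for bounded measurable $f:X^V\to\mathbb R$ put $$G_vf(x)=\int_{X^{\mathcal N_v}}\bigl(f(x|v|y)-f(x)\bigr)\,\alpha_v^*(x|_{\mathcal N_v},dy).$$ Let $\mathcal C$ be the class of bounded measurable $f:X^V\to\mathbb R$ that depend on only finitely many coordinates. For $W\subseteq V$ put $G^W=\sum_{v\in W}G_v$, on all bounded measurable functions if $W$ is finite, and on $\mathcal C$ if $W=V$ (where for each $f\in\mathcal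 C$ only finitely many $G_vf$ are nonzero); write $G=G^V$. A *Markovian family of transition distributions* on a measurable space $E$ is a family $(\mu_t)_{t\ge0}$ of probability kernels on $E$ with $\mu_0(x,\cdot)=\delta_x$ and $\int_E\mu_t(y,A)\,\mu_s(x,dy)=\mu_{s+t}(x,A)$ for all $s,t\ge 0$, $x\in E$ and measurable $A\subseteq E$. Its semigroup is $P_tf(x)=\int f(y)\,\mu_t(x,dy)$ for bounded measurable $f$. The semigroup *has generator $L$ on* a class $\mathcal D$ of bounded measurable functions if $t^{-1}(P_tf-f)\to Lf$ uniformly on $E$ as $t\downarrow0$, for every $f\in\mathcal D$. **Theorem 2.1.** 0. For every finite $W\subseteq V$ there is a unique Markovian family of transition distributions on $X^V$ whose semigroup has generator $G^W$ on all bounded measurable functions; write $(P_t^W)_{t\ge0}$ for this semigroup (it is the semigroup of the jump process with jump events at the sites of $W$ only). 1. There is a unique Markovian family of transition distributions $(\mu_t)_{t\ge0}$ on $X^V$ whose semigroup $(P_t)_{t\ge0}$ has generator $G$ on $\mathcal C$. 2. For every sequence $(W_m)_{m\ge 1}$ of finite subsets of $V$ with $\liminf_m W_m:=\bigcup_m\bigcap_{n\ge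 m}W_n=V$, one has $P_tf(x)=\lim_{m\to\infty}P_t^{W_m}f(x)$ for all $t\ge0$, $f\in\mathcal C$ and $x\in X^V$. 3. There exist a probability space, a filtration $(\mathcal G_t)_{t\ge0}$ on it, and processes $(\xi^x_t)_{t\ge0}$, $x\in X^V$, with values in $X^V$, adapted to $(\mathcal G_t)$, with right-continuous sample paths having left limits, such that for all $x\in X^V$ one has $\mathbb P[\xi_0^x=x]=1$ and, for all $s,t\ge0$ and Borel $A\subseteq X^V$, $\mathbb P[\xi^x_{s+t}\in A\mid\mathcal G_s]=\mu_t(\xi^x_s,A)$ almost surely. -/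

import Mathlib

open MeasureTheory ProbabilityTheory Filter Topology
open scoped NNReal ENNReal

noncomputable section

namespace LocalIPS

/-! ### Time-homogeneous Markov processes -/

/-- A Markovian family of transition distributions on `E`: probability kernels `μ_t`, `t ≥ 0`,
with `μ_0(x, ·) = δ_x` and `∫ μ_t(y, A) μ_s(x, dy) = μ_{s+t}(x, A)`. -/
structure IsMarkovianFamily {E : Type*} [MeasurableSpace E] (μ : ℝ≥0 → Kernel E E) : Prop where
  isMarkovKernel : ∀ t, IsMarkovKernel (μ t)
  zero : ∀ x, μ 0 x = Measure.dirac x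
  chapman_kolmogorov : ∀ (s t : ℝ≥0) (x : E) (A : Set E), MeasurableSet A →
    ∫⁻ y, μ t y A ∂(μ s x) = μ (s + t) x A

/-- The semigroup `P_t f(x) = ∫ f(y) μ_t(x, dy)`, used for bounded measurable `f`. -/
def semigroup {E : Type*} [MeasurableSpace E] (μ : ℝ≥0 → Kernel E E) (t : ℝ≥0) (f : E → ℝ) :
    E → ℝ :=
  fun x => ∫ y, f y ∂(μ t x)

/-- The semigroup of `μ` has generator `L` on the class `𝒟`: for every `f ∈ 𝒟`,
`t⁻¹ (P_t f - f) → L f` uniformly as `t ↓ 0`. -/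
def HasGeneratorOn {E : Type*} [MeasurableSpace E] (μ : ℝ≥0 → Kernel E E)
    (L : (E → ℝ) → E → ℝ) (𝒟 : Set (E → ℝ)) : Prop :=
  ∀ f ∈ 𝒟, TendstoUniformly
    (fun (t : ℝ≥0) (x : E) => (t : ℝ)⁻¹ * (semigroup μ t f x - f x)) (L f) (𝓝[>] 0)

/-- The bounded measurable real functions on `E`. -/
def boundedMeasurable (E : Type*) [MeasurableSpace E] : Set (E → ℝ) :=
  {f | Measurable f ∧ ∃ M : ℝ, ∀ x, |f x| ≤ M}

/-- A Markov family of processes `(ξ_t^x, t ≥ 0)`, `x ∈ E`, with transition distributions `μ`,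
relative to the filtration `𝓕`. -/
structure IsMarkovProcessFamily {E : Type*} [TopologicalSpace E] [MeasurableSpace E]
    {Ω : Type*} {mΩ : MeasurableSpace Ω} (P : Measure Ω) (𝓕 : Filtration ℝ≥0 mΩ)
    (μ : ℝ≥0 → Kernel E E) (ξ : E → ℝ≥0 → Ω → E) : Prop where
  right_continuous : ∀ x ω t, ContinuousWithinAt (fun s => ξ x s ω) (Set.Ici t) t
  left_limits : ∀ x ω t, ∃ l, Tendsto (fun s => ξ x s ω) (𝓝[<] t) (𝓝 l)
  adapted : ∀ x, Adapted 𝓕 (ξ x)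
  initial : ∀ x, ∀ᵐ ω ∂P, ξ x 0 ω = x
  markov : ∀ (x : E) (s t : ℝ≥0) (A : Set E), MeasurableSet A →
    P[(ξ x (s + t) ⁻¹' A).indicator (fun _ => (1 : ℝ)) | 𝓕 s]
      =ᵐ[P] fun ω => (μ t (ξ x s ω)).real A

/-! ### The particle system -/

variable {V X : Type*}

/-- The neighbourhood `𝒩_v`: the vertex `v` together with all adjacent vertices. -/
def nbhd (𝒢 : SimpleGraph V) (v : V) : Set V := {w | w = v ∨ 𝒢.Adj v w}

/-- The configuration `x|v|y`, equal to `y` inside `𝒩_v` and to `x` outside. -/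
def patch (𝒢 : SimpleGraph V) (v : V) (x : V → X) (y : nbhd 𝒢 v → X) : V → X :=
  open Classical in fun w => if h : w ∈ nbhd 𝒢 v then y ⟨w, h⟩ else x w

/-- The class `𝒞` of bounded measurable functions depending on finitely many coordinates. -/
def cylinderFun (V X : Type*) [MeasurableSpace X] : Set ((V → X) → ℝ) :=
  {f | f ∈ boundedMeasurable (V → X) ∧ ∃ A : Finset V, DependsOn f (A : Set V)}

variable [MeasurableSpace X]

/-- The local generator `G_v^* g(x) = ∫ (g(y) - g(x)) α_v^*(x, dy)` on functions of the states
in `𝒩_v`. -/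
def localGen {𝒢 : SimpleGraph V} (α : ∀ v, Kernel (nbhd 𝒢 v → X) (nbhd 𝒢 v → X)) (v : V)
    (g : (nbhd 𝒢 v → X) → ℝ) (x : nbhd 𝒢 v → X) : ℝ :=
  ∫ y, (g y - g x) ∂(α v x)

/-- The generator `G_v` on functions of the global state: `G_v^*` applied to
`y ↦ f(x|v|y)`, at the restriction of `x` to `𝒩_v`. -/
def siteGen {𝒢 : SimpleGraph V} (α : ∀ v, Kernel (nbhd 𝒢 v → X) (nbhd 𝒢 v → X)) (v : V)
    (f : (V → X) → ℝ) (x : V → X) : ℝ :=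
  localGen α v (fun y => f (patch 𝒢 v x y)) (fun w => x w)

/-- `G^W = ∑_{v ∈ W} G_v`. For `f ∈ 𝒞` and a graph of finite degrees only finitely many terms
are nonzero, see `finite_siteGen_ne_zero`. -/
def gen {𝒢 : SimpleGraph V} (α : ∀ v, Kernel (nbhd 𝒢 v → X) (nbhd 𝒢 v → X)) (W : Set V)
    (f : (V → X) → ℝ) (x : V → X) : ℝ :=
  ∑ᶠ v ∈ W, siteGen α v f x

/-- `μ` is the family of transition distributions of the jump process in the finite window `W`,
i.e. the one whose generator is `G^W` on all bounded measurable functions. -/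
def IsWindowFamily {𝒢 : SimpleGraph V} (α : ∀ v, Kernel (nbhd 𝒢 v → X) (nbhd 𝒢 v → X))
    (W : Finset V) (μ : ℝ≥0 → Kernel (V → X) (V → X)) : Prop :=
  IsMarkovianFamily μ ∧ HasGeneratorOn μ (gen α (W : Set V)) (boundedMeasurable (V → X))

/-- The sum defining `G f` is a finite sum when `f ∈ 𝒞` and all degrees are finite. -/
theorem finite_siteGen_ne_zero {𝒢 : SimpleGraph V}
    (h𝒢 : ⨆ v, (𝒢.neighborSet v).encard < ⊤)
    (α : ∀ v, Kernel (nbhd 𝒢 v → X) (nbhd 𝒢 v → X)) {f : (V → X) → ℝ} (hf : f ∈ cylinderFun V X) :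
    {v | ∃ x, siteGen α v f x ≠ 0}.Finite := by
  obtain ⟨-, A, hA⟩ := hf
  have hfin : ∀ v, (𝒢.neighborSet v).Finite := fun v =>
    Set.encard_lt_top_iff.1 ((le_iSup (fun v => (𝒢.neighborSet v).encard) v).trans_lt h𝒢)
  refine (Set.Finite.biUnion A.finite_toSet
    (t := fun v => insert v (𝒢.neighborSet v)) fun v _ => (hfin v).insert v).subset ?_
  rintro v ⟨x, hx⟩
  by_contra hv
  refine hx ?_
  simp only [Set.mem_iUnion, Set.mem_insert_iff, not_exists, not_or,
    SimpleGraph.mem_neighborSet] at hv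
  have key : ∀ y, f (patch 𝒢 v x y) = f x := fun y => hA fun w hw => by
    have h1 := hv w hw
    have : w ∉ nbhd 𝒢 v := by
      rintro (h | h)
      · exact h1.1 h.symm
      · exact h1.2 h.symm
    simp [patch, this]
  simp [siteGen, localGen, key]

end LocalIPS

end

open LocalIPS

noncomputable section

namespace LocalIPS

/-! ### Semigroups of Markovian families -/

section Semigroup

variable {E : Type*} [MeasurableSpace E]

/-! Everything rests on one estimate. Let K bound the total rates and b the sizes of the
neighbourhoods. If f depends on a sites, at most ab of the G_v act on it, and each G_v f depends on
at most a + b sites and has norm at most 2K‖f‖. Iterating summand by summand gives ‖(G^W)^n f‖ ≤ c^n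
n! 2^a ‖f‖ for every W, with c depending on K and b only (`abs_iterate_gen_le`). By Taylor's formula
(`abs_semigroup_sub_taylor_le`) any semigroup with generator G^W on 𝒞 is then given on 𝒞 by its
exponential series, up to a time `shortTime` that is the same for all f ∈ 𝒞 and all W.

Uniqueness follows: the short-time kernels are determined on cylinder functions, hence determined,
and Chapman–Kolmogorov propagates this to all times (`eq_of_hasGeneratorOn_cylinderFun`).

For existence, the jump process in a finite window is a Markov chain run for a Poisson number of
steps (`exists_isMarkovianFamily_of_rate`). For short times, the leading Taylor terms in two large
windows coincide, so the semigroups are close, uniformly in the starting point and in all f with |f|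
≤ 1 depending on a given finite set. Finite-window semigroups preserve cylinder functions, so
closeness extends to all times (`exists_window_close`). Thus finite-dimensional marginals are Cauchy
in total variation, and their limits are assembled into kernels on X^V (`exists_limit_law`,
`exists_limit_kernels`). The rates are not assumed continuous, so there is no Feller property; its
role is taken by the uniform approximability of P_t f by cylinder functions.

For the paths, a given site changes within time t with probability at most a constant times t. Hence
the chains observed at dyadic times, coupled over all levels, have for each site an expected number
of changes in bounded time intervals that is bounded uniformly in the level
(`exists_dyadic_process`). Each coordinate is therefore piecewise constant and extends
right-continuously, and the Markov property survives the passage to the limit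
(`exists_cadlag_process`). Independent copies for all starting points live on a product space
(`exists_isMarkovProcessFamily`). -/

theorem integrable_of_boundedMeasurable {m : Measure E} [IsFiniteMeasure m] {f : E → ℝ}
    (hf : f ∈ boundedMeasurable E) : Integrable f m := by
  obtain ⟨hm, M, hM⟩ := hf
  exact Integrable.of_bound hm.aestronglyMeasurable M (ae_of_all _ fun x => by simpa using hM x)

theorem abs_integral_le_of_abs_le {m : Measure E} [IsProbabilityMeasure m] {f : E → ℝ} {M : ℝ}
    (hM : ∀ x, |f x| ≤ M) : |∫ y, f y ∂m| ≤ M := by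
  simpa using norm_integral_le_of_norm_le_const (μ := m) (f := f) (C := M)
    (ae_of_all _ fun x => by simpa using hM x)

theorem boundedMeasurable_add {f g : E → ℝ} (hf : f ∈ boundedMeasurable E)
    (hg : g ∈ boundedMeasurable E) : (fun x => f x + g x) ∈ boundedMeasurable E := by
  obtain ⟨hf, M, hM⟩ := hf
  obtain ⟨hg, N, hN⟩ := hg
  exact ⟨hf.add hg, M + N, fun x => (abs_add_le _ _).trans (add_le_add (hM x) (hN x))⟩

theorem boundedMeasurable_sub {f g : E → ℝ} (hf : f ∈ boundedMeasurable E)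
    (hg : g ∈ boundedMeasurable E) : (fun x => f x - g x) ∈ boundedMeasurable E := by
  obtain ⟨hf, M, hM⟩ := hf
  obtain ⟨hg, N, hN⟩ := hg
  exact ⟨hf.sub hg, M + N, fun x => (abs_sub _ _).trans (add_le_add (hM x) (hN x))⟩

theorem boundedMeasurable_const_mul (c : ℝ) {f : E → ℝ} (hf : f ∈ boundedMeasurable E) :
    (fun x => c * f x) ∈ boundedMeasurable E := by
  obtain ⟨hf, M, hM⟩ := hf
  exact ⟨hf.const_mul c, |c| * M, fun x => by
    rw [abs_mul]; exact mul_le_mul_of_nonneg_left (hM x) (abs_nonneg c)⟩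

theorem boundedMeasurable_sum {ι : Type*} (s : Finset ι) {f : ι → E → ℝ}
    (hf : ∀ i ∈ s, f i ∈ boundedMeasurable E) :
    (fun x => ∑ i ∈ s, f i x) ∈ boundedMeasurable E := by
  classical
  induction s using Finset.induction_on with
  | empty => exact ⟨by simp, 0, by simp⟩
  | insert a s ha ih =>
    simp only [Finset.sum_insert ha]
    exact boundedMeasurable_add (hf a (by simp)) (ih fun i hi => hf i (by simp [hi]))

theorem boundedMeasurable_indicator {S : Set E} (hS : MeasurableSet S) :
    S.indicator (fun _ => (1 : ℝ)) ∈ boundedMeasurable E :=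
  ⟨measurable_const.indicator hS, 1, fun x => by
    by_cases h : x ∈ S <;> simp [h]⟩

variable {μ : ℝ≥0 → Kernel E E}

theorem boundedMeasurable_semigroup (hμ : IsMarkovianFamily μ) (t : ℝ≥0) {f : E → ℝ}
    (hf : f ∈ boundedMeasurable E) : semigroup μ t f ∈ boundedMeasurable E := by
  have := hμ.isMarkovKernel t
  obtain ⟨hm, M, hM⟩ := hf
  refine ⟨?_, M, fun x => abs_integral_le_of_abs_le hM⟩
  exact (hm.stronglyMeasurable.integral_kernel (κ := μ t)).measurable

theorem abs_semigroup_le (hμ : IsMarkovianFamily μ) (t : ℝ≥0) {f : E → ℝ} {M : ℝ}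
    (hM : ∀ x, |f x| ≤ M) (x : E) : |semigroup μ t f x| ≤ M :=
  have := hμ.isMarkovKernel t
  abs_integral_le_of_abs_le hM

theorem semigroup_zero (hμ : IsMarkovianFamily μ) {f : E → ℝ} (hf : Measurable f) (x : E) :
    semigroup μ 0 f x = f x := by
  simp only [semigroup, hμ.zero]
  exact integral_dirac' _ _ hf.stronglyMeasurable

theorem semigroup_const_mul (t : ℝ≥0) (c : ℝ) (f : E → ℝ) (x : E) :
    semigroup μ t (fun y => c * f y) x = c * semigroup μ t f x :=
  integral_const_mul _ _

theorem semigroup_sub (hμ : IsMarkovianFamily μ) (t : ℝ≥0) {f g : E → ℝ}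
    (hf : f ∈ boundedMeasurable E) (hg : g ∈ boundedMeasurable E) (x : E) :
    semigroup μ t (fun y => f y - g y) x = semigroup μ t f x - semigroup μ t g x :=
  have := hμ.isMarkovKernel t
  integral_sub (integrable_of_boundedMeasurable hf) (integrable_of_boundedMeasurable hg)

theorem abs_semigroup_sub_le (hμ : IsMarkovianFamily μ) (t : ℝ≥0) {f g : E → ℝ}
    (hf : f ∈ boundedMeasurable E) (hg : g ∈ boundedMeasurable E) {ε : ℝ}
    (h : ∀ y, |f y - g y| ≤ ε) (x : E) :
    |semigroup μ t f x - semigroup μ t g x| ≤ ε := by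
  rw [← semigroup_sub hμ t hf hg]
  exact abs_semigroup_le hμ t h x

theorem comp_eq_of_isMarkovianFamily (hμ : IsMarkovianFamily μ) (s t : ℝ≥0) :
    μ t ∘ₖ μ s = μ (s + t) := by
  ext x A hA
  rw [Kernel.comp_apply' _ _ _ hA, hμ.chapman_kolmogorov s t x A hA]

theorem semigroup_add (hμ : IsMarkovianFamily μ) (s t : ℝ≥0) {f : E → ℝ}
    (hf : f ∈ boundedMeasurable E) (x : E) :
    semigroup μ (s + t) f x = semigroup μ s (semigroup μ t f) x := by
  have := hμ.isMarkovKernel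
  have h : Integrable f ((μ t ∘ₖ μ s) x) := integrable_of_boundedMeasurable hf
  simp only [semigroup, ← comp_eq_of_isMarkovianFamily hμ s t]
  exact Kernel.integral_comp h

theorem kernel_eq_of_semigroup_eq {μ' : ℝ≥0 → Kernel E E} (hμ : IsMarkovianFamily μ)
    (hμ' : IsMarkovianFamily μ') (t : ℝ≥0)
    (h : ∀ f ∈ boundedMeasurable E, semigroup μ t f = semigroup μ' t f) : μ t = μ' t := by
  have := hμ.isMarkovKernel t
  have := hμ'.isMarkovKernel t
  ext x A hA
  have := congrFun (h _ (boundedMeasurable_indicator hA)) x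
  simp only [semigroup, integral_indicator_const _ hA, smul_eq_mul, mul_one] at this
  exact (measureReal_eq_measureReal_iff).1 this

/-! ### Taylor's formula for a semigroup on a class invariant under its generator -/

section Taylor

variable {L : (E → ℝ) → E → ℝ} {𝒟 : Set (E → ℝ)}

theorem tendsto_semigroup_uniform (hμ : IsMarkovianFamily μ) (hG : HasGeneratorOn μ L 𝒟)
    (hsub : 𝒟 ⊆ boundedMeasurable E) (hL : ∀ f ∈ 𝒟, L f ∈ 𝒟) {f : E → ℝ} (hf : f ∈ 𝒟)
    {ε : ℝ} (hε : 0 < ε) : ∃ δ > 0, ∀ h : ℝ≥0, (h : ℝ) < δ → ∀ x,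
      |semigroup μ h f x - f x| < ε := by
  obtain ⟨-, M, hM⟩ := hsub (hL f hf)
  have h1 := Metric.tendstoUniformly_iff.1 (hG f hf) 1 one_pos
  rw [eventually_nhdsWithin_iff, Metric.eventually_nhds_iff] at h1
  obtain ⟨δ, hδ, h1⟩ := h1
  -- Below the first δ the difference quotient is within 1 of `L f`, hence bounded by `|M| + 1`; the
  -- second restriction then makes the increment itself small.
  refine ⟨min δ (ε / (|M| + 1)), lt_min hδ (by positivity), fun h hh x => ?_⟩
  rcases eq_or_ne h 0 with rfl | h0
  · rw [semigroup_zero hμ (hsub hf).1]; simpa using hε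
  have hpos : 0 < (h : ℝ) := by positivity
  have h2 := h1 (y := h) (by simpa [NNReal.dist_eq] using hh.trans_le (min_le_left _ _))
    (pos_iff_ne_zero.2 h0) x
  rw [Real.dist_eq] at h2
  have h3 : |(h : ℝ)⁻¹ * (semigroup μ h f x - f x)| < |M| + 1 := by
    have := (hM x).trans (le_abs_self M)
    rw [abs_le] at this
    rw [abs_lt] at h2 ⊢
    constructor <;> linarith
  rw [abs_mul, abs_of_pos (inv_pos.2 hpos), inv_mul_lt_iff₀ hpos] at h3
  refine h3.trans_le ?_
  have := (hh.trans_le (min_le_right _ _)).le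
  rwa [le_div_iff₀ (by positivity)] at this

/-- The right derivative of `s ↦ P_s f(x)` is `P_s L f(x)`. -/
theorem hasDerivWithinAt_semigroup (hμ : IsMarkovianFamily μ) (hG : HasGeneratorOn μ L 𝒟)
    (hsub : 𝒟 ⊆ boundedMeasurable E) (hL : ∀ f ∈ 𝒟, L f ∈ 𝒟) {f : E → ℝ} (hf : f ∈ 𝒟) (x : E)
    {s : ℝ} (hs : 0 ≤ s) :
    HasDerivWithinAt (fun r : ℝ => semigroup μ r.toNNReal f x)
      (semigroup μ s.toNNReal (L f) x) (Set.Ici s) s := by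
  rw [hasDerivWithinAt_iff_tendsto_slope, Set.Ici_sdiff_left]
  rw [Metric.tendsto_nhds]
  intro ε hε
  have h1 := Metric.tendstoUniformly_iff.1 (hG f hf) (ε / 2) (half_pos hε)
  rw [eventually_nhdsWithin_iff, Metric.eventually_nhds_iff] at h1
  obtain ⟨δ, hδ, h1⟩ := h1
  rw [eventually_nhdsWithin_iff, Metric.eventually_nhds_iff]
  refine ⟨δ, hδ, fun r hr hsr => ?_⟩
  rw [Set.mem_Ioi] at hsr
  rw [Real.dist_eq, abs_of_pos (sub_pos.2 hsr)] at hr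
  set h : ℝ≥0 := (r - s).toNNReal with hh
  have hhr : (h : ℝ) = r - s := Real.coe_toNNReal _ (sub_pos.2 hsr).le
  have hh0 : 0 < h := by rw [← NNReal.coe_pos, hhr]; exact sub_pos.2 hsr
  have hadd : r.toNNReal = s.toNNReal + h := by
    rw [hh, ← Real.toNNReal_add hs (sub_pos.2 hsr).le]; congr 1; ring
  have h2 := h1 (y := h) (by simpa [NNReal.dist_eq, hhr, abs_of_pos (sub_pos.2 hsr)] using hr) hh0
  have hfb := hsub hf
  have hPf := boundedMeasurable_semigroup hμ h hfb
  -- By the semigroup law the slope at `s` is `P_s` applied to the difference quotient at time 0. As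
  -- `P_s` is a contraction, the uniform convergence of the latter carries over.
  have key : slope (fun r : ℝ => semigroup μ r.toNNReal f x) s r =
      semigroup μ s.toNNReal (fun y => (h : ℝ)⁻¹ * (semigroup μ h f y - f y)) x := by
    rw [slope_def_field, semigroup_const_mul, semigroup_sub hμ _ hPf hfb, hadd,
      semigroup_add hμ _ _ hfb, hhr]
    ring
  rw [key, Real.dist_eq]
  refine (abs_semigroup_sub_le hμ _ (boundedMeasurable_const_mul _
    (boundedMeasurable_sub hPf hfb)) (hsub (hL f hf)) (fun y => ?_) x).trans_lt (half_lt_self hε)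
  rw [abs_sub_comm]
  exact (h2 y).le

theorem continuousOn_semigroup (hμ : IsMarkovianFamily μ) (hG : HasGeneratorOn μ L 𝒟)
    (hsub : 𝒟 ⊆ boundedMeasurable E) (hL : ∀ f ∈ 𝒟, L f ∈ 𝒟) {f : E → ℝ} (hf : f ∈ 𝒟) (x : E) :
    Continuous (fun r : ℝ => semigroup μ r.toNNReal f x) := by
  suffices h : Continuous (fun r : ℝ≥0 => semigroup μ r f x) from h.comp continuous_real_toNNReal
  have hfb := hsub hf
  rw [Metric.continuous_iff]
  intro s ε hε
  obtain ⟨δ, hδ, h1⟩ := tendsto_semigroup_uniform hμ hG hsub hL hf (half_pos hε)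
  have key : ∀ a b : ℝ≥0, a ≤ b → (b : ℝ) - a < δ →
      |semigroup μ b f x - semigroup μ a f x| < ε := by
    intro a b hab hlt
    obtain ⟨c, rfl⟩ := exists_add_of_le hab
    rw [semigroup_add hμ _ _ hfb]
    refine (abs_semigroup_sub_le hμ _ (boundedMeasurable_semigroup hμ c hfb) hfb
      (fun y => (h1 c ?_ y).le) x).trans_lt (half_lt_self hε)
    simpa using hlt
  refine ⟨δ, hδ, fun r hr => ?_⟩
  rw [NNReal.dist_eq] at hr
  rw [Real.dist_eq]
  rcases le_total s r with h | h
  · exact key s r h ((le_abs_self _).trans_lt hr)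
  · rw [abs_sub_comm] at hr ⊢
    exact key r s h ((le_abs_self _).trans_lt hr)

/-- Taylor's formula for the semigroup, with a uniform bound on the remainder. -/
theorem abs_semigroup_sub_taylor_le (hμ : IsMarkovianFamily μ) (hG : HasGeneratorOn μ L 𝒟)
    (hsub : 𝒟 ⊆ boundedMeasurable E) (hL : ∀ f ∈ 𝒟, L f ∈ 𝒟) (n : ℕ) {f : E → ℝ} (hf : f ∈ 𝒟)
    {M : ℝ} (hM : ∀ x, |(L^[n] f) x| ≤ M) (t : ℝ≥0) (x : E) :
    |semigroup μ t f x - ∑ k ∈ Finset.range n, (t : ℝ) ^ k / k.factorial * (L^[k] f) x|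
      ≤ (t : ℝ) ^ n / n.factorial * M := by
  induction n generalizing f t with
  | zero => simpa using abs_semigroup_le hμ t hM x
  | succ n ih =>
    have hLf := hL f hf
    have hpoly : ∀ (g : ℕ → ℝ) (s : ℝ), HasDerivAt
        (fun s : ℝ => ∑ k ∈ Finset.range (n + 1), s ^ k / k.factorial * g k)
        (∑ k ∈ Finset.range n, s ^ k / k.factorial * g (k + 1)) s := by
      intro g s
      have : ∀ k ∈ Finset.range (n + 1), HasDerivAt (fun s : ℝ => s ^ k / k.factorial * g k)
          ((k * s ^ (k - 1)) / k.factorial * g k) s := fun k _ =>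
        ((hasDerivAt_pow k s).div_const _).mul_const _
      have h := HasDerivAt.fun_sum this
      refine h.congr_deriv ?_
      rw [Finset.sum_range_succ']
      simp only [Nat.cast_zero, zero_mul, zero_div, add_zero]
      refine Finset.sum_congr rfl fun k _ => ?_
      rw [Nat.factorial_succ]
      push_cast
      have h1 : (k.factorial : ℝ) ≠ 0 := by positivity
      have h2 : (k : ℝ) + 1 ≠ 0 := by positivity
      field_simp
    have hB : ∀ s : ℝ, HasDerivAt (fun s : ℝ => s ^ (n + 1) / (n + 1).factorial * M)
        (s ^ n / n.factorial * M) s := by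
      intro s
      refine (((hasDerivAt_pow (n + 1) s).div_const ((n + 1).factorial : ℝ)).mul_const
        M).congr_deriv ?_
      rw [Nat.factorial_succ]
      push_cast
      have h1 : (n.factorial : ℝ) ≠ 0 := by positivity
      have h2 : (n : ℝ) + 1 ≠ 0 := by positivity
      field_simp
    -- This form of the mean value inequality asks only for right derivatives, which is what the
    -- generator provides. Differentiating the remainder of order `n + 1` for `f` gives the
    -- remainder of order `n` for `L f`, which the induction hypothesis bounds by the derivative of
    -- `B`.
    have main := image_norm_le_of_norm_deriv_right_le_deriv_boundary (a := 0) (b := (t : ℝ))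
      (f := fun s : ℝ => semigroup μ s.toNNReal f x -
        ∑ k ∈ Finset.range (n + 1), s ^ k / k.factorial * (L^[k] f) x)
      (f' := fun s : ℝ => semigroup μ s.toNNReal (L f) x -
        ∑ k ∈ Finset.range n, s ^ k / k.factorial * (L^[k + 1] f) x)
      (B := fun s : ℝ => s ^ (n + 1) / (n + 1).factorial * M)
      (B' := fun s : ℝ => s ^ n / n.factorial * M)
      ?_ ?_ ?_ hB ?_ (Set.right_mem_Icc.2 t.2)
    · simpa using main
    · exact ((continuousOn_semigroup hμ hG hsub hL hf x).sub
        (continuous_iff_continuousAt.2 fun s =>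
          (hpoly (fun k => (L^[k] f) x) s).continuousAt)).continuousOn
    · intro s hs
      exact (hasDerivWithinAt_semigroup hμ hG hsub hL hf x hs.1).sub
        (hpoly (fun k => (L^[k] f) x) s).hasDerivWithinAt
    · simp [Finset.sum_range_succ', semigroup_zero hμ (hsub hf).1]
    · intro s hs
      have := ih hLf (by simpa using hM) s.toNNReal
      simpa only [Real.norm_eq_abs, Real.coe_toNNReal _ hs.1, Function.iterate_succ,
        Function.comp_apply] using this

end Taylor

end Semigroup

/-! ### Site generators -/

section SiteGen

variable {V X : Type*} {𝒢 : SimpleGraph V}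

/-- `nb` lists the neighbourhoods, which have at most `b` elements. -/
structure IsNbhdFinset (𝒢 : SimpleGraph V) (nb : V → Finset V) (b : ℕ) : Prop where
  mem_iff : ∀ v w, w ∈ nb v ↔ w ∈ nbhd 𝒢 v
  card_le : ∀ v, (nb v).card ≤ b

theorem exists_isNbhdFinset (h𝒢 : ⨆ v, (𝒢.neighborSet v).encard < ⊤) :
    ∃ nb b, IsNbhdFinset 𝒢 nb b := by
  obtain ⟨D, hD⟩ := ENat.ne_top_iff_exists.1 h𝒢.ne
  have hle : ∀ v, (nbhd 𝒢 v).encard ≤ D + 1 := fun v => by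
    have : nbhd 𝒢 v = insert v (𝒢.neighborSet v) := by
      ext w; simp [nbhd]
    rw [this, hD]
    exact (Set.encard_insert_le _ _).trans
      (add_le_add_left (le_iSup (fun v => (𝒢.neighborSet v).encard) v) 1)
  have hfin : ∀ v, (nbhd 𝒢 v).Finite := fun v =>
    Set.finite_of_encard_le_coe (k := D + 1) (by exact_mod_cast hle v)
  refine ⟨fun v => (hfin v).toFinset, D + 1, fun v w => by simp, fun v => ?_⟩
  have := hle v
  rw [(hfin v).encard_eq_coe_toFinset_card] at this
  exact_mod_cast this

theorem mem_nbhd_comm {v w : V} : w ∈ nbhd 𝒢 v ↔ v ∈ nbhd 𝒢 w := by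
  simp only [nbhd, Set.mem_ofPred_eq, eq_comm (a := w), 𝒢.adj_comm]

theorem patch_self (v : V) (x : V → X) : patch 𝒢 v x (fun w => x w) = x := by
  ext w; simp [patch]

theorem patch_eq_of_notMem {v w : V} (h : w ∉ nbhd 𝒢 v) (x : V → X) (y : nbhd 𝒢 v → X) :
    patch 𝒢 v x y w = x w := by
  simp [patch, h]

theorem patch_congr {v w : V} {x x' : V → X} (h : x w = x' w) (y : nbhd 𝒢 v → X) :
    patch 𝒢 v x y w = patch 𝒢 v x' y w := by
  by_cases hw : w ∈ nbhd 𝒢 v <;> simp [patch, hw, h]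

/-- The sites whose neighbourhoods meet `A`. -/
def touch (nb : V → Finset V) (A : Finset V) : Finset V :=
  open Classical in A.biUnion nb

theorem mem_touch {nb : V → Finset V} {b : ℕ} (hnb : IsNbhdFinset 𝒢 nb b) {A : Finset V} {v : V} :
    v ∈ touch nb A ↔ ∃ w ∈ A, w ∈ nbhd 𝒢 v := by
  simp only [touch, Finset.mem_biUnion, hnb.mem_iff]
  exact exists_congr fun w => and_congr_right fun _ => mem_nbhd_comm

theorem card_touch_le {nb : V → Finset V} {b : ℕ} (hnb : IsNbhdFinset 𝒢 nb b) (A : Finset V) :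
    (touch nb A).card ≤ A.card * b := by
  classical
  exact Finset.card_biUnion_le_card_mul _ _ _ fun v _ => hnb.card_le v

variable [MeasurableSpace X]

theorem measurable_patch (v : V) :
    Measurable fun p : (V → X) × (nbhd 𝒢 v → X) => patch 𝒢 v p.1 p.2 := by
  refine measurable_pi_lambda _ fun w => ?_
  by_cases hw : w ∈ nbhd 𝒢 v
  · simp only [patch, hw, dif_pos]; fun_prop
  · simp only [patch, hw, dif_neg, not_false_eq_true]; fun_prop

theorem measurable_restrict_nbhd (v : V) :
    Measurable fun (x : V → X) (w : nbhd 𝒢 v) => x w := by fun_prop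

variable {α : ∀ v, Kernel (nbhd 𝒢 v → X) (nbhd 𝒢 v → X)}

theorem siteGen_eq (v : V) (f : (V → X) → ℝ) (x : V → X) :
    siteGen α v f x = ∫ y, (f (patch 𝒢 v x y) - f x) ∂(α v fun w => x w) := by
  simp only [siteGen, localGen, patch_self]

theorem siteGen_eq_zero {v : V} {A : Set V} {f : (V → X) → ℝ} (hf : DependsOn f A)
    (h : Disjoint A (nbhd 𝒢 v)) (x : V → X) : siteGen α v f x = 0 := by
  have key : ∀ y, f (patch 𝒢 v x y) = f x := fun y => hf fun w hw =>
    patch_eq_of_notMem (Set.disjoint_left.1 h hw) x y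
  simp [siteGen_eq, key]

theorem dependsOn_siteGen (v : V) {A : Set V} {f : (V → X) → ℝ} (hf : DependsOn f A) :
    DependsOn (siteGen α v f) (A ∪ nbhd 𝒢 v) := by
  intro x x' h
  have h1 : (fun w : nbhd 𝒢 v => x w) = fun w : nbhd 𝒢 v => x' w :=
    funext fun w => h w (Or.inr w.2)
  rw [siteGen_eq, siteGen_eq, h1, hf fun w hw => h w (Or.inl hw)]
  congr with y
  rw [hf fun w hw => patch_congr (h w (Or.inl hw)) y]

variable [∀ v, IsFiniteKernel (α v)]

theorem integrable_siteGen (v : V) {f : (V → X) → ℝ} (hf : f ∈ boundedMeasurable (V → X))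
    (x : V → X) : Integrable (fun y => f (patch 𝒢 v x y) - f x) (α v fun w => x w) := by
  refine integrable_of_boundedMeasurable (boundedMeasurable_sub ?_ ⟨measurable_const, |f x|, ?_⟩)
  · obtain ⟨hm, M, hM⟩ := hf
    exact ⟨hm.comp ((measurable_patch v).comp measurable_prodMk_left), M, fun y => hM _⟩
  · simp

theorem siteGen_add (v : V) {f g : (V → X) → ℝ} (hf : f ∈ boundedMeasurable (V → X))
    (hg : g ∈ boundedMeasurable (V → X)) (x : V → X) :
    siteGen α v (fun x => f x + g x) x = siteGen α v f x + siteGen α v g x := by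
  simp only [siteGen_eq]
  rw [← integral_add (integrable_siteGen v hf x) (integrable_siteGen v hg x)]
  congr with y
  ring

theorem measurable_siteGen (v : V) {f : (V → X) → ℝ} (hf : Measurable f) :
    Measurable (siteGen α v f) := by
  have h : siteGen α v f = fun x => ∫ y, (f (patch 𝒢 v x y) - f x)
      ∂((α v).comap _ (measurable_restrict_nbhd v) x) := by
    ext x
    rw [siteGen_eq, Kernel.comap_apply]
  rw [h]
  refine (StronglyMeasurable.integral_kernel_prod_right'
    (f := fun p : (V → X) × (nbhd 𝒢 v → X) => f (patch 𝒢 v p.1 p.2) - f p.1) ?_).measurable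
  exact ((hf.comp (measurable_patch v)).sub (hf.comp measurable_fst)).stronglyMeasurable

omit [∀ v, IsFiniteKernel (α v)] in
theorem isFiniteKernel_of_le {K : ℝ≥0} (hK : ∀ v x, α v x Set.univ ≤ K) (v : V) :
    IsFiniteKernel (α v) :=
  ⟨⟨K, ENNReal.coe_lt_top, hK v⟩⟩

omit [∀ v, IsFiniteKernel (α v)] in
theorem abs_siteGen_le {K : ℝ≥0} (hK : ∀ v x, α v x Set.univ ≤ K) (v : V) {f : (V → X) → ℝ}
    {M : ℝ} (hM : ∀ x, |f x| ≤ M) (x : V → X) : |siteGen α v f x| ≤ 2 * K * M := by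
  have := isFiniteKernel_of_le hK
  have hM0 : 0 ≤ M := (abs_nonneg _).trans (hM x)
  rw [siteGen_eq, ← Real.norm_eq_abs]
  refine (norm_integral_le_of_norm_le_const (C := 2 * M) (ae_of_all _ fun y => ?_)).trans ?_
  · rw [Real.norm_eq_abs]
    exact (abs_sub _ _).trans (by linarith [hM x, hM (patch 𝒢 v x y)])
  · have : (α v fun w => x w).real Set.univ ≤ K := by
      rw [measureReal_def]
      exact ENNReal.toReal_le_of_le_ofReal K.2 (by simpa using hK v _)
    nlinarith

/-! ### The generators `G^W` -/

omit [∀ v, IsFiniteKernel (α v)] in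
theorem gen_coe_finset (W : Finset V) (f : (V → X) → ℝ) (x : V → X) :
    gen α (W : Set V) f x = ∑ v ∈ W, siteGen α v f x :=
  finsum_mem_coe_finset _ _

theorem gen_mem_boundedMeasurable {K : ℝ≥0} (hK : ∀ v x, α v x Set.univ ≤ K) (W : Finset V)
    {f : (V → X) → ℝ} (hf : f ∈ boundedMeasurable (V → X)) :
    gen α (W : Set V) f ∈ boundedMeasurable (V → X) := by
  obtain ⟨hm, M, hM⟩ := hf
  have : gen α (W : Set V) f = fun x => ∑ v ∈ W, siteGen α v f x := funext (gen_coe_finset W f)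
  rw [this]
  exact boundedMeasurable_sum _ fun v _ =>
    ⟨measurable_siteGen v hm, 2 * K * M, abs_siteGen_le hK v hM⟩

omit [∀ v, IsFiniteKernel (α v)] in
theorem abs_gen_le {K : ℝ≥0} (hK : ∀ v x, α v x Set.univ ≤ K) (W : Finset V)
    {f : (V → X) → ℝ} {M : ℝ} (hM : ∀ x, |f x| ≤ M) (x : V → X) :
    |gen α (W : Set V) f x| ≤ 2 * K * W.card * M := by
  rw [gen_coe_finset]
  calc |∑ v ∈ W, siteGen α v f x| ≤ ∑ v ∈ W, |siteGen α v f x| := Finset.abs_sum_le_sum_abs _ _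
    _ ≤ ∑ v ∈ W, 2 * K * M := Finset.sum_le_sum fun v _ => abs_siteGen_le hK v hM x
    _ = _ := by rw [Finset.sum_const, nsmul_eq_mul]; ring

/-! ### Generators acting on cylinder functions -/

section Cylinder

variable {nb : V → Finset V} {b : ℕ}

open Classical in
omit [∀ v, IsFiniteKernel (α v)] in
-- Sites whose neighbourhoods miss `A` contribute nothing. This turns the `finsum` into a sum over a
-- finite set that does not depend on `x`, also for infinite `W`.
theorem gen_eq_sum_touch (hnb : IsNbhdFinset 𝒢 nb b) (W : Set V) {A : Finset V}
    {f : (V → X) → ℝ} (hf : DependsOn f (A : Set V)) (x : V → X) :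
    gen α W f x = ∑ v ∈ touch nb A with v ∈ W, siteGen α v f x := by
  refine finsum_mem_eq_sum_of_inter_support_eq _ ?_
  ext v
  simp only [Set.mem_inter_iff, Function.mem_support, Finset.coe_filter, Set.mem_ofPred_eq,
    and_congr_left_iff, iff_and_self]
  intro hv _
  by_contra h
  refine hv (siteGen_eq_zero hf ?_ x)
  rw [Set.disjoint_left]
  exact fun w hw hw' => h ((mem_touch hnb).2 ⟨w, hw, hw'⟩)

omit [∀ v, IsFiniteKernel (α v)] in
theorem gen_congr_of_touch_subset (hnb : IsNbhdFinset 𝒢 nb b) {W : Set V} {A : Finset V}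
    {f : (V → X) → ℝ} (hf : DependsOn f (A : Set V)) (hW : (touch nb A : Set V) ⊆ W) :
    gen α W f = gen α Set.univ f := by
  classical
  ext x
  rw [gen_eq_sum_touch hnb W hf, gen_eq_sum_touch hnb _ hf]
  congr 1
  ext v
  simp only [Finset.mem_filter, Set.mem_univ, and_congr_right_iff, iff_true]
  exact fun hv => hW hv

/-- The sites on which `G f` may depend when `f` depends on `A`. -/
def enlarge (nb : V → Finset V) (A : Finset V) : Finset V :=
  open Classical in A ∪ touch nb (touch nb A)

omit [∀ v, IsFiniteKernel (α v)] in
theorem dependsOn_gen (hnb : IsNbhdFinset 𝒢 nb b) (W : Set V) {A : Finset V}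
    {f : (V → X) → ℝ} (hf : DependsOn f (A : Set V)) :
    DependsOn (gen α W f) (enlarge nb A : Set V) := by
  classical
  intro x x' h
  rw [gen_eq_sum_touch hnb W hf, gen_eq_sum_touch hnb W hf]
  refine Finset.sum_congr rfl fun v hv => dependsOn_siteGen v hf fun w hw => h w ?_
  simp only [enlarge, Finset.coe_union, Set.mem_union, Finset.mem_coe] at hw ⊢
  refine hw.imp id fun hw => ?_
  exact (mem_touch hnb).2 ⟨v, (Finset.mem_filter.1 hv).1, mem_nbhd_comm.1 hw⟩

theorem gen_add (hnb : IsNbhdFinset 𝒢 nb b) (W : Set V) {f g : (V → X) → ℝ}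
    (hf : f ∈ cylinderFun V X) (hg : g ∈ cylinderFun V X) (x : V → X) :
    gen α W (fun x => f x + g x) x = gen α W f x + gen α W g x := by
  classical
  obtain ⟨hfb, A, hA⟩ := hf
  obtain ⟨hgb, B, hB⟩ := hg
  have hA' : DependsOn f ((A ∪ B : Finset V) : Set V) := hA.mono (by simp)
  have hB' : DependsOn g ((A ∪ B : Finset V) : Set V) := hB.mono (by simp)
  have hAB : DependsOn (fun x => f x + g x) ((A ∪ B : Finset V) : Set V) := fun x y h => by
    simp only [hA' h, hB' h]
  rw [gen_eq_sum_touch hnb W hA', gen_eq_sum_touch hnb W hB', gen_eq_sum_touch hnb W hAB,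
    ← Finset.sum_add_distrib]
  exact Finset.sum_congr rfl fun v _ => siteGen_add v hfb hgb x

theorem gen_mem_cylinderFun (hnb : IsNbhdFinset 𝒢 nb b) {K : ℝ≥0}
    (hK : ∀ v x, α v x Set.univ ≤ K) (W : Set V) {f : (V → X) → ℝ} (hf : f ∈ cylinderFun V X) :
    gen α W f ∈ cylinderFun V X := by
  classical
  obtain ⟨⟨hm, M, hM⟩, A, hA⟩ := hf
  refine ⟨?_, _, dependsOn_gen hnb W hA⟩
  rw [show gen α W f = _ from funext (gen_eq_sum_touch hnb W hA)]
  exact boundedMeasurable_sum _ fun v _ =>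
    ⟨measurable_siteGen v hm, 2 * K * M, abs_siteGen_le hK v hM⟩

end Cylinder

end SiteGen

/-! ### Jump processes with bounded rates, by uniformisation -/

section Uniformization

variable {E : Type*} [MeasurableSpace E]

instance isMarkovKernel_pow (Q : Kernel E E) [IsMarkovKernel Q] (n : ℕ) :
    IsMarkovKernel (Q ^ n) := by
  induction n with
  | zero => rw [pow_zero]; exact inferInstanceAs (IsMarkovKernel (Kernel.id : Kernel E E))
  | succ n ih => rw [pow_succ]; exact inferInstanceAs (IsMarkovKernel ((Q ^ n) ∘ₖ Q))

/-- The iterates of a kernel, jointly in the starting point and the number of steps. -/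
def powKernel (Q : Kernel E E) : Kernel (E × ℕ) E :=
  ⟨fun p => (Q ^ p.2) p.1, measurable_from_prod_countable_left fun n => (Q ^ n).measurable⟩

instance (Q : Kernel E E) [IsMarkovKernel Q] : IsMarkovKernel (powKernel Q) :=
  ⟨fun p => inferInstanceAs (IsProbabilityMeasure ((Q ^ p.2) p.1))⟩

/-- The kernel `∑ₙ e^{-r} rⁿ / n! Qⁿ`. -/
def poissonMix (Q : Kernel E E) (r : ℝ≥0) : Kernel E E :=
  powKernel Q ∘ₖ (Kernel.id ×ₖ Kernel.const E (poissonMeasure r))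

instance (Q : Kernel E E) [IsMarkovKernel Q] (r : ℝ≥0) : IsMarkovKernel (poissonMix Q r) := by
  unfold poissonMix; infer_instance

theorem lintegral_poissonMix (Q : Kernel E E) [IsMarkovKernel Q] (r : ℝ≥0) (x : E) {f : E → ℝ≥0∞}
    (hf : Measurable f) :
    ∫⁻ y, f y ∂(poissonMix Q r x) = ∫⁻ n, ∫⁻ y, f y ∂((Q ^ n) x) ∂(poissonMeasure r) := by
  rw [poissonMix, Kernel.lintegral_comp _ _ _ hf, Kernel.prod_apply, Kernel.id_apply,
    Kernel.const_apply, lintegral_prod, lintegral_dirac']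
  · rfl
  · exact (hf.lintegral_kernel (κ := powKernel Q)).lintegral_prod_right'
  · exact (hf.lintegral_kernel (κ := powKernel Q)).aemeasurable

theorem integral_poissonMix (Q : Kernel E E) [IsMarkovKernel Q] (r : ℝ≥0) (x : E) {f : E → ℝ}
    (hf : f ∈ boundedMeasurable E) :
    ∫ y, f y ∂(poissonMix Q r x) = ∫ n, ∫ y, f y ∂((Q ^ n) x) ∂(poissonMeasure r) := by
  have h : Integrable f ((powKernel Q ∘ₖ (Kernel.id ×ₖ Kernel.const E (poissonMeasure r))) x) :=
    integrable_of_boundedMeasurable hf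
  rw [poissonMix, Kernel.integral_comp h, Kernel.prod_apply, Kernel.id_apply,
    Kernel.const_apply, Measure.dirac_prod, integral_map (by fun_prop)]
  · rfl
  · exact (hf.1.stronglyMeasurable.integral_kernel (κ := powKernel Q)).aestronglyMeasurable

/-- Chapman–Kolmogorov is the convolution identity for Poisson laws: numbers of steps in successive
time intervals add up. -/
theorem isMarkovianFamily_poissonMix (Q : Kernel E E) [IsMarkovKernel Q] (c : ℝ≥0) :
    IsMarkovianFamily fun t => poissonMix Q (c * t) where
  isMarkovKernel t := inferInstance
  zero x := by
    ext A hA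
    rw [← lintegral_indicator_one hA, mul_zero, lintegral_poissonMix _ _ _
      (measurable_one.indicator hA), lintegral_countable']
    rw [tsum_eq_single 0]
    · rw [pow_zero, lintegral_indicator_one hA]
      simp [poissonMeasure_singleton]
      rfl
    · intro n hn
      simp [poissonMeasure_singleton, hn]
  chapman_kolmogorov s t x A hA := by
    have h1 : ∀ r y, poissonMix Q r y A = ∫⁻ n, (Q ^ n) y A ∂(poissonMeasure r) := fun r y => by
      rw [← lintegral_indicator_one hA, lintegral_poissonMix _ _ _ (measurable_one.indicator hA)]
      simp only [lintegral_indicator_one hA]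
    rw [h1, mul_add, ← poissonMeasure_conv_poissonMeasure, Measure.lintegral_conv (by fun_prop),
      lintegral_poissonMix _ _ _ (Kernel.measurable_coe _ hA)]
    refine lintegral_congr fun n => ?_
    simp only [h1]
    rw [lintegral_lintegral_swap]
    · refine lintegral_congr fun m => ?_
      rw [add_comm, pow_add]
      exact (Kernel.comp_apply' _ _ _ hA).symm
    · exact ((powKernel Q).measurable_coe hA).aemeasurable

/-- Separate zero, one, and at least two Poisson steps. The three errors add up to `2 M r (1 -
e^{-r})`, and `1 - e^{-r} ≤ r`. -/
theorem abs_poissonMix_sub_le (Q : Kernel E E) [IsMarkovKernel Q] (r : ℝ≥0) (x : E) {f : E → ℝ}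
    (hf : Measurable f) {M : ℝ} (hM : ∀ x, |f x| ≤ M) :
    |∫ y, f y ∂(poissonMix Q r x) - f x - r * (∫ y, f y ∂(Q x) - f x)| ≤ 2 * M * r ^ 2 := by
  have hfb : f ∈ boundedMeasurable E := ⟨hf, M, hM⟩
  rw [integral_poissonMix Q r x hfb]
  set F : ℕ → ℝ := fun n => ∫ y, f y ∂((Q ^ n) x) with hF
  have hF0 : F 0 = f x := by
    simp only [hF, pow_zero]
    exact integral_dirac' _ _ hf.stronglyMeasurable
  have hF1 : F 1 = ∫ y, f y ∂(Q x) := by simp only [hF, pow_one]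
  have hFM : ∀ n, |F n| ≤ M := fun n => abs_integral_le_of_abs_le hM
  have hFi : Integrable F (poissonMeasure r) :=
    integrable_of_boundedMeasurable ⟨measurable_of_countable _, M, hFM⟩
  set S : Finset ℕ := {0, 1}
  have hsplit := integral_add_compl (μ := poissonMeasure r) S.measurableSet hFi
  rw [setIntegral_finset S hFi.integrableOn] at hsplit
  have hp0 : (poissonMeasure r).real {0} = Real.exp (-r) := by
    simp [poissonMeasure_real_singleton]
  have hp1 : (poissonMeasure r).real {1} = Real.exp (-r) * r := by
    simp [poissonMeasure_real_singleton]
  have hsum : ∑ n ∈ S, (poissonMeasure r).real {n} • F n =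
      Real.exp (-r) * F 0 + Real.exp (-r) * r * F 1 := by
    simp [S, hp0, hp1]
  have hS : (poissonMeasure r).real (S : Set ℕ)ᶜ = 1 - (Real.exp (-r) + Real.exp (-r) * r) := by
    rw [probReal_compl_eq_one_sub S.measurableSet, ← sum_measureReal_singleton]
    simp [S, hp0, hp1]
  have hrest : |∫ n in (S : Set ℕ)ᶜ, F n ∂(poissonMeasure r)| ≤
      M * (1 - (Real.exp (-r) + Real.exp (-r) * r)) := by
    have := norm_setIntegral_le_of_norm_le_const (μ := poissonMeasure r) (s := (S : Set ℕ)ᶜ)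
      (f := F) (C := M) (measure_lt_top _ _) fun n _ => hFM n
    rwa [hS] at this
  rw [← hsplit, hsum, ← hF0, ← hF1]
  set R := ∫ n in (S : Set ℕ)ᶜ, F n ∂(poissonMeasure r)
  have hr : (0 : ℝ) ≤ r := r.2
  set e := Real.exp (-r)
  have he1 : 1 - (r : ℝ) ≤ e := Real.one_sub_le_exp_neg _
  have he2 : e ≤ 1 := Real.exp_le_one_iff.2 (by linarith)
  have h0 := hFM 0
  have h1 := hFM 1
  have hM0 : 0 ≤ M := (abs_nonneg _).trans h0
  have e1 : e * F 0 + e * r * F 1 + R - F 0 - r * (F 1 - F 0) =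
      (e - 1 + r) * F 0 + (e * r - r) * F 1 + R := by ring
  rw [e1]
  have b1 : |(e - 1 + r) * F 0| ≤ (e - 1 + r) * M := by
    rw [abs_mul, abs_of_nonneg (by linarith : 0 ≤ e - 1 + r)]
    exact mul_le_mul_of_nonneg_left h0 (by linarith)
  have b2 : |(e * r - r) * F 1| ≤ (r - e * r) * M := by
    rw [abs_mul, abs_sub_comm, abs_of_nonneg (by nlinarith : 0 ≤ r - e * r)]
    exact mul_le_mul_of_nonneg_left h1 (by nlinarith)
  have b3 := abs_add_three ((e - 1 + r) * F 0) ((e * r - r) * F 1) R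
  have b4 : r * (1 - e) * M ≤ r * r * M := by gcongr; linarith
  nlinarith

/-- Existence of the pure jump process with jump kernel `R` of bounded total rate. -/
theorem exists_isMarkovianFamily_of_rate (R : Kernel E E) (c : ℝ≥0) (hc : 0 < c)
    (hR : ∀ x, R x Set.univ ≤ c) : ∃ μ : ℝ≥0 → Kernel E E, IsMarkovianFamily μ ∧
      HasGeneratorOn μ (fun f x => ∫ y, (f y - f x) ∂(R x)) (boundedMeasurable E) := by
  have hfinite : IsFiniteKernel R := ⟨⟨c, ENNReal.coe_lt_top, hR⟩⟩
  have hmeas : Measurable fun x => 1 - (c : ℝ≥0∞)⁻¹ * R x Set.univ :=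
    measurable_const.sub ((R.measurable_coe MeasurableSet.univ).const_mul _)
  have hc0 : (c : ℝ≥0∞) ≠ 0 := by exact_mod_cast hc.ne'
  -- Uniformisation: jumps are attempted at the constant rate `c`, and the shortfall of the true
  -- rate becomes a probability of staying put, so that `c (Q - 1)` is the required generator.
  let Q : Kernel E E := ⟨fun x => (c : ℝ≥0∞)⁻¹ • R x +
    (1 - (c : ℝ≥0∞)⁻¹ * R x Set.univ) • Measure.dirac x, by
      refine Measure.measurable_of_measurable_coe _ fun A hA => ?_
      simp only [Measure.coe_add, Measure.coe_smul, Pi.add_apply, Pi.smul_apply, smul_eq_mul]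
      refine ((R.measurable_coe hA).const_mul _).add (hmeas.mul ?_)
      exact (Kernel.id (α := E)).measurable_coe hA⟩
  have hQ : ∀ x, Q x = (c : ℝ≥0∞)⁻¹ • R x +
    (1 - (c : ℝ≥0∞)⁻¹ * R x Set.univ) • Measure.dirac x := fun x => rfl
  have hle : ∀ x, (c : ℝ≥0∞)⁻¹ * R x Set.univ ≤ 1 := fun x => by
    rw [← ENNReal.inv_mul_cancel hc0 ENNReal.coe_ne_top]
    gcongr
    exact hR x
  have hQM : IsMarkovKernel Q := ⟨fun x => ⟨by
    rw [hQ]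
    simp only [Measure.coe_add, Measure.coe_smul, Pi.add_apply, Pi.smul_apply, smul_eq_mul,
      measure_univ, mul_one]
    exact add_tsub_cancel_of_le (hle x)⟩⟩
  have hgen : ∀ f ∈ boundedMeasurable E, ∀ x,
      (c : ℝ) * (∫ y, f y ∂(Q x) - f x) = ∫ y, (f y - f x) ∂(R x) := by
    intro f hf x
    have hfi : ∀ m : Measure E, IsFiniteMeasure m → Integrable f m := fun m _ =>
      integrable_of_boundedMeasurable hf
    rw [integral_sub (hfi _ inferInstance) (integrable_const _), integral_const, hQ,
      integral_add_measure, integral_smul_measure, integral_smul_measure, integral_dirac' _ _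
        hf.1.stronglyMeasurable, ENNReal.toReal_sub_of_le (hle x) (by simp), ENNReal.toReal_mul,
        ENNReal.toReal_inv]
    · have : (c : ℝ) ≠ 0 := by exact_mod_cast hc.ne'
      simp only [ENNReal.coe_toReal, smul_eq_mul, ENNReal.toReal_one, measureReal_def]
      field_simp
      ring
    · exact (hfi _ inferInstance).smul_measure (by simp [hc.ne'])
    · exact (hfi _ inferInstance).smul_measure (by simp)
  refine ⟨_, isMarkovianFamily_poissonMix Q c, fun f hf => ?_⟩
  obtain ⟨hm, M, hM⟩ := id hf
  rw [Metric.tendstoUniformly_iff]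
  intro ε hε
  rw [eventually_nhdsWithin_iff, Metric.eventually_nhds_iff]
  refine ⟨ε / (2 * |M| * c ^ 2 + 1), by positivity, fun t ht ht0 x => ?_⟩
  have ht' : 0 < (t : ℝ) := by exact_mod_cast ht0
  have htε : (t : ℝ) * (2 * |M| * c ^ 2 + 1) < ε := by
    rw [NNReal.dist_eq, NNReal.coe_zero, sub_zero, abs_of_pos ht'] at ht
    rwa [lt_div_iff₀ (by positivity)] at ht
  have h := abs_poissonMix_sub_le Q (c * t) x hm hM
  rw [dist_comm, Real.dist_eq]
  simp only [semigroup, ← hgen f hf x]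
  set I := ∫ y, f y ∂(poissonMix Q (c * t) x)
  set J := ∫ y, f y ∂(Q x)
  have e1 : (t : ℝ)⁻¹ * (I - f x) - c * (J - f x) =
      (t : ℝ)⁻¹ * (I - f x - (c * t : ℝ≥0) * (J - f x)) := by
    push_cast; field_simp
  rw [e1, abs_mul, abs_of_pos (inv_pos.2 ht'), inv_mul_lt_iff₀ ht']
  refine h.trans_lt ?_
  push_cast
  have : 2 * M * (c * t : ℝ) ^ 2 ≤ t * (t * (2 * |M| * c ^ 2)) := by
    have := mul_le_mul_of_nonneg_right (le_abs_self M) (by positivity : 0 ≤ 2 * (c * t : ℝ) ^ 2)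
    nlinarith
  refine this.trans_lt (mul_lt_mul_of_pos_left ?_ ht')
  nlinarith

end Uniformization

/-! ### The jump process in a finite window -/

section Window

variable {V X : Type*} {𝒢 : SimpleGraph V} [MeasurableSpace X]
  {α : ∀ v, Kernel (nbhd 𝒢 v → X) (nbhd 𝒢 v → X)} {K : ℝ≥0}

/-- The jump kernel on global configurations induced by the rates at `v`. -/
def siteKernel (α : ∀ v, Kernel (nbhd 𝒢 v → X) (nbhd 𝒢 v → X)) [∀ v, IsFiniteKernel (α v)]
    (v : V) : Kernel (V → X) (V → X) :=
  (Kernel.id ×ₖ (α v).comap _ (measurable_restrict_nbhd v)).map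
    fun p => patch 𝒢 v p.1 p.2

theorem siteKernel_apply [∀ v, IsFiniteKernel (α v)] (v : V) (x : V → X) :
    siteKernel α v x = (α v fun w => x w).map (patch 𝒢 v x) := by
  rw [siteKernel, Kernel.map_apply _ (measurable_patch v), Kernel.prod_apply, Kernel.id_apply,
    Kernel.comap_apply, Measure.dirac_prod, Measure.map_map (measurable_patch v) (by fun_prop)]
  rfl

theorem exists_isWindowFamily (hK : ∀ v x, α v x Set.univ ≤ K) (W : Finset V) :
    ∃ μ, IsWindowFamily α W μ := by
  have := isFiniteKernel_of_le hK
  have hpm : ∀ v x, Measurable (patch 𝒢 v x : (nbhd 𝒢 v → X) → V → X) := fun v x =>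
    (measurable_patch v).comp measurable_prodMk_left
  obtain ⟨μ, hμ, hG⟩ := exists_isMarkovianFamily_of_rate (∑ v ∈ W, siteKernel α v)
    -- The added 1 keeps the rate positive when `W` is empty or `K = 0`.
    (W.card * K + 1) (by positivity) fun x => by
      rw [FunLike.coe_sum, Finset.sum_apply, Measure.finsetSum_apply]
      calc ∑ v ∈ W, siteKernel α v x Set.univ ≤ ∑ v ∈ W, (K : ℝ≥0∞) :=
            Finset.sum_le_sum fun v _ => by
              rw [siteKernel_apply, Measure.map_apply (hpm v x) MeasurableSet.univ]
              exact hK v _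
        _ ≤ _ := by
              rw [Finset.sum_const, nsmul_eq_mul]
              push_cast
              exact le_self_add
  refine ⟨μ, hμ, fun f hf => ?_⟩
  convert hG f hf using 1
  ext x
  simp only [gen_coe_finset, FunLike.coe_sum, Finset.sum_apply]
  rw [integral_finsetSum_measure]
  · refine Finset.sum_congr rfl fun v _ => ?_
    rw [siteKernel_apply, siteGen_eq, integral_map (hpm v x).aemeasurable]
    exact (hf.1.sub measurable_const).aestronglyMeasurable
  · intro v _
    rw [siteKernel_apply]
    exact integrable_of_boundedMeasurable
      (boundedMeasurable_sub hf ⟨measurable_const, |f x|, by simp⟩)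

theorem tendsto_pow_div_factorial_mul (t c M : ℝ) :
    Tendsto (fun n : ℕ => t ^ n / n.factorial * (c ^ n * M)) atTop (𝓝 0) := by
  have := (FloorSemiring.tendsto_pow_div_factorial_atTop (t * c)).mul_const M
  rw [zero_mul] at this
  refine this.congr fun n => ?_
  rw [mul_pow]; ring

/-- The exponential series of the semigroup in a finite window. -/
theorem tendsto_taylor_window (hK : ∀ v x, α v x Set.univ ≤ K) {W : Finset V}
    {μ : ℝ≥0 → Kernel (V → X) (V → X)} (hμ : IsWindowFamily α W μ) (t : ℝ≥0)
    {f : (V → X) → ℝ} (hf : f ∈ boundedMeasurable (V → X)) (x : V → X) :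
    Tendsto (fun n => ∑ k ∈ Finset.range n,
      (t : ℝ) ^ k / k.factorial * ((gen α (W : Set V))^[k] f) x) atTop
      (𝓝 (semigroup μ t f x)) := by
  have := isFiniteKernel_of_le hK
  obtain ⟨-, M, hM⟩ := id hf
  -- In a finite window the generator is a bounded operator, so its iterates grow only geometrically
  -- and the series converges for all times and all bounded measurable functions.
  have hbd : ∀ n x, |((gen α (W : Set V))^[n] f) x| ≤ (2 * K * W.card) ^ n * M := by
    intro n
    induction n with
    | zero => simpa using hM
    | succ n ih =>
      intro x
      rw [Function.iterate_succ_apply']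
      refine (abs_gen_le hK W ih x).trans_eq ?_
      ring
  have h0 := tendsto_pow_div_factorial_mul (t : ℝ) (2 * K * W.card) M
  rw [← tendsto_sub_nhds_zero_iff]
  refine squeeze_zero_norm (fun n => ?_) h0
  rw [Real.norm_eq_abs, abs_sub_comm]
  exact abs_semigroup_sub_taylor_le hμ.1 hμ.2 subset_rfl
    (fun f hf => gen_mem_boundedMeasurable hK W hf) n hf (hbd n) t x

theorem existsUnique_isWindowFamily (hK : ∀ v x, α v x Set.univ ≤ K) (W : Finset V) :
    ∃! μ, IsWindowFamily α W μ := by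
  obtain ⟨μ, hμ⟩ := exists_isWindowFamily hK W
  refine ⟨μ, hμ, fun μ' hμ' => funext fun t => ?_⟩
  exact kernel_eq_of_semigroup_eq hμ'.1 hμ.1 t fun f hf => funext fun x =>
    tendsto_nhds_unique (tendsto_taylor_window hK hμ' t hf x) (tendsto_taylor_window hK hμ t hf x)

end Window

/-! ### Cylinder functions determine measures -/

section CylinderFun

variable {V X : Type*} [MeasurableSpace X]

theorem cylinderFun_subset_boundedMeasurable : cylinderFun V X ⊆ boundedMeasurable (V → X) :=
  fun _ hf => hf.1

theorem indicator_cylinder_mem_cylinderFun {A : Finset V} {S : Set (A → X)}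
    (hS : MeasurableSet S) :
    (cylinder A S).indicator (fun _ => (1 : ℝ)) ∈ cylinderFun V X := by
  refine ⟨boundedMeasurable_indicator (hS.cylinder A), A, fun x y h => ?_⟩
  have : x ∈ cylinder A S ↔ y ∈ cylinder A S := by
    simp only [mem_cylinder]
    rw [show A.restrict x = A.restrict y from funext fun w => h w w.2]
  by_cases hx : x ∈ cylinder A S
  · simp [hx, this.1 hx]
  · rw [Set.indicator_of_notMem hx, Set.indicator_of_notMem (mt this.2 hx)]

theorem measure_ext_of_cylinderFun {m m' : Measure (V → X)} [IsFiniteMeasure m]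
    [IsFiniteMeasure m'] (h : ∀ f ∈ cylinderFun V X, ∫ x, f x ∂m = ∫ x, f x ∂m') : m = m' := by
  have key : ∀ S ∈ measurableCylinders fun _ : V => X, m S = m' S := by
    intro S hS
    obtain ⟨A, T, hT, rfl⟩ := (mem_measurableCylinders _).1 hS
    have := h _ (indicator_cylinder_mem_cylinderFun hT)
    have hC : MeasurableSet (cylinder (α := fun _ : V => X) A T) := hT.cylinder A
    simp only [integral_indicator_const _ hC, smul_eq_mul, mul_one] at this
    exact (measureReal_eq_measureReal_iff).1 this
  exact ext_of_generate_finite _ generateFrom_measurableCylinders.symm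
    isPiSystem_measurableCylinders key (key _ (univ_mem_measurableCylinders _))

end CylinderFun

/-! ### Iterates of the generator on cylinder functions -/

section Iterates

variable {V X : Type*} {𝒢 : SimpleGraph V} [MeasurableSpace X]
  {α : ∀ v, Kernel (nbhd 𝒢 v → X) (nbhd 𝒢 v → X)} {K : ℝ≥0} {nb : V → Finset V} {b : ℕ}

/-- Finite sums of measurable functions depending on at most `a` sites each, where `M` bounds the
sum of the sup norms of the summands. -/
inductive LocalSum (V X : Type*) [MeasurableSpace X] (a : ℕ) : ℝ → ((V → X) → ℝ) → Prop
  | of {M : ℝ} {f : (V → X) → ℝ} (A : Finset V) (hA : A.card ≤ a) (hm : Measurable f)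
      (hd : DependsOn f (A : Set V)) (h0 : 0 ≤ M) (hM : ∀ x, |f x| ≤ M) : LocalSum V X a M f
  | add {M N : ℝ} {f g : (V → X) → ℝ} (hf : LocalSum V X a M f) (hg : LocalSum V X a N g) :
      LocalSum V X a (M + N) fun x => f x + g x

namespace LocalSum

variable {a : ℕ} {M : ℝ} {f : (V → X) → ℝ}

theorem abs_le (h : LocalSum V X a M f) (x : V → X) : |f x| ≤ M := by
  induction h with
  | of A hA hm hd h0 hM => exact hM x
  | add hf hg ihf ihg => exact (abs_add_le _ _).trans (add_le_add ihf ihg)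

theorem mono (h : LocalSum V X a M f) {M' : ℝ} (hM' : M ≤ M') : LocalSum V X a M' f := by
  induction h generalizing M' with
  | of A hA hm hd h0 hM => exact .of A hA hm hd (h0.trans hM') fun x => (hM x).trans hM'
  | @add M N f g hf hg ihf ihg =>
    have := (ihf (M' := M' - N) (by linarith)).add hg
    rwa [sub_add_cancel] at this

theorem mem_cylinderFun (h : LocalSum V X a M f) : f ∈ cylinderFun V X := by
  classical
  induction h with
  | of A hA hm hd h0 hM => exact ⟨⟨hm, _, hM⟩, A, hd⟩
  | add hf hg ihf ihg =>
    obtain ⟨hf, A, hA⟩ := ihf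
    obtain ⟨hg, B, hB⟩ := ihg
    refine ⟨boundedMeasurable_add hf hg, A ∪ B, fun x y h => ?_⟩
    simp only [hA fun w hw => h w (by simp [Finset.mem_coe.1 hw]),
      hB fun w hw => h w (by simp [Finset.mem_coe.1 hw])]

theorem sum {ι : Type*} (s : Finset ι) {F : ι → (V → X) → ℝ}
    (h : ∀ i ∈ s, LocalSum V X a M (F i)) :
    LocalSum V X a (s.card * M) fun x => ∑ i ∈ s, F i x := by
  classical
  induction s using Finset.induction_on with
  | empty =>
    simp only [Finset.card_empty, Nat.cast_zero, zero_mul, Finset.sum_empty]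
    exact .of ∅ (by simp) measurable_const (fun _ _ _ => rfl) le_rfl (by simp)
  | insert i s hi ih =>
    simp only [Finset.sum_insert hi]
    have := (h i (by simp)).add (ih fun j hj => h j (by simp [hj]))
    rwa [show M + s.card * M = ((insert i s).card : ℝ) * M by
      rw [Finset.card_insert_of_notMem hi]; push_cast; ring] at this

/-- Treating the summands `G_v f` separately keeps the growth of supports additive: each sees at
most `b` further sites, whereas the set on which the whole sum depends can grow by a factor at every
step. At most `a b` sites touch the support, and each contributes norm at most `2 K M`. -/
theorem gen (hnb : IsNbhdFinset 𝒢 nb b) (hK : ∀ v x, α v x Set.univ ≤ K) (W : Set V)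
    (h : LocalSum V X a M f) : LocalSum V X (a + b) (2 * K * (a * b) * M) (gen α W f) := by
  classical
  have := isFiniteKernel_of_le hK
  induction h with
  | @of M f A hA hm hd h0 hM =>
    rw [show LocalIPS.gen α W f = _ from funext (gen_eq_sum_touch hnb W hd)]
    have hv : ∀ v ∈ (touch nb A).filter (· ∈ W), LocalSum V X (a + b) (2 * K * M)
        (siteGen α v f) := fun v _ => by
      refine .of (A ∪ nb v) ((Finset.card_union_le _ _).trans (add_le_add hA (hnb.card_le v)))
        (measurable_siteGen v hm) ?_ (by positivity) (abs_siteGen_le hK v hM)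
      refine (dependsOn_siteGen v hd).mono fun w hw => ?_
      simpa [hnb.mem_iff] using hw
    refine (LocalSum.sum _ hv).mono ?_
    have hcard : (((touch nb A).filter (· ∈ W)).card : ℝ) ≤ a * b := by
      exact_mod_cast (Finset.card_filter_le _ _).trans ((card_touch_le hnb A).trans
        (Nat.mul_le_mul_right b hA))
    calc _ ≤ (a * b : ℝ) * (2 * K * M) := by gcongr
      _ = _ := by ring
  | @add M N f g hf hg ihf ihg =>
    rw [show LocalIPS.gen α W (fun x => f x + g x) = _ from
      funext (gen_add hnb W hf.mem_cylinderFun hg.mem_cylinderFun), mul_add]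
    exact ihf.add ihg

theorem iterate_gen (hnb : IsNbhdFinset 𝒢 nb b) (hK : ∀ v x, α v x Set.univ ≤ K) (W : Set V)
    (h : LocalSum V X a M f) (n : ℕ) : LocalSum V X (a + n * b)
      ((∏ k ∈ Finset.range n, (2 * K * ((a + k * b) * b) : ℝ)) * M) ((LocalIPS.gen α W)^[n] f) := by
  induction n with
  | zero => simpa using h
  | succ n ih =>
    rw [Function.iterate_succ_apply', Finset.prod_range_succ]
    have := ih.gen hnb hK W
    rw [show a + (n + 1) * b = a + n * b + b by ring]
    convert this using 1
    push_cast
    ring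

end LocalSum

/-- Each factor is at most a constant times `a + 1 + k`, and the product of the latter is `n!` times
the binomial coefficient of `a + n` over `n`, at most `2 ^ (a + n)`. The support size `a` enters
only through the prefactor `2 ^ a`, which is why the radius of convergence does not depend on the
function. -/
theorem prod_range_rate_le (a b n : ℕ) (K : ℝ≥0) :
    ∏ k ∈ Finset.range n, (2 * K * ((a + k * b) * b) : ℝ) ≤
      (4 * K * (b + 1) ^ 2) ^ n * (n.factorial * 2 ^ a) := by
  have h1 : ∏ k ∈ Finset.range n, (2 * K * ((a + k * b) * b) : ℝ) ≤
      ∏ k ∈ Finset.range n, (2 * K * (b + 1) ^ 2 : ℝ) * ((a + 1 + k : ℕ) : ℝ) := by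
    refine Finset.prod_le_prod (fun k _ => by positivity) fun k _ => ?_
    push_cast
    have : ((a + k * b) * b : ℝ) ≤ (b + 1) ^ 2 * (a + 1 + k) := by
      have ha : (0 : ℝ) ≤ a := by positivity
      have hb : (0 : ℝ) ≤ b := by positivity
      have hk : (0 : ℝ) ≤ k := by positivity
      have := mul_nonneg ha hb
      have := mul_nonneg (mul_nonneg ha hb) hb
      have := mul_nonneg hk hb
      nlinarith
    have hK : (0 : ℝ) ≤ 2 * K := by positivity
    nlinarith
  refine h1.trans ?_
  rw [Finset.prod_mul_distrib, Finset.prod_const, Finset.card_range, ← Nat.cast_prod,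
    ← Nat.ascFactorial_eq_prod_range, Nat.ascFactorial_eq_factorial_mul_choose]
  have h2 : ((a + n).choose n : ℝ) ≤ 2 ^ a * 2 ^ n := by
    rw [← pow_add]
    exact_mod_cast Nat.choose_le_two_pow (a + n) n
  push_cast
  calc (2 * K * (b + 1) ^ 2 : ℝ) ^ n * (n.factorial * ((a + n).choose n : ℝ))
      ≤ (2 * K * (b + 1) ^ 2 : ℝ) ^ n * (n.factorial * (2 ^ a * 2 ^ n)) := by gcongr
    _ = ((2 * K * (b + 1) ^ 2) * 2 : ℝ) ^ n * (n.factorial * 2 ^ a) := by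
        rw [mul_pow _ (2 : ℝ)]; ring
    _ = _ := by
        rw [show (2 * K * (b + 1) ^ 2 * 2 : ℝ) = 4 * K * (b + 1) ^ 2 by ring]

theorem abs_iterate_gen_le (hnb : IsNbhdFinset 𝒢 nb b) (hK : ∀ v x, α v x Set.univ ≤ K)
    (W : Set V) {A : Finset V} {f : (V → X) → ℝ} (hm : Measurable f)
    (hd : DependsOn f (A : Set V)) {M : ℝ} (h0 : 0 ≤ M) (hM : ∀ x, |f x| ≤ M) (n : ℕ)
    (x : V → X) :
    |((gen α W)^[n] f) x| ≤ (4 * K * (b + 1) ^ 2) ^ n * (n.factorial * 2 ^ A.card) * M :=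
  (((LocalSum.of A le_rfl hm hd h0 hM).iterate_gen hnb hK W n).abs_le x).trans
    (mul_le_mul_of_nonneg_right (prod_range_rate_le _ _ _ _) h0)

/-- A time up to which the Taylor series of cylinder functions converge geometrically. -/
def shortTime (K : ℝ≥0) (b : ℕ) : ℝ≥0 := (8 * K * (b + 1) ^ 2 + 1)⁻¹

theorem shortTime_pos (K : ℝ≥0) (b : ℕ) : 0 < shortTime K b := by
  unfold shortTime; positivity

/-- The 8 in `shortTime` is twice the growth constant 4, which leaves the ratio 1/2; the added 1
avoids division by zero when `K = 0`. -/
theorem rate_mul_le_half {t : ℝ≥0} (ht : t ≤ shortTime K b) :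
    (t : ℝ) * (4 * K * (b + 1) ^ 2) ≤ 1 / 2 := by
  have h : (t : ℝ) ≤ (8 * K * (b + 1) ^ 2 + 1 : ℝ)⁻¹ := by
    have : ((shortTime K b : ℝ≥0) : ℝ) = (8 * K * (b + 1) ^ 2 + 1 : ℝ)⁻¹ := by
      simp [shortTime]
    exact this ▸ NNReal.coe_le_coe.2 ht
  have h1 : (t : ℝ) * (8 * K * (b + 1) ^ 2 + 1 : ℝ) ≤ 1 := by
    calc _ ≤ (8 * K * (b + 1) ^ 2 + 1 : ℝ)⁻¹ * (8 * K * (b + 1) ^ 2 + 1 : ℝ) := by gcongr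
      _ = 1 := inv_mul_cancel₀ (by positivity)
  have := t.2
  nlinarith

variable {μ : ℝ≥0 → Kernel (V → X) (V → X)} {W : Set V}

/-- The `n!` in the bound on the iterates cancels against the one in Taylor's remainder. -/
theorem abs_semigroup_sub_taylor_le_geometric (hnb : IsNbhdFinset 𝒢 nb b)
    (hK : ∀ v x, α v x Set.univ ≤ K) (hμ : IsMarkovianFamily μ)
    (hG : HasGeneratorOn μ (gen α W) (cylinderFun V X)) {t : ℝ≥0} (ht : t ≤ shortTime K b)
    {A : Finset V} {f : (V → X) → ℝ} (hm : Measurable f) (hd : DependsOn f (A : Set V)) {M : ℝ}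
    (h0 : 0 ≤ M) (hM : ∀ x, |f x| ≤ M) (n : ℕ) (x : V → X) :
    |semigroup μ t f x - ∑ k ∈ Finset.range n, (t : ℝ) ^ k / k.factorial * ((gen α W)^[k] f) x|
      ≤ (1 / 2) ^ n * (2 ^ A.card * M) := by
  have := isFiniteKernel_of_le hK
  refine (abs_semigroup_sub_taylor_le hμ hG cylinderFun_subset_boundedMeasurable
    (fun f hf => gen_mem_cylinderFun hnb hK W hf) n ⟨⟨hm, M, hM⟩, A, hd⟩
    (abs_iterate_gen_le hnb hK W hm hd h0 hM n) t x).trans ?_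
  have h1 := pow_le_pow_left₀ (by positivity) (rate_mul_le_half ht) n
  rw [mul_pow] at h1
  have h2 : (n.factorial : ℝ) ≠ 0 := by positivity
  calc _ = (t : ℝ) ^ n * (4 * K * (b + 1) ^ 2) ^ n * (2 ^ A.card * M) := by field_simp
    _ ≤ _ := by gcongr

theorem tendsto_taylor_cylinder (hnb : IsNbhdFinset 𝒢 nb b)
    (hK : ∀ v x, α v x Set.univ ≤ K) (hμ : IsMarkovianFamily μ)
    (hG : HasGeneratorOn μ (gen α W) (cylinderFun V X)) {t : ℝ≥0} (ht : t ≤ shortTime K b)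
    {f : (V → X) → ℝ} (hf : f ∈ cylinderFun V X) (x : V → X) :
    Tendsto (fun n => ∑ k ∈ Finset.range n, (t : ℝ) ^ k / k.factorial * ((gen α W)^[k] f) x)
      atTop (𝓝 (semigroup μ t f x)) := by
  obtain ⟨⟨hm, M, hM⟩, A, hA⟩ := hf
  have h0 : Tendsto (fun n : ℕ => (1 / 2 : ℝ) ^ n * (2 ^ A.card * M)) atTop (𝓝 0) := by
    simpa using (tendsto_pow_atTop_nhds_zero_of_lt_one (by norm_num : (0 : ℝ) ≤ 1 / 2)
      (by norm_num)).mul_const (2 ^ A.card * M)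
  rw [← tendsto_sub_nhds_zero_iff]
  refine squeeze_zero_norm (fun n => ?_) h0
  rw [Real.norm_eq_abs, abs_sub_comm]
  exact abs_semigroup_sub_taylor_le_geometric hnb hK hμ hG ht hm hA
    ((abs_nonneg _).trans (hM x)) hM n x

/-- A Markovian family is determined by its generator on cylinder functions. -/
theorem eq_of_hasGeneratorOn_cylinderFun (hnb : IsNbhdFinset 𝒢 nb b)
    (hK : ∀ v x, α v x Set.univ ≤ K) {μ' : ℝ≥0 → Kernel (V → X) (V → X)}
    (hμ : IsMarkovianFamily μ) (hG : HasGeneratorOn μ (gen α W) (cylinderFun V X))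
    (hμ' : IsMarkovianFamily μ') (hG' : HasGeneratorOn μ' (gen α W) (cylinderFun V X)) :
    μ = μ' := by
  have short : ∀ t ≤ shortTime K b, μ t = μ' t := fun t ht => by
    have := hμ.isMarkovKernel t
    have := hμ'.isMarkovKernel t
    ext1 x
    exact measure_ext_of_cylinderFun fun f hf => tendsto_nhds_unique
      (tendsto_taylor_cylinder hnb hK hμ hG ht hf x)
      (tendsto_taylor_cylinder hnb hK hμ' hG' ht hf x)
  -- The induction composes kernels rather than iterating on functions, because the semigroup need
  -- not map cylinder functions to cylinder functions.
  have step : ∀ n : ℕ, ∀ t ≤ n * shortTime K b, μ t = μ' t := by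
    intro n
    induction n with
    | zero => exact fun t ht => short t (ht.trans (by simp))
    | succ n ih =>
      intro t ht
      rcases le_total t (shortTime K b) with h | h
      · exact short t h
      · obtain ⟨s, rfl⟩ := exists_add_of_le h
        rw [← comp_eq_of_isMarkovianFamily hμ, ← comp_eq_of_isMarkovianFamily hμ',
          short _ le_rfl, ih s]
        push_cast at ht
        rw [add_mul, one_mul, add_comm] at ht
        exact le_of_add_le_add_right ht
  ext1 t
  obtain ⟨n, hn⟩ := exists_nat_ge (t / shortTime K b)
  exact step n t ((div_le_iff₀ (shortTime_pos K b)).1 hn)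

end Iterates

/-! ### Finite windows approximate one another -/

section Approximation

variable {V X : Type*} {𝒢 : SimpleGraph V} [MeasurableSpace X]
  {α : ∀ v, Kernel (nbhd 𝒢 v → X) (nbhd 𝒢 v → X)} {K : ℝ≥0} {nb : V → Finset V} {b : ℕ}

theorem HasGeneratorOn.mono {E : Type*} [MeasurableSpace E] {μ : ℝ≥0 → Kernel E E}
    {L : (E → ℝ) → E → ℝ} {𝒟 𝒟' : Set (E → ℝ)} (h : HasGeneratorOn μ L 𝒟) (hs : 𝒟' ⊆ 𝒟) :
    HasGeneratorOn μ L 𝒟' := fun f hf => h f (hs hf)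

theorem dependsOn_iterate_gen_window (hnb : IsNbhdFinset 𝒢 nb b) (W : Finset V) {A : Set V}
    (hA : (touch nb W : Set V) ⊆ A) {f : (V → X) → ℝ} (hd : DependsOn f A) (n : ℕ) :
    DependsOn ((gen α (W : Set V))^[n] f) A := by
  induction n with
  | zero => exact hd
  | succ n ih =>
    rw [Function.iterate_succ_apply']
    intro x y h
    rw [gen_coe_finset, gen_coe_finset]
    refine Finset.sum_congr rfl fun v hv => dependsOn_siteGen v ih fun w hw => h w ?_
    exact hw.elim id fun hw => hA ((mem_touch hnb).2 ⟨v, hv, mem_nbhd_comm.1 hw⟩)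

/-- Sites of `W` read and write only inside `touch nb W`, so every term of the exponential series
depends on `A` alone. Consequently finite-window semigroups preserve cylinder functions. -/
theorem dependsOn_semigroup_window (hnb : IsNbhdFinset 𝒢 nb b) (hK : ∀ v x, α v x Set.univ ≤ K)
    {W : Finset V} {μ : ℝ≥0 → Kernel (V → X) (V → X)} (hμ : IsWindowFamily α W μ) (t : ℝ≥0)
    {A : Set V} (hA : (touch nb W : Set V) ⊆ A) {f : (V → X) → ℝ}
    (hf : f ∈ boundedMeasurable (V → X)) (hd : DependsOn f A) :
    DependsOn (semigroup μ t f) A := by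
  intro x y h
  refine tendsto_nhds_unique (tendsto_taylor_window hK hμ t hf x)
    ((tendsto_taylor_window hK hμ t hf y).congr fun n => Finset.sum_congr rfl fun k _ => ?_)
  rw [dependsOn_iterate_gen_window hnb W hA hd k h]

/-- Each application of the generator enlarges the support by finitely many sites. A window
containing every site that the first few iterates can involve is indistinguishable from `V`. The set
`B` depends on `A` and `n` but not on `f`, as the uniformity in `f` below requires. -/
theorem exists_iterate_gen_eq (hnb : IsNbhdFinset 𝒢 nb b) (A : Finset V) (n : ℕ) :
    ∃ B : Finset V, ∀ W : Set V, (B : Set V) ⊆ W → ∀ f : (V → X) → ℝ, DependsOn f (A : Set V) →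
      ∀ k < n, (gen α W)^[k] f = (gen α Set.univ)^[k] f := by
  classical
  have hdep : ∀ (f : (V → X) → ℝ), DependsOn f (A : Set V) → ∀ k,
      DependsOn ((gen α Set.univ)^[k] f) ((enlarge nb)^[k] A : Set V) := by
    intro f hf k
    induction k with
    | zero => exact hf
    | succ k ih =>
      rw [Function.iterate_succ_apply', Function.iterate_succ_apply']
      exact dependsOn_gen hnb _ ih
  refine ⟨(Finset.range n).biUnion fun k => touch nb ((enlarge nb)^[k] A), fun W hW f hf k hk => ?_⟩
  induction k with
  | zero => rfl
  | succ k ih =>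
    rw [Function.iterate_succ_apply', Function.iterate_succ_apply', ih (by omega)]
    refine gen_congr_of_touch_subset hnb (hdep f hf k) (subset_trans ?_ hW)
    exact_mod_cast Finset.subset_biUnion_of_mem (fun k => touch nb ((enlarge nb)^[k] A))
      (Finset.mem_range.2 (by omega : k < n))

/-- The semigroups in large finite windows are uniformly close on functions of finitely many
sites. -/
theorem exists_window_close (hnb : IsNbhdFinset 𝒢 nb b) (hK : ∀ v x, α v x Set.univ ≤ K)
    {win : Finset V → ℝ≥0 → Kernel (V → X) (V → X)} (hwin : ∀ W, IsWindowFamily α W (win W))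
    (t : ℝ≥0) (A : Finset V) {ε : ℝ} (hε : 0 < ε) :
    ∃ B : Finset V, ∀ W W' : Finset V, B ⊆ W → B ⊆ W' → ∀ f : (V → X) → ℝ, Measurable f →
      DependsOn f (A : Set V) → (∀ x, |f x| ≤ 1) → ∀ x,
      |semigroup (win W) t f x - semigroup (win W') t f x| ≤ ε := by
  classical
  have hG : ∀ W, HasGeneratorOn (win W) (gen α (W : Set V)) (cylinderFun V X) := fun W =>
    (hwin W).2.mono cylinderFun_subset_boundedMeasurable
  have short : ∀ t ≤ shortTime K b, ∀ (A : Finset V) (ε : ℝ), 0 < ε →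
    ∃ B : Finset V, ∀ W W' : Finset V, B ⊆ W → B ⊆ W' → ∀ f : (V → X) → ℝ, Measurable f →
      DependsOn f (A : Set V) → (∀ x, |f x| ≤ 1) → ∀ x,
      |semigroup (win W) t f x - semigroup (win W') t f x| ≤ ε := by
    intro t ht A ε hε
    -- With this `n` the Taylor remainder is at most `ε / 2` in every window, so two windows with
    -- the same first `n` terms differ by at most `ε`.
    obtain ⟨n, hn⟩ : ∃ n : ℕ, (1 / 2 : ℝ) ^ n < ε / (2 * 2 ^ A.card) :=
      exists_pow_lt_of_lt_one (by positivity) (by norm_num)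
    obtain ⟨B, hB⟩ := exists_iterate_gen_eq (X := X) (α := α) hnb A n
    refine ⟨B, fun W W' hW hW' f hm hd hM x => ?_⟩
    have hT : ∀ W : Finset V, B ⊆ W → |semigroup (win W) t f x - ∑ k ∈ Finset.range n,
        (t : ℝ) ^ k / k.factorial * ((gen α Set.univ)^[k] f) x| ≤ ε / 2 := by
      intro W hW
      have h := abs_semigroup_sub_taylor_le_geometric hnb hK (hwin W).1 (hG W) ht hm hd zero_le_one
        hM n x
      rw [lt_div_iff₀ (by positivity)] at hn
      rw [Finset.sum_congr rfl fun k hk => by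
        rw [← hB W (by exact_mod_cast hW) f hd k (Finset.mem_range.1 hk)]]
      linarith
    have h1 := hT W hW
    have h2 := hT W' hW'
    rw [abs_le] at *
    constructor <;> linarith [h1.1, h1.2, h2.1, h2.2]
  have step : ∀ n : ℕ, ∀ t ≤ n * shortTime K b, ∀ (A : Finset V) (ε : ℝ), 0 < ε →
    ∃ B : Finset V, ∀ W W' : Finset V, B ⊆ W → B ⊆ W' → ∀ f : (V → X) → ℝ, Measurable f →
      DependsOn f (A : Set V) → (∀ x, |f x| ≤ 1) → ∀ x,
      |semigroup (win W) t f x - semigroup (win W') t f x| ≤ ε := by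
    intro n
    induction n with
    | zero => exact fun t ht => short t (ht.trans (by simp))
    | succ n ih =>
      intro t ht A ε hε
      rcases le_total t (shortTime K b) with h | h
      · exact short t h A ε hε
      obtain ⟨r, rfl⟩ := exists_add_of_le h
      have hr : r ≤ n * shortTime K b := by
        push_cast at ht
        rw [add_mul, one_mul, add_comm] at ht
        exact le_of_add_le_add_right ht
      obtain ⟨B₁, hB₁⟩ := short _ le_rfl A (ε / 3) (by positivity)
      obtain ⟨B₂, hB₂⟩ := ih r hr (A ∪ touch nb B₁) (ε / 3) (by positivity)
      refine ⟨B₁ ∪ B₂, fun W W' hW hW' f hm hd hM x => ?_⟩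
      have hfb : f ∈ boundedMeasurable (V → X) := ⟨hm, 1, hM⟩
      -- In the window `W` the support of `P_δ f` may grow with `W`. It is replaced by its
      -- counterpart in the fixed window `B₁`, which lives on a finite set independent of `f`, `W`
      -- and `W'`, so that `B₂` could be chosen in advance.
      set g := semigroup (win B₁) (shortTime K b) f with hg
      have hgb : g ∈ boundedMeasurable (V → X) := boundedMeasurable_semigroup (hwin _).1 _ hfb
      have hgd : DependsOn g ((A ∪ touch nb B₁ : Finset V) : Set V) :=
        dependsOn_semigroup_window hnb hK (hwin _) _ (by simp) hfb (hd.mono (by simp))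
      have hgM : ∀ x, |g x| ≤ 1 := abs_semigroup_le (hwin _).1 _ hM
      have hc : ∀ W, B₁ ∪ B₂ ⊆ W →
          |semigroup (win W) (shortTime K b + r) f x - semigroup (win W) r g x| ≤ ε / 3 := by
        intro W hW
        rw [add_comm, semigroup_add (hwin W).1 _ _ hfb]
        exact abs_semigroup_sub_le (hwin W).1 _ (boundedMeasurable_semigroup (hwin W).1 _ hfb) hgb
          (fun y => hB₁ W B₁ (Finset.union_subset_left hW) subset_rfl f hm hd hM y) x
      have h1 := hc W hW
      have h2 := hc W' hW'
      have h3 := hB₂ W W' (Finset.union_subset_right hW) (Finset.union_subset_right hW') g hgb.1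
        hgd hgM x
      rw [abs_le] at *
      constructor <;> linarith [h1.1, h1.2, h2.1, h2.2, h3.1, h3.2]
  obtain ⟨n, hn⟩ := exists_nat_ge (t / shortTime K b)
  exact step n t ((div_le_iff₀ (shortTime_pos K b)).1 hn) A ε hε

end Approximation

/-! ### Resampling a coordinate of a product measure -/

section Resample

variable {ι Y : Type*} [DecidableEq ι] [MeasurableSpace Y]

theorem map_update_infinitePi (m : ι → Measure Y) [∀ i, IsProbabilityMeasure (m i)] (i : ι) :
    ((Measure.infinitePi m).prod (m i)).map (fun p => Function.update p.1 i p.2) =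
      Measure.infinitePi m := by
  have hmeas : Measurable fun p : (ι → Y) × Y => Function.update p.1 i p.2 := by
    refine measurable_pi_lambda _ fun j => ?_
    by_cases h : j = i
    · subst h; simpa using measurable_snd
    · simp only [Function.update_of_ne h]; fun_prop
  refine Measure.eq_infinitePi _ fun s t ht => ?_
  rw [Measure.map_apply hmeas (MeasurableSet.pi s.countable_toSet fun j _ => ht j)]
  have hpre : (fun p : (ι → Y) × Y => Function.update p.1 i p.2) ⁻¹' Set.pi s t =
      Set.pi (s.erase i) t ×ˢ (if i ∈ s then t i else Set.univ) := by
    ext ⟨ω, u⟩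
    simp only [Set.mem_preimage, Set.mem_pi, Finset.mem_coe, Set.mem_prod, Finset.mem_erase]
    constructor
    · intro h
      refine ⟨fun j hj => by simpa [hj.1] using h j hj.2, ?_⟩
      split_ifs with hi
      · simpa using h i hi
      · trivial
    · rintro ⟨h1, h2⟩ j hj
      by_cases hji : j = i
      · subst hji; simpa [hj] using h2
      · simpa [hji] using h1 j ⟨hji, hj⟩
  rw [hpre, Measure.prod_prod, Measure.infinitePi_pi _ fun j _ => ht j]
  split_ifs with hi
  · exact Finset.prod_erase_mul s _ hi
  · rw [measure_univ, mul_one, Finset.erase_eq_of_notMem hi]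

/-- Replacing one coordinate by an independent copy preserves the product law. This permits
integrating out a single coordinate with the others frozen, even in an uncountable product. -/
theorem lintegral_infinitePi_update (m : ι → Measure Y) [∀ i, IsProbabilityMeasure (m i)] (i : ι)
    {F : (ι → Y) → ℝ≥0∞} (hF : Measurable F) :
    ∫⁻ ω, F ω ∂(Measure.infinitePi m) =
      ∫⁻ ω, ∫⁻ u, F (Function.update ω i u) ∂(m i) ∂(Measure.infinitePi m) := by
  have hmeas : Measurable fun p : (ι → Y) × Y => Function.update p.1 i p.2 := by
    refine measurable_pi_lambda _ fun j => ?_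
    by_cases h : j = i
    · subst h; simpa using measurable_snd
    · simp only [Function.update_of_ne h]; fun_prop
  conv_lhs => rw [← map_update_infinitePi m i]
  rw [lintegral_map hF hmeas]
  exact lintegral_prod _ (hF.comp hmeas).aemeasurable

end Resample

/-! ### Markov chains driven by independent uniform variables -/

section Chain

/-- The sample space of sequences of uniform random variables. -/
abbrev UniformSeq : Type := ℕ → unitInterval

/-- The law of a sequence of independent uniform random variables. -/
def uniformSeq : Measure UniformSeq := Measure.infinitePi fun _ => volume

instance : IsProbabilityMeasure uniformSeq := by unfold uniformSeq; infer_instance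

variable {S : Type*} [MeasurableSpace S] [StandardBorelSpace S] [Nonempty S]

/-- A time-inhomogeneous Markov chain with prescribed transition kernels, driven by a sequence of
independent uniform variables. -/
theorem exists_chain (κ : ℕ → Kernel S S) [∀ n, IsMarkovKernel (κ n)] (z₀ : S) :
    ∃ Z : ℕ → UniformSeq → S, (∀ n, Measurable (Z n)) ∧ (∀ ω, Z 0 ω = z₀) ∧
      (∀ n, DependsOn (Z n) (Set.Iio n)) ∧
      ∀ (n : ℕ) (F : UniformSeq → S → ℝ≥0∞), Measurable (Function.uncurry F) →
        (∀ z, DependsOn (fun ω => F ω z) (Set.Iio n)) →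
        ∫⁻ ω, F ω (Z (n + 1) ω) ∂uniformSeq =
          ∫⁻ ω, ∫⁻ z, F ω z ∂(κ n (Z n ω)) ∂uniformSeq := by
  classical
  -- `g n` realises the kernel `κ n` as a measurable function of the current state and one uniform
  -- variable.
  choose g hg hgκ using fun n => Kernel.exists_measurable_map_eq_unitInterval (κ n)
  let Z : ℕ → UniformSeq → S := fun n =>
    Nat.rec (fun _ => z₀) (fun n Zn ω => g n (Zn ω) (ω n)) n
  have hZs : ∀ n ω, Z (n + 1) ω = g n (Z n ω) (ω n) := fun n ω => rfl
  have hZm : ∀ n, Measurable (Z n) := by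
    intro n
    induction n with
    | zero => exact measurable_const
    | succ n ih => exact (hg n).comp (ih.prodMk (measurable_pi_apply n))
  have hZd : ∀ n, DependsOn (Z n) (Set.Iio n) := by
    intro n
    induction n with
    | zero => exact fun _ _ _ => rfl
    | succ n ih =>
      intro ω ω' h
      rw [hZs, hZs, ih fun i hi => h i (lt_trans hi (Nat.lt_succ_self n)),
        h n (Nat.lt_succ_self n)]
  refine ⟨Z, hZm, fun _ => rfl, hZd, fun n F hF hFd => ?_⟩
  have hup : ∀ (ω : UniformSeq) u, ∀ i ∈ Set.Iio n, Function.update ω n u i = ω i :=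
    fun ω u i hi => Function.update_of_ne (ne_of_lt hi) _ _
  have hmeas : Measurable fun ω => F ω (Z (n + 1) ω) :=
    hF.comp (measurable_id.prodMk (hZm (n + 1)))
  -- Resample `ω n` alone: `F` and `Z n` do not see it, and averaging over it amounts to integrating
  -- against `κ n (Z n ω)`.
  rw [uniformSeq, lintegral_infinitePi_update _ n hmeas]
  refine lintegral_congr fun ω => ?_
  have hFω : Measurable (F ω) := hF.comp measurable_prodMk_left
  have hgω : Measurable (g n (Z n ω)) := (hg n).comp measurable_prodMk_left
  rw [← hgκ n, lintegral_map hFω hgω]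
  refine lintegral_congr fun u => ?_
  rw [hZs, hZd n (hup ω u), Function.update_self]
  exact hFd _ (hup ω u)

/-- Inverse limits of sequences of probability measures, realised by random variables. -/
theorem exists_inverse_limit (lam : ℕ → Measure S) [∀ n, IsProbabilityMeasure (lam n)]
    (p : ℕ → S → S) (hp : ∀ n, Measurable (p n)) (h : ∀ n, (lam (n + 1)).map (p n) = lam n) :
    ∃ Z : ℕ → UniformSeq → S, (∀ n, Measurable (Z n)) ∧ (∀ n, uniformSeq.map (Z n) = lam n) ∧
      ∀ᵐ ω ∂uniformSeq, ∀ n, p n (Z (n + 1) ω) = Z n ω := by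
  -- From a state with law `lam n`, the next one is drawn from the conditional law, under `lam (n +
  -- 1)`, of a point given its image under `p n`. The extra step 0 turns an arbitrary starting state
  -- into a sample of `lam 0`, hence the index shift in the result.
  let κ : ℕ → Kernel S S := fun n => match n with
    | 0 => Kernel.const S (lam 0)
    | n + 1 => condDistrib id (p n) (lam (n + 1))
  have hκ : ∀ n, IsMarkovKernel (κ n) := fun n => match n with
    | 0 => inferInstanceAs (IsMarkovKernel (Kernel.const S (lam 0)))
    | n + 1 => inferInstanceAs (IsMarkovKernel (condDistrib id (p n) (lam (n + 1))))
  obtain ⟨Z, hZm, -, hZd, hZ⟩ := exists_chain κ (Classical.arbitrary S)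
  have hpair : ∀ n, uniformSeq.map (fun ω => (Z (n + 1) ω, Z (n + 2) ω)) =
      (uniformSeq.map (Z (n + 1))) ⊗ₘ κ (n + 1) := by
    intro n
    ext T hT
    have hind : Measurable (T.indicator (1 : S × S → ℝ≥0∞)) := measurable_one.indicator hT
    have h1 := hZ (n + 1) (fun ω z => T.indicator 1 (Z (n + 1) ω, z))
      (hind.comp (((hZm (n + 1)).comp measurable_fst).prodMk measurable_snd))
      fun z ω ω' hω => by simp only [hZd (n + 1) hω]
    have hpm : Measurable fun ω => (Z (n + 1) ω, Z (n + 2) ω) := (hZm _).prodMk (hZm _)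
    rw [← lintegral_indicator_one hT, lintegral_map hind hpm, h1, Measure.compProd_apply hT,
      lintegral_map (Kernel.measurable_kernel_prodMk_left hT) (hZm _)]
    refine lintegral_congr fun ω => ?_
    rw [← lintegral_indicator_one (measurable_prodMk_left hT)]
    rfl
  have hlaw0 : uniformSeq.map (Z 1) = lam 0 := by
    ext T hT
    have hind : Measurable (T.indicator (1 : S → ℝ≥0∞)) := measurable_one.indicator hT
    have h1 := hZ 0 (fun _ z => T.indicator 1 z) (hind.comp measurable_snd) fun _ _ _ _ => rfl
    rw [← lintegral_indicator_one hT, lintegral_map hind (hZm _), h1]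
    simp [κ, lintegral_indicator_one hT]
  have hlaws : ∀ n, uniformSeq.map (Z (n + 1)) = lam n ∧
      uniformSeq.map (fun ω => (Z (n + 1) ω, Z (n + 2) ω)) =
        (lam (n + 1)).map (fun z => (p n z, z)) := by
    intro n
    induction n with
    | zero =>
      refine ⟨hlaw0, ?_⟩
      rw [hpair, hlaw0, ← h 0]
      exact compProd_map_condDistrib aemeasurable_id
    | succ n ih =>
      have h2 : uniformSeq.map (Z (n + 2)) = lam (n + 1) := by
        have := congrArg (fun m => m.map Prod.snd) ih.2
        have hpm : Measurable fun z => (p n z, z) := (hp n).prodMk measurable_id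
        rw [Measure.map_map measurable_snd ((hZm _).prodMk (hZm _)),
          Measure.map_map measurable_snd hpm] at this
        exact this.trans Measure.map_id
      refine ⟨h2, ?_⟩
      rw [hpair, h2, ← h (n + 1)]
      exact compProd_map_condDistrib aemeasurable_id
  refine ⟨fun n => Z (n + 1), fun n => hZm _, fun n => (hlaws n).1, ?_⟩
  rw [ae_all_iff]
  intro n
  have hD : MeasurableSet {q : S × S | p n q.2 = q.1} :=
    measurableSet_eq_fun ((hp n).comp measurable_snd) measurable_fst
  have h3 : ∀ᵐ q ∂((lam (n + 1)).map fun z => (p n z, z)), p n q.2 = q.1 := by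
    have hpm : Measurable fun z => (p n z, z) := (hp n).prodMk measurable_id
    rw [ae_map_iff hpm.aemeasurable hD]
    exact ae_of_all _ fun _ => rfl
  rw [← (hlaws n).2, ae_map_iff ((hZm _).prodMk (hZm _)).aemeasurable hD] at h3
  exact h3

/-- `ρ` is the law of a path of the Markov chain with transition kernel `q`. -/
def IsChainLaw (q : Kernel S S) (ρ : Measure (ℕ → S)) : Prop :=
  ∀ (k : ℕ) (G : (ℕ → S) → ℝ≥0∞) (h : S → ℝ≥0∞), Measurable G → DependsOn G (Set.Iic k) →
    Measurable h → ∫⁻ y, G y * h (y (k + 1)) ∂ρ = ∫⁻ y, G y * ∫⁻ z, h z ∂(q (y k)) ∂ρ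

theorem exists_isChainLaw (q : Kernel S S) [IsMarkovKernel q] (x : S) :
    ∃ ρ : Measure (ℕ → S), IsProbabilityMeasure ρ ∧ (∀ᵐ y ∂ρ, y 0 = x) ∧ IsChainLaw q ρ := by
  obtain ⟨Z, hZm, hZ0, hZd, hZ⟩ := exists_chain (fun _ => q) x
  have hm : Measurable fun ω n => Z n ω := measurable_pi_lambda _ hZm
  refine ⟨uniformSeq.map fun ω n => Z n ω, Measure.isProbabilityMeasure_map hm.aemeasurable, ?_,
    fun k G h hG hGd hh => ?_⟩
  · rw [ae_map_iff hm.aemeasurable (measurableSet_eq_fun (measurable_pi_apply 0) measurable_const)]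
    exact ae_of_all _ hZ0
  · have hq : Measurable fun z => ∫⁻ z', h z' ∂(q z) := hh.lintegral_kernel
    have m1 : Measurable fun y : ℕ → S => G y * h (y (k + 1)) := by fun_prop
    have m2 : Measurable fun y : ℕ → S => G y * ∫⁻ z, h z ∂(q (y k)) :=
      hG.mul (hq.comp (measurable_pi_apply _))
    rw [lintegral_map m1 hm, lintegral_map m2 hm,
      hZ k (fun ω z => G (fun n => Z n ω) * h z)
        ((hG.comp (hm.comp measurable_fst)).mul (hh.comp measurable_snd)) ?_]
    · exact lintegral_congr fun ω => lintegral_const_mul _ hh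
    · intro z ω ω' hω
      simp only
      rw [hGd fun n hn => hZd n fun i hi => hω i (Set.Iio_subset_Iio hn hi)]

omit [StandardBorelSpace S] [Nonempty S] in
-- The past of the thinned chain up to `k` is part of the original past up to `2 k`, and two
-- original steps follow. This makes the chains on successive dyadic grids consistent.
theorem IsChainLaw.map_double {q q' : Kernel S S} {ρ : Measure (ℕ → S)} (hρ : IsChainLaw q ρ)
    (hq : q' = q ∘ₖ q) : IsChainLaw q' (ρ.map fun y k => y (2 * k)) := by
  intro k G h hG hGd hh
  have hm : Measurable fun (y : ℕ → S) k => y (2 * k) := by fun_prop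
  have hqh : Measurable fun z => ∫⁻ z', h z' ∂(q z) := hh.lintegral_kernel
  have hqh' : Measurable fun z => ∫⁻ z', h z' ∂(q' z) := hh.lintegral_kernel
  have m1 : Measurable fun y : ℕ → S => G y * h (y (k + 1)) := by fun_prop
  have m2 : Measurable fun y : ℕ → S => G y * ∫⁻ z, h z ∂(q' (y k)) :=
    hG.mul (hqh'.comp (measurable_pi_apply _))
  rw [lintegral_map m1 hm, lintegral_map m2 hm]
  have hGm : Measurable fun y : ℕ → S => G fun k => y (2 * k) := hG.comp hm
  have hdep : DependsOn (fun y : ℕ → S => G fun k => y (2 * k)) (Set.Iic (2 * k)) :=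
    fun y y' hy => hGd fun i hi => hy _ (Nat.mul_le_mul_left 2 hi)
  have h1 := hρ (2 * k + 1) _ h hGm (hdep.mono (Set.Iic_subset_Iic.2 (by omega))) hh
  have h2 := hρ (2 * k) _ _ hGm hdep hqh
  refine (h1.trans h2).trans (lintegral_congr fun y => ?_)
  rw [hq, Kernel.lintegral_comp _ _ _ hh]

omit [StandardBorelSpace S] [Nonempty S] in
/-- The law of a Markov chain is determined by its kernel and starting point. -/
theorem IsChainLaw.unique {q : Kernel S S} {ρ ρ' : Measure (ℕ → S)} [IsProbabilityMeasure ρ]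
    [IsProbabilityMeasure ρ'] {x : S} (h0 : ∀ᵐ y ∂ρ, y 0 = x) (h0' : ∀ᵐ y ∂ρ', y 0 = x)
    (hρ : IsChainLaw q ρ) (hρ' : IsChainLaw q ρ') : ρ = ρ' := by
  have key : ∀ (k : ℕ) (h : ℕ → S → ℝ≥0∞), (∀ i, Measurable (h i)) →
      ∫⁻ y, ∏ i ∈ Finset.range (k + 1), h i (y i) ∂ρ =
        ∫⁻ y, ∏ i ∈ Finset.range (k + 1), h i (y i) ∂ρ' := by
    intro k
    induction k with
    | zero =>
      intro h hh
      have e : ∀ (r : Measure (ℕ → S)), IsProbabilityMeasure r → (∀ᵐ y ∂r, y 0 = x) →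
          ∫⁻ y, ∏ i ∈ Finset.range (0 + 1), h i (y i) ∂r = h 0 x := fun r _ hr => by
        rw [lintegral_congr_ae (g := fun _ => h 0 x) (by filter_upwards [hr] with y hy; simp [hy])]
        simp
      rw [e ρ inferInstance h0, e ρ' inferInstance h0']
    | succ k ih =>
      intro h hh
      have hqh : Measurable fun z => ∫⁻ z', h (k + 1) z' ∂(q z) := (hh (k + 1)).lintegral_kernel
      -- Integrating out the last state absorbs the last factor into the one before it, which leaves
      -- a product of the same form with one factor fewer.
      have e : ∀ (r : Measure (ℕ → S)), IsChainLaw q r →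
          ∫⁻ y, ∏ i ∈ Finset.range (k + 1 + 1), h i (y i) ∂r =
          ∫⁻ y, ∏ i ∈ Finset.range (k + 1), Function.update h k
            (fun z => h k z * ∫⁻ z', h (k + 1) z' ∂(q z)) i (y i) ∂r := by
        intro r hr
        simp only [Finset.prod_range_succ _ (k + 1)]
        have m1 : Measurable fun y : ℕ → S => ∏ i ∈ Finset.range (k + 1), h i (y i) :=
          Finset.measurable_prod _ fun i _ => (hh i).comp (measurable_pi_apply i)
        rw [hr k _ (h (k + 1)) m1 ?_ (hh (k + 1))]
        · refine lintegral_congr fun y => ?_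
          rw [Finset.prod_range_succ, Finset.prod_range_succ, Function.update_self, mul_assoc]
          congr 1
          refine Finset.prod_congr rfl fun i hi => ?_
          rw [Function.update_of_ne (Finset.mem_range.1 hi).ne]
        · intro y y' hy
          exact Finset.prod_congr rfl fun i hi => by
            rw [hy i (Nat.lt_succ_iff.1 (Finset.mem_range.1 hi))]
      rw [e ρ hρ, e ρ' hρ']
      refine ih _ fun i => ?_
      by_cases hi : i = k
      · subst hi; rw [Function.update_self]; exact (hh i).mul hqh
      · rw [Function.update_of_ne hi]; exact hh i
  refine ext_of_generate_finite _ (generateFrom_squareCylinders (α := fun _ : ℕ => S)).symm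
    (isPiSystem_squareCylinders (fun _ => MeasurableSpace.isPiSystem_measurableSet)
      fun _ => MeasurableSet.univ) ?_ (by simp)
  rintro _ ⟨s, t, ht, rfl⟩
  have ht' : ∀ i, MeasurableSet (t i) := by simpa using ht
  classical
  obtain ⟨k, hk⟩ : ∃ k, s ⊆ Finset.range (k + 1) :=
    ⟨s.sup id, fun i hi => Finset.mem_range.2 (Nat.lt_succ_iff.2 (Finset.le_sup (f := id) hi))⟩
  have hmeas : MeasurableSet (Set.pi (s : Set ℕ) t) :=
    MeasurableSet.pi s.countable_toSet fun i _ => ht' i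
  have e : ∀ y : ℕ → S, (Set.pi (s : Set ℕ) t).indicator (1 : (ℕ → S) → ℝ≥0∞) y =
      ∏ i ∈ Finset.range (k + 1), (if i ∈ s then (t i).indicator 1 else 1) (y i) := by
    intro y
    rw [← Finset.prod_subset hk fun i _ hi => by simp [hi]]
    by_cases hy : y ∈ Set.pi (s : Set ℕ) t
    · rw [Set.indicator_of_mem hy]
      refine (Finset.prod_eq_one fun i hi => ?_).symm
      simp [hi, hy i hi]
    · rw [Set.indicator_of_notMem hy]
      simp only [Set.mem_pi, not_forall] at hy
      obtain ⟨i, hi, hyi⟩ := hy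
      refine (Finset.prod_eq_zero hi ?_).symm
      simp [Finset.mem_coe.1 hi, hyi]
  rw [← lintegral_indicator_one hmeas, ← lintegral_indicator_one hmeas]
  simp only [e]
  refine key k _ fun i => ?_
  split_ifs
  · exact measurable_one.indicator (ht' i)
  · exact measurable_one

omit [StandardBorelSpace S] [Nonempty S] in
theorem IsChainLaw.multi_step {q : Kernel S S} {ρ : Measure (ℕ → S)} (hρ : IsChainLaw q ρ)
    (k j : ℕ) {G : (ℕ → S) → ℝ≥0∞} {h : S → ℝ≥0∞} (hG : Measurable G)
    (hGd : DependsOn G (Set.Iic k)) (hh : Measurable h) :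
    ∫⁻ y, G y * h (y (k + j)) ∂ρ = ∫⁻ y, G y * ∫⁻ z, h z ∂((q ^ j) (y k)) ∂ρ := by
  induction j generalizing h with
  | zero =>
    refine lintegral_congr fun y => ?_
    rw [pow_zero]
    exact congrArg _ (lintegral_dirac' _ hh).symm
  | succ j ih =>
    have hqh : Measurable fun z => ∫⁻ z', h z' ∂(q z) := hh.lintegral_kernel
    rw [← add_assoc, hρ (k + j) G h hG (hGd.mono (Set.Iic_subset_Iic.2 (by omega))) hh, ih hqh]
    refine lintegral_congr fun y => ?_
    rw [add_comm, pow_add, pow_one]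
    exact congrArg _ (Kernel.lintegral_comp _ _ _ hh).symm

end Chain

/-! ### Setwise limits of probability measures -/

section Setwise

variable {S : Type*} [MeasurableSpace S]

theorem hasSum_measureReal_iUnion {m : Measure S} [IsFiniteMeasure m] {f : ℕ → Set S}
    (hf : ∀ i, MeasurableSet (f i)) (hd : Pairwise (Function.onFun Disjoint f)) :
    HasSum (fun i => m.real (f i)) (m.real (⋃ i, f i)) := by
  have h := measure_iUnion hd hf (μ := m)
  have hne : ∑' i, m (f i) ≠ ∞ := h ▸ measure_ne_top _ _
  have := ENNReal.hasSum_toReal hne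
  rw [← ENNReal.tsum_toReal_eq (fun i => measure_ne_top _ _), ← h] at this
  exact this

/-- The Cauchy condition is uniform over measurable sets, so a single `nu N` approximates the
limiting set function on all sets at once, and countable additivity passes to the limit. -/
theorem exists_setwise_limit (nu : ℕ → Measure S) [∀ n, IsProbabilityMeasure (nu n)]
    (hC : ∀ ε > 0, ∃ N, ∀ m ≥ N, ∀ n ≥ N, ∀ T, MeasurableSet T →
      |(nu m).real T - (nu n).real T| ≤ ε) :
    ∃ lam : Measure S, IsProbabilityMeasure lam ∧
      ∀ T, MeasurableSet T → Tendsto (fun n => (nu n).real T) atTop (𝓝 (lam.real T)) := by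
  have hlim : ∀ T, ∃ l, MeasurableSet T → Tendsto (fun n => (nu n).real T) atTop (𝓝 l) := by
    intro T
    by_cases hT : MeasurableSet T
    · have hc : CauchySeq fun n => (nu n).real T := by
        rw [Metric.cauchySeq_iff]
        intro ε hε
        obtain ⟨N, hN⟩ := hC (ε / 2) (half_pos hε)
        exact ⟨N, fun m hm n hn => (hN m hm n hn T hT).trans_lt (half_lt_self hε)⟩
      obtain ⟨l, hl⟩ := cauchySeq_tendsto_of_complete hc
      exact ⟨l, fun _ => hl⟩
    · exact ⟨0, fun h => absurd h hT⟩
  choose l hl using hlim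
  have hl0 : ∀ T, MeasurableSet T → 0 ≤ l T := fun T hT =>
    ge_of_tendsto' (hl T hT) fun n => measureReal_nonneg
  have hunif : ∀ ε > 0, ∃ N, ∀ T, MeasurableSet T → |l T - (nu N).real T| ≤ ε := by
    intro ε hε
    obtain ⟨N, hN⟩ := hC ε hε
    refine ⟨N, fun T hT => ?_⟩
    exact le_of_tendsto ((hl T hT).sub_const _).abs
      (eventually_atTop.2 ⟨N, fun n hn => hN n hn N le_rfl T hT⟩)
  have hsum : ∀ f : ℕ → Set S, (∀ i, MeasurableSet (f i)) →
      Pairwise (Function.onFun Disjoint f) → HasSum (fun i => l (f i)) (l (⋃ i, f i)) := by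
    intro f hf hd
    rw [hasSum_iff_tendsto_nat_of_nonneg (fun i => hl0 _ (hf i))]
    rw [Metric.tendsto_atTop]
    intro ε hε
    obtain ⟨N, hN⟩ := hunif (ε / 4) (by positivity)
    have h1 := (hasSum_iff_tendsto_nat_of_nonneg (fun i => measureReal_nonneg) _).1
      (hasSum_measureReal_iUnion (m := nu N) hf hd)
    rw [Metric.tendsto_atTop] at h1
    obtain ⟨k₀, hk₀⟩ := h1 (ε / 4) (by positivity)
    refine ⟨k₀, fun k hk => ?_⟩
    have hfin : ∀ n, (nu n).real (⋃ i ∈ Finset.range k, f i) =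
        ∑ i ∈ Finset.range k, (nu n).real (f i) := fun n =>
      measureReal_biUnion_finset (fun i _ j _ hij => hd hij) fun i _ => hf i
    have hmk : MeasurableSet (⋃ i ∈ Finset.range k, f i) :=
      Finset.measurableSet_biUnion _ fun i _ => hf i
    have hlk : l (⋃ i ∈ Finset.range k, f i) = ∑ i ∈ Finset.range k, l (f i) :=
      tendsto_nhds_unique (hl _ hmk) (by
        simp only [hfin]; exact tendsto_finsetSum _ fun i _ => hl _ (hf i))
    have h2 := hN _ hmk
    have h3 := hN _ (MeasurableSet.iUnion hf)
    have h4 := hk₀ k hk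
    rw [hlk, hfin] at h2
    rw [Real.dist_eq, abs_lt] at *
    rw [abs_le] at *
    constructor <;> linarith [h2.1, h2.2, h3.1, h3.2, h4.1, h4.2]
  have hempty : l ∅ = 0 :=
    tendsto_nhds_unique (hl ∅ MeasurableSet.empty) (by simp)
  let lam : Measure S := Measure.ofMeasurable (fun T _ => ENNReal.ofReal (l T))
    (by simp [hempty]) (fun f hf hd => by
      rw [← (hsum f hf hd).tsum_eq]
      exact ENNReal.ofReal_tsum_of_nonneg (fun i => hl0 _ (hf i)) (hsum f hf hd).summable)
  have hlam : ∀ T, MeasurableSet T → lam T = ENNReal.ofReal (l T) := fun T hT =>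
    Measure.ofMeasurable_apply T hT
  refine ⟨lam, ⟨?_⟩, fun T hT => ?_⟩
  · rw [hlam _ MeasurableSet.univ, tendsto_nhds_unique (hl _ MeasurableSet.univ)
      (by simp : Tendsto (fun n => (nu n).real Set.univ) atTop (𝓝 1))]
    simp
  · rw [measureReal_def, hlam T hT, ENNReal.toReal_ofReal (hl0 T hT)]
    exact hl T hT

/-- By the layer-cake formula, the integral of `f + M` is an integral over levels in `[0, 2 M]` of
probabilities, to which dominated convergence applies. -/
theorem tendsto_integral_of_setwise {ι : Type*} {F : Filter ι} [F.IsCountablyGenerated]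
    {nu : ι → Measure S} [∀ n, IsProbabilityMeasure (nu n)] {lam : Measure S}
    [IsProbabilityMeasure lam]
    (h : ∀ T, MeasurableSet T → Tendsto (fun n => (nu n).real T) F (𝓝 (lam.real T)))
    {f : S → ℝ} (hf : f ∈ boundedMeasurable S) :
    Tendsto (fun n => ∫ x, f x ∂(nu n)) F (𝓝 (∫ x, f x ∂lam)) := by
  obtain ⟨hm, M, hM⟩ := id hf
  have key : ∀ m : Measure S, IsProbabilityMeasure m → ∫ x, f x ∂m =
      (∫ t in Set.Ioc 0 (2 * M), m.real {x | t ≤ f x + M}) - M := by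
    intro m _
    have hfi : Integrable f m := integrable_of_boundedMeasurable hf
    have := (hfi.add (integrable_const M)).integral_eq_integral_Ioc_meas_le (M := 2 * M)
      (ae_of_all _ fun x => by
        have := (abs_le.1 (hM x)).1
        simp only [Pi.zero_apply, Pi.add_apply]; linarith)
      (ae_of_all _ fun x => by
        have := (abs_le.1 (hM x)).2
        simp only [Pi.add_apply]; linarith)
    simp only [Pi.add_apply] at this
    rw [← this, integral_add hfi (integrable_const M)]
    simp
  simp only [fun n => key (nu n) inferInstance, key lam inferInstance]
  refine Tendsto.sub_const (tendsto_integral_filter_of_dominated_convergence (fun _ => (1 : ℝ))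
    ?_ ?_ ?_ ?_) M
  · refine Eventually.of_forall fun n => Measurable.aestronglyMeasurable ?_
    refine Antitone.measurable fun s t hst => measureReal_mono fun x hx => ?_
    exact hst.trans hx
  · exact Eventually.of_forall fun n => ae_of_all _ fun t => by
      rw [Real.norm_eq_abs, abs_of_nonneg measureReal_nonneg]
      exact measureReal_le_one
  · exact integrable_const _
  · exact ae_of_all _ fun t => h _ (measurableSet_le measurable_const (hm.add_const M))

end Setwise

theorem abs_integral_sub_le {E : Type*} [MeasurableSpace E] {m : Measure E}
    [IsProbabilityMeasure m] {f g : E → ℝ} (hf : f ∈ boundedMeasurable E)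
    (hg : g ∈ boundedMeasurable E) {ε : ℝ} (h : ∀ y, |f y - g y| ≤ ε) :
    |∫ y, f y ∂m - ∫ y, g y ∂m| ≤ ε := by
  rw [← integral_sub (integrable_of_boundedMeasurable hf) (integrable_of_boundedMeasurable hg)]
  exact abs_integral_le_of_abs_le h

/-! ### The infinite system -/

section InfiniteSystem

variable {V X : Type*} {𝒢 : SimpleGraph V} [MeasurableSpace X]
  {α : ∀ v, Kernel (nbhd 𝒢 v → X) (nbhd 𝒢 v → X)} {K : ℝ≥0} {nb : V → Finset V} {b : ℕ}
  {win : Finset V → ℝ≥0 → Kernel (V → X) (V → X)}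

theorem exists_exhaustion (V : Type*) [Countable V] :
    ∃ A : ℕ → Finset V, Monotone A ∧ ∀ v, ∃ n, v ∈ A n := by
  obtain ⟨e, he⟩ := exists_injective_nat V
  have hfin : ∀ n, (e ⁻¹' Set.Iio n).Finite := fun n =>
    (Set.finite_Iio n).preimage he.injOn
  refine ⟨fun n => (hfin n).toFinset, fun m n hmn v hv => ?_, fun v => ⟨e v + 1, by simp⟩⟩
  simp only [Set.Finite.mem_toFinset, Set.mem_preimage, Set.mem_Iio] at *
  omega

/-- The configuration equal to `y` on `A` and to `x` off `A`. -/
def glue (A : Finset V) (x y : V → X) : V → X :=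
  open Classical in fun v => if v ∈ A then y v else x v

theorem measurable_glue (A : Finset V) (x : V → X) : Measurable (glue A x) := by
  refine measurable_pi_lambda _ fun v => ?_
  by_cases h : v ∈ A
  · simp only [glue, h, if_true]; fun_prop
  · simp only [glue, h, if_false]; fun_prop

omit [MeasurableSpace X] in
theorem glue_glue {A B : Finset V} (h : A ⊆ B) (x y : V → X) :
    glue A x (glue B x y) = glue A x y := by
  ext v
  by_cases hA : v ∈ A
  · simp [glue, hA, h hA]
  · simp [glue, hA]

omit [MeasurableSpace X] in
theorem dependsOn_comp_glue {β : Type*} (A : Finset V) (x : V → X) (f : (V → X) → β) :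
    DependsOn (fun y => f (glue A x y)) (A : Set V) := by
  intro y y' h
  simp only
  congr 1
  ext v
  by_cases hA : v ∈ A
  · simp [glue, hA, h v hA]
  · simp [glue, hA]

/-- Freezing the coordinates off `A n` at `x` lets all finite marginals live on `V → X`. By
`exists_window_close` they are Cauchy in total variation as the window grows; their limits form an
inverse system under the maps `glue (A n) x`, whose limit is realised by random variables. -/
theorem exists_limit_law [Countable V] [StandardBorelSpace X] (hnb : IsNbhdFinset 𝒢 nb b)
    (hK : ∀ v x, α v x Set.univ ≤ K) (hwin : ∀ W, IsWindowFamily α W (win W))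
    {A : ℕ → Finset V} (hA : Monotone A) (hAV : ∀ v, ∃ n, v ∈ A n) (t : ℝ≥0) (x : V → X) :
    ∃ m : Measure (V → X), IsProbabilityMeasure m ∧ ∀ f ∈ cylinderFun V X,
      Tendsto (fun k => semigroup (win (A k)) t f x) atTop (𝓝 (∫ y, f y ∂m)) := by
  have hprob : ∀ k, IsProbabilityMeasure (win (A k) t x) := fun k =>
    ((hwin (A k)).1.isMarkovKernel t).isProbabilityMeasure x
  have hcof : ∀ B : Finset V, ∃ N, ∀ n ≥ N, B ⊆ A n := fun B => by
    choose n hn using hAV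
    exact ⟨B.sup n, fun k hk v hv => hA ((Finset.le_sup hv).trans hk) (hn v)⟩
  have hglue : ∀ n k, IsProbabilityMeasure ((win (A k) t x).map (glue (A n) x)) := fun n k =>
    Measure.isProbabilityMeasure_map (measurable_glue _ _).aemeasurable
  have hlaw : ∀ n, ∃ lam : Measure (V → X), IsProbabilityMeasure lam ∧
      ∀ T, MeasurableSet T → Tendsto (fun k => ((win (A k) t x).map (glue (A n) x)).real T)
        atTop (𝓝 (lam.real T)) := by
    intro n
    refine exists_setwise_limit _ fun ε hε => ?_
    obtain ⟨B, hB⟩ := exists_window_close hnb hK hwin t (A n) hε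
    obtain ⟨N, hN⟩ := hcof B
    refine ⟨N, fun k hk l hl T hT => ?_⟩
    have hT' : MeasurableSet (glue (A n) x ⁻¹' T) := measurable_glue _ _ hT
    have h := hB (A k) (A l) (hN k hk) (hN l hl)
      ((glue (A n) x ⁻¹' T).indicator fun _ => 1) (measurable_const.indicator hT')
      (dependsOn_comp_glue (A n) x (T.indicator fun _ => (1 : ℝ)))
      (fun y => by
        by_cases hy : y ∈ glue (A n) x ⁻¹' T
        · rw [Set.indicator_of_mem hy, abs_one]
        · rw [Set.indicator_of_notMem hy, abs_zero]; exact zero_le_one) x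
    simpa only [semigroup, integral_indicator_const _ hT', smul_eq_mul, mul_one,
      map_measureReal_apply (measurable_glue (A n) x) hT] using h
  choose lam hlamP hlam using hlaw
  have hcons : ∀ n, (lam (n + 1)).map (glue (A n) x) = lam n := by
    intro n
    have := Measure.isProbabilityMeasure_map (μ := lam (n + 1)) (measurable_glue (A n) x).aemeasurable
    ext T hT
    rw [← measureReal_eq_measureReal_iff, map_measureReal_apply (measurable_glue _ _) hT]
    refine tendsto_nhds_unique (hlam (n + 1) _ (measurable_glue (A n) x hT)) ?_
    refine (hlam n T hT).congr fun k => ?_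
    rw [map_measureReal_apply (measurable_glue _ _) hT, map_measureReal_apply
      (measurable_glue _ _) (measurable_glue (A n) x hT), ← Set.preimage_comp]
    congr 1
    ext y
    simp only [Set.mem_preimage, Function.comp_apply, glue_glue (hA n.le_succ)]
  have : Nonempty (V → X) := ⟨x⟩
  obtain ⟨Z, hZm, hZl, hZ⟩ := exists_inverse_limit lam (fun n => glue (A n) x)
    (fun n => measurable_glue _ _) hcons
  choose e he using hAV
  -- Coordinate `v` is read at a level where it has already joined the exhaustion; almost surely it
  -- does not change afterwards.
  let z : UniformSeq → V → X := fun ω v => Z (e v) ω v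
  have hzm : Measurable z := measurable_pi_lambda _ fun v => (measurable_pi_apply v).comp (hZm _)
  have hstab : ∀ᵐ ω ∂uniformSeq, ∀ n, ∀ v ∈ A n, z ω v = Z n ω v := by
    filter_upwards [hZ] with ω hω
    have hstep : ∀ n v, v ∈ A n → Z (n + 1) ω v = Z n ω v := fun n v hv => by
      rw [← hω n]; simp [glue, hv]
    have hle : ∀ v k n, v ∈ A k → k ≤ n → Z n ω v = Z k ω v := by
      intro v k n hv hkn
      induction n, hkn using Nat.le_induction with
      | base => rfl
      | succ n hkn ih => rw [hstep n v (hA hkn hv), ih]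
    intro n v hv
    rcases le_total (e v) n with h | h
    · exact (hle v _ _ (he v) h).symm
    · exact hle v _ _ hv h
  refine ⟨uniformSeq.map z, Measure.isProbabilityMeasure_map hzm.aemeasurable, fun f hf => ?_⟩
  obtain ⟨hfb, B, hB⟩ := hf
  obtain ⟨n, hn⟩ := hcof B
  have hBn := hn n le_rfl
  have hfg : ∀ y, f (glue (A n) x y) = f y := fun y => hB fun v hv => by
    simp [glue, hBn hv]
  have e1 : ∫ y, f y ∂(uniformSeq.map z) = ∫ y, f y ∂(lam n) := by
    rw [← hZl n, integral_map hzm.aemeasurable hfb.1.aestronglyMeasurable,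
      integral_map (hZm n).aemeasurable hfb.1.aestronglyMeasurable]
    refine integral_congr_ae ?_
    filter_upwards [hstab] with ω hω
    exact hB fun v hv => hω n v (hBn hv)
  rw [e1]
  refine (tendsto_integral_of_setwise (hlam n) hfb).congr fun k => ?_
  rw [integral_map (measurable_glue _ _).aemeasurable hfb.1.aestronglyMeasurable]
  simp only [hfg]
  rfl

/-- The limiting transition kernels, approximated uniformly by those in finite windows. -/
theorem exists_limit_kernels [Countable V] [StandardBorelSpace X] (hnb : IsNbhdFinset 𝒢 nb b)
    (hK : ∀ v x, α v x Set.univ ≤ K) (hwin : ∀ W, IsWindowFamily α W (win W)) :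
    ∃ μ : ℝ≥0 → Kernel (V → X) (V → X), (∀ t, IsMarkovKernel (μ t)) ∧
      ∀ t, ∀ f ∈ cylinderFun V X, ∀ ε > 0, ∃ B : Finset V, ∀ W : Finset V, B ⊆ W → ∀ x,
        |semigroup (win W) t f x - semigroup μ t f x| ≤ ε := by
  obtain ⟨A, hA, hAV⟩ := exists_exhaustion V
  choose m hmP hm using exists_limit_law hnb hK hwin hA hAV
  have hmeas : ∀ t, Measurable (m t) := by
    intro t
    have := hmP t
    refine Measurable.measure_of_isPiSystem_of_isProbabilityMeasure
      generateFrom_measurableCylinders.symm isPiSystem_measurableCylinders fun S hS => ?_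
    obtain ⟨B, T, hT, rfl⟩ := (mem_measurableCylinders _).1 hS
    have hC : MeasurableSet (cylinder (α := fun _ : V => X) B T) := hT.cylinder B
    -- On a cylinder event the limit law is a pointwise limit, in the starting point, of window
    -- kernels.
    have h1 : Measurable fun x => ∫ y, (cylinder B T).indicator (fun _ => (1 : ℝ)) y ∂(m t x) :=
      measurable_of_tendsto_metrizable
        (fun k => (boundedMeasurable_semigroup (hwin (A k)).1 t
          (indicator_cylinder_mem_cylinderFun hT).1).1)
        (tendsto_pi_nhds.2 fun x => hm t x _ (indicator_cylinder_mem_cylinderFun hT))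
    simp only [integral_indicator_const _ hC, smul_eq_mul, mul_one] at h1
    simpa only [ofReal_measureReal (measure_ne_top _ _)] using h1.ennreal_ofReal
  refine ⟨fun t => ⟨m t, hmeas t⟩, fun t => ⟨hmP t⟩, fun t f hf ε hε => ?_⟩
  obtain ⟨⟨hfm, M, hM⟩, C, hC⟩ := id hf
  obtain ⟨B, hB⟩ := exists_window_close hnb hK hwin t C (ε := ε / (|M| + 1)) (by positivity)
  refine ⟨B, fun W hW x => ?_⟩
  refine le_of_tendsto ((hm t x f hf).const_sub _).abs ?_
  have hcof : ∀ᶠ k in atTop, B ⊆ A k := by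
    choose n hn using hAV
    exact eventually_atTop.2 ⟨B.sup n, fun k hk v hv => hA ((Finset.le_sup hv).trans hk) (hn v)⟩
  filter_upwards [hcof] with k hk
  have hpos : 0 < |M| + 1 := by positivity
  have h := hB W (A k) hW hk (fun y => (|M| + 1)⁻¹ * f y) (hfm.const_mul _)
    (fun y y' h => by simp only [hC h]) (fun y => by
      rw [abs_mul, abs_of_pos (inv_pos.2 hpos), inv_mul_le_iff₀ hpos]
      linarith [hM y, le_abs_self M]) x
  rw [semigroup_const_mul, semigroup_const_mul, ← mul_sub, abs_mul, abs_of_pos (inv_pos.2 hpos),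
    div_eq_inv_mul] at h
  exact le_of_mul_le_mul_left h (inv_pos.2 hpos)

/-! ### Semigroup property, generator and window approximation of the limiting kernels -/

section LimitFamily

variable {μ : ℝ≥0 → Kernel (V → X) (V → X)}

theorem semigroup_window_mem_cylinderFun (hnb : IsNbhdFinset 𝒢 nb b)
    (hK : ∀ v x, α v x Set.univ ≤ K) (hwin : ∀ W, IsWindowFamily α W (win W)) (W : Finset V)
    (t : ℝ≥0) {f : (V → X) → ℝ} (hf : f ∈ cylinderFun V X) :
    semigroup (win W) t f ∈ cylinderFun V X := by
  classical
  obtain ⟨hfb, A, hA⟩ := hf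
  exact ⟨boundedMeasurable_semigroup (hwin W).1 t hfb, A ∪ touch nb W,
    dependsOn_semigroup_window hnb hK (hwin W) t (by simp) hfb (hA.mono (by simp))⟩

theorem isMarkovianFamily_of_limit (hnb : IsNbhdFinset 𝒢 nb b)
    (hK : ∀ v x, α v x Set.univ ≤ K) (hwin : ∀ W, IsWindowFamily α W (win W))
    (hμ : ∀ t, IsMarkovKernel (μ t))
    (hlim : ∀ t, ∀ f ∈ cylinderFun V X, ∀ ε > 0, ∃ B : Finset V, ∀ W : Finset V, B ⊆ W → ∀ x,
      |semigroup (win W) t f x - semigroup μ t f x| ≤ ε) : IsMarkovianFamily μ := by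
  classical
  have hbm : ∀ t, ∀ f ∈ boundedMeasurable (V → X), semigroup μ t f ∈ boundedMeasurable (V → X) := by
    intro t f hf
    obtain ⟨hm, M, hM⟩ := hf
    exact ⟨(hm.stronglyMeasurable.integral_kernel (κ := μ t)).measurable, M,
      fun x => abs_integral_le_of_abs_le hM⟩
  refine ⟨hμ, fun x => ?_, fun s t x A hA => ?_⟩
  · refine measure_ext_of_cylinderFun fun f hf => ?_
    refine eq_of_abs_sub_le_all fun ε hε => ?_
    obtain ⟨B, hB⟩ := hlim 0 f hf ε hε
    have := hB B subset_rfl x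
    rw [semigroup_zero (hwin B).1 hf.1.1, abs_sub_comm] at this
    rwa [integral_dirac' _ _ hf.1.1.stronglyMeasurable]
  · have key : (μ t ∘ₖ μ s) x = μ (s + t) x := by
      refine measure_ext_of_cylinderFun fun f hf => ?_
      have hfi : Integrable f ((μ t ∘ₖ μ s) x) := integrable_of_boundedMeasurable hf.1
      rw [Kernel.integral_comp hfi]
      change semigroup μ s (semigroup μ t f) x = semigroup μ (s + t) f x
      refine eq_of_abs_sub_le_all fun ε hε => ?_
      obtain ⟨B₁, hB₁⟩ := hlim (s + t) f hf (ε / 5) (by positivity)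
      obtain ⟨B₂, hB₂⟩ := hlim t f hf (ε / 5) (by positivity)
      -- `hlim` cannot be applied to `P_t f`, which need not be a cylinder function, so the cylinder
      -- function `g` stands in for it. One error comes from each of the times `s + t` and `s`, one
      -- from replacing `P_t f` by `g`, and two from doing the same inside the window `W`.
      set g := semigroup (win B₂) t f with hg
      have hgC : g ∈ cylinderFun V X := semigroup_window_mem_cylinderFun hnb hK hwin B₂ t hf
      obtain ⟨B₃, hB₃⟩ := hlim s g hgC (ε / 5) (by positivity)
      set W := B₁ ∪ B₂ ∪ B₃ with hW
      have h1 := hB₁ W (by rw [hW, Finset.union_assoc]; exact Finset.subset_union_left) x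
      have h2 : |semigroup μ s (semigroup μ t f) x - semigroup μ s g x| ≤ ε / 5 :=
        abs_integral_sub_le (hbm t f hf.1) hgC.1 fun y => by
          rw [abs_sub_comm]; exact hB₂ B₂ subset_rfl y
      have h3 := hB₃ W Finset.subset_union_right x
      have h4 : |semigroup (win W) s (semigroup (win W) t f) x - semigroup (win W) s g x|
          ≤ ε / 5 + ε / 5 := by
        refine abs_semigroup_sub_le (hwin W).1 s
          (boundedMeasurable_semigroup (hwin W).1 t hf.1) hgC.1 (fun y => ?_) x
        have a1 := hB₂ W (Finset.subset_union_right.trans Finset.subset_union_left) y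
        have a2 := hB₂ B₂ subset_rfl y
        rw [abs_sub_comm] at a2
        exact (abs_sub_le _ _ _).trans (add_le_add a1 a2)
      rw [← semigroup_add (hwin W).1 s t hf.1] at h4
      rw [abs_le] at *
      constructor <;> linarith [h1.1, h1.2, h2.1, h2.2, h3.1, h3.2, h4.1, h4.2]
    rw [← key, Kernel.comp_apply' _ _ _ hA]

theorem hasGeneratorOn_of_limit (hnb : IsNbhdFinset 𝒢 nb b)
    (hK : ∀ v x, α v x Set.univ ≤ K) (hwin : ∀ W, IsWindowFamily α W (win W))
    (hlim : ∀ t, ∀ f ∈ cylinderFun V X, ∀ ε > 0, ∃ B : Finset V, ∀ W : Finset V, B ⊆ W → ∀ x,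
      |semigroup (win W) t f x - semigroup μ t f x| ≤ ε) :
    HasGeneratorOn μ (gen α Set.univ) (cylinderFun V X) := by
  classical
  have := isFiniteKernel_of_le hK
  intro f hf
  obtain ⟨⟨hm, M₀, hM₀⟩, A, hA⟩ := id hf
  set M := |M₀|
  have hM : ∀ x, |f x| ≤ M := fun x => (hM₀ x).trans (le_abs_self _)
  have h0 : 0 ≤ M := abs_nonneg _
  set C : ℝ := (4 * K * (b + 1) ^ 2) ^ 2 * (Nat.factorial 2 * 2 ^ A.card) * M with hCdef
  have hC0 : 0 ≤ C := by positivity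
  -- The second-order remainder in a window has a constant that does not depend on the window, so
  -- the bound survives the limit.
  have key : ∀ (t : ℝ≥0) (x : V → X),
      |semigroup μ t f x - f x - t * gen α Set.univ f x| ≤ (t : ℝ) ^ 2 / 2 * C := by
    intro t x
    refine le_of_forall_pos_le_add fun ε hε => ?_
    obtain ⟨B, hB⟩ := hlim t f hf ε hε
    set W := B ∪ touch nb A
    have h1 := hB W Finset.subset_union_left x
    have h2 := abs_semigroup_sub_taylor_le (hwin W).1
      ((hwin W).2.mono cylinderFun_subset_boundedMeasurable) cylinderFun_subset_boundedMeasurable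
      (fun f hf => gen_mem_cylinderFun hnb hK (W : Set V) hf) 2 hf
      (abs_iterate_gen_le hnb hK (W : Set V) hm hA h0 hM 2) t x
    have h3 : gen α (W : Set V) f = gen α Set.univ f :=
      gen_congr_of_touch_subset hnb hA (by simp [W])
    rw [Finset.sum_range_succ, Finset.sum_range_one, Function.iterate_zero_apply,
      Function.iterate_one, h3] at h2
    simp only [pow_zero, Nat.factorial_zero, Nat.cast_one, div_one, one_mul, pow_one,
      Nat.factorial_one, Nat.factorial_two, Nat.cast_ofNat] at h2
    simp only [hCdef, Nat.factorial_two, Nat.cast_ofNat]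
    rw [abs_le] at *
    constructor <;> linarith [h1.1, h1.2, h2.1, h2.2]
  rw [Metric.tendstoUniformly_iff]
  intro ε hε
  rw [eventually_nhdsWithin_iff, Metric.eventually_nhds_iff]
  refine ⟨ε / (C + 1), by positivity, fun t ht ht0 x => ?_⟩
  have ht' : 0 < (t : ℝ) := by exact_mod_cast ht0
  have htε : (t : ℝ) * (C + 1) < ε := by
    rw [NNReal.dist_eq, NNReal.coe_zero, sub_zero, abs_of_pos ht'] at ht
    rwa [lt_div_iff₀ (by positivity)] at ht
  rw [dist_comm, Real.dist_eq]
  have e1 : (t : ℝ)⁻¹ * (semigroup μ t f x - f x) - gen α Set.univ f x =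
      (t : ℝ)⁻¹ * (semigroup μ t f x - f x - t * gen α Set.univ f x) := by
    field_simp
  rw [e1, abs_mul, abs_of_pos (inv_pos.2 ht'), inv_mul_lt_iff₀ ht']
  refine (key t x).trans_lt ?_
  have : (t : ℝ) ^ 2 / 2 * C = t * (t * C / 2) := by ring
  rw [this]
  refine mul_lt_mul_of_pos_left ?_ ht'
  nlinarith [mul_nonneg ht'.le hC0]

theorem tendsto_semigroup_window
    (hlim : ∀ t, ∀ f ∈ cylinderFun V X, ∀ ε > 0, ∃ B : Finset V, ∀ W : Finset V, B ⊆ W → ∀ x,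
      |semigroup (win W) t f x - semigroup μ t f x| ≤ ε)
    {W : ℕ → Finset V} (hW : (⋃ m, ⋂ n ≥ m, (W n : Set V)) = Set.univ) (t : ℝ≥0)
    {f : (V → X) → ℝ} (hf : f ∈ cylinderFun V X) (x : V → X) :
    Tendsto (fun m => semigroup (win (W m)) t f x) atTop (𝓝 (semigroup μ t f x)) := by
  rw [Metric.tendsto_nhds]
  intro ε hε
  obtain ⟨B, hB⟩ := hlim t f hf (ε / 2) (half_pos hε)
  have hev : ∀ᶠ m in atTop, ∀ v ∈ B, v ∈ W m := by
    rw [eventually_all_finset]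
    intro v _
    have hv : v ∈ ⋃ m, ⋂ n ≥ m, (W n : Set V) := hW ▸ Set.mem_univ v
    simp only [Set.mem_iUnion, Set.mem_iInter, Finset.mem_coe] at hv
    exact eventually_atTop.2 hv
  filter_upwards [hev] with m hm
  rw [Real.dist_eq]
  exact (hB (W m) hm x).trans_lt (half_lt_self hε)

end LimitFamily

end InfiniteSystem

/-! ### Paths on the dyadic numbers with finitely many changes -/

section DyadicPath

variable {X : Type*} {y : ℕ → ℕ → X}

/-- The number of changes of the level `n` path `y n` before index `k`. -/
def changes (y : ℕ → ℕ → X) (n k : ℕ) : ℕ :=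
  open Classical in ∑ j ∈ Finset.range k, if y n (j + 1) = y n j then 0 else 1

/-- A dyadic path, where `y n k` is the value at time `k / 2 ^ n`, with finitely many changes in
bounded time intervals. -/
structure IsDyadicPath (y : ℕ → ℕ → X) : Prop where
  consistent : ∀ n k, y (n + 1) (2 * k) = y n k
  bounded : ∀ N, ∃ B, ∀ n, changes y n (N * 2 ^ n) ≤ B

theorem changes_mono (y : ℕ → ℕ → X) (n : ℕ) : Monotone (changes y n) := fun _ _ h =>
  Finset.sum_le_sum_of_subset (Finset.range_mono h)

theorem changes_succ_of_ne {n k : ℕ} (h : y n (k + 1) ≠ y n k) :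
    changes y n (k + 1) = changes y n k + 1 := by
  simp [changes, Finset.sum_range_succ, h]

theorem changes_lt_of_ne {n k l : ℕ} (hkl : k ≤ l) (h : y n k ≠ y n l) :
    changes y n k < changes y n l := by
  induction l, hkl using Nat.le_induction with
  | base => exact absurd rfl h
  | succ l hkl ih =>
    by_cases hl : y n k = y n l
    · rw [changes_succ_of_ne (fun e => h (hl.trans e.symm))]
      exact Nat.lt_succ_of_le (changes_mono y n hkl)
    · exact (ih hl).trans_le (changes_mono y n l.le_succ)

/-- Two different neighbouring values on the coarse grid force a change between them on the finer
one. -/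
theorem changes_le_double (hc : ∀ n k, y (n + 1) (2 * k) = y n k) (n k : ℕ) :
    changes y n k ≤ changes y (n + 1) (2 * k) := by
  classical
  induction k with
  | zero => simp [changes]
  | succ k ih =>
    by_cases h : y n (k + 1) = y n k
    · have : changes y n (k + 1) = changes y n k := by
        simp [changes, Finset.sum_range_succ, h]
      rw [this]
      exact ih.trans (changes_mono y _ (by omega))
    · rw [changes_succ_of_ne h]
      have : changes y (n + 1) (2 * k) < changes y (n + 1) (2 * (k + 1)) :=
        changes_lt_of_ne (by omega) (by rw [hc, hc]; exact fun e => h e.symm)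
      omega

theorem dyadic_refine (hc : ∀ n k, y (n + 1) (2 * k) = y n k) (n j k : ℕ) :
    y (n + j) (k * 2 ^ j) = y n k := by
  induction j with
  | zero => simp
  | succ j ih =>
    rw [← ih, ← add_assoc, ← hc (n + j)]
    congr 1
    ring

/-- The time `k / 2 ^ n`. -/
def gridTime (n k : ℕ) : ℝ≥0 := k / 2 ^ n

theorem gridTime_mul (n j k : ℕ) : gridTime n k * 2 ^ (n + j) = (k * 2 ^ j : ℕ) := by
  have : (2 : ℝ≥0) ^ n ≠ 0 := by positivity
  rw [gridTime, pow_add]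
  push_cast
  field_simp

/-- The number of changes up to time `t`. -/
def changeCount (y : ℕ → ℕ → X) (t : ℝ≥0) : ℕ := ⨆ n, changes y n ⌊t * 2 ^ n⌋₊

namespace IsDyadicPath

theorem bddAbove (hy : IsDyadicPath y) (t : ℝ≥0) :
    BddAbove (Set.range fun n => changes y n ⌊t * 2 ^ n⌋₊) := by
  obtain ⟨N, hN⟩ := exists_nat_ge t
  obtain ⟨B, hB⟩ := hy.bounded N
  refine ⟨B, ?_⟩
  rintro _ ⟨n, rfl⟩
  refine (changes_mono y n ?_).trans (hB n)
  refine Nat.floor_le_of_le ?_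
  push_cast
  gcongr

theorem changeCount_mono (hy : IsDyadicPath y) : Monotone (changeCount y) := fun s t hst =>
  ciSup_mono (hy.bddAbove t) fun n => changes_mono y n (Nat.floor_mono (by gcongr))

theorem monotone_level (hy : IsDyadicPath y) (t : ℝ≥0) :
    Monotone fun n => changes y n ⌊t * 2 ^ n⌋₊ := by
  refine monotone_nat_of_le_succ fun n => (changes_le_double hy.consistent n _).trans
    (changes_mono y _ (Nat.le_floor ?_))
  push_cast
  calc (2 : ℝ≥0) * ⌊t * 2 ^ n⌋₊ ≤ 2 * (t * 2 ^ n) := by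
        gcongr; exact Nat.floor_le zero_le
    _ = _ := by ring

theorem exists_changes_eq (hy : IsDyadicPath y) (t : ℝ≥0) :
    ∃ n₀, ∀ n ≥ n₀, changes y n ⌊t * 2 ^ n⌋₊ = changeCount y t := by
  obtain ⟨n₀, hn₀⟩ := Nat.sSup_mem (Set.range_nonempty _) (hy.bddAbove t)
  refine ⟨n₀, fun n hn => le_antisymm (le_ciSup (hy.bddAbove t) n) ?_⟩
  exact (hn₀.symm.trans_le (hy.monotone_level t hn) : _)

/-- Compare both values on a common finer level at which the count up to the earlier time has
reached its supremum. The change between the two times then adds at least one. -/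
theorem changeCount_lt (hy : IsDyadicPath y) {n k n' k' : ℕ} (h : gridTime n k < gridTime n' k')
    (hne : y n k ≠ y n' k') : changeCount y (gridTime n k) < changeCount y (gridTime n' k') := by
  obtain ⟨n₀, hn₀⟩ := hy.exists_changes_eq (gridTime n k)
  have h1 := hn₀ (n₀ + n + n') (by omega)
  have e1 : ⌊gridTime n k * 2 ^ (n₀ + n + n')⌋₊ = k * 2 ^ (n₀ + n') := by
    rw [show n₀ + n + n' = n + (n₀ + n') by ring, gridTime_mul, Nat.floor_natCast]
  have e2 : ⌊gridTime n' k' * 2 ^ (n₀ + n + n')⌋₊ = k' * 2 ^ (n₀ + n) := by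
    rw [show n₀ + n + n' = n' + (n₀ + n) by ring, gridTime_mul, Nat.floor_natCast]
  have v1 : y (n₀ + n + n') (k * 2 ^ (n₀ + n')) = y n k := by
    rw [show n₀ + n + n' = n + (n₀ + n') by ring, dyadic_refine hy.consistent]
  have v2 : y (n₀ + n + n') (k' * 2 ^ (n₀ + n)) = y n' k' := by
    rw [show n₀ + n + n' = n' + (n₀ + n) by ring, dyadic_refine hy.consistent]
  have hle : k * 2 ^ (n₀ + n') ≤ k' * 2 ^ (n₀ + n) := by
    rw [← e1, ← e2]
    exact Nat.floor_mono (by gcongr)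
  rw [← h1, e1]
  refine (changes_lt_of_ne hle (by rwa [v1, v2])).trans_le ?_
  rw [← e2]
  exact le_ciSup (hy.bddAbove (gridTime n' k')) (n₀ + n + n')

theorem eq_of_changeCount_eq (hy : IsDyadicPath y) {n k n' k' : ℕ}
    (h : changeCount y (gridTime n k) = changeCount y (gridTime n' k')) : y n k = y n' k' := by
  by_contra hne
  rcases lt_trichotomy (gridTime n k) (gridTime n' k') with hlt | heq | hlt
  · exact (hy.changeCount_lt hlt hne).ne h
  · have h1 := gridTime_mul n n' k
    have h2 := gridTime_mul n' n k'
    rw [heq, add_comm n n', h2] at h1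
    have h3 : k' * 2 ^ n = k * 2 ^ n' := by exact_mod_cast h1
    apply hne
    rw [← dyadic_refine hy.consistent n n' k, ← dyadic_refine hy.consistent n' n k', h3,
      add_comm]
  · exact (hy.changeCount_lt hlt (Ne.symm hne)).ne h.symm

end IsDyadicPath

/-- The first grid time of level `n` after `t`, in units of `2 ^ (-n)`. -/
def nextIndex (n : ℕ) (t : ℝ≥0) : ℕ := ⌊t * 2 ^ n⌋₊ + 1

theorem lt_gridTime_nextIndex (n : ℕ) (t : ℝ≥0) : t < gridTime n (nextIndex n t) := by
  rw [gridTime, lt_div_iff₀ (by positivity), nextIndex]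
  push_cast
  exact Nat.lt_floor_add_one _

theorem gridTime_nextIndex_le (n : ℕ) (t : ℝ≥0) :
    gridTime n (nextIndex n t) ≤ t + (2 ^ n)⁻¹ := by
  rw [gridTime, div_le_iff₀ (by positivity), nextIndex, add_mul, inv_mul_cancel₀ (by positivity)]
  push_cast
  gcongr
  exact Nat.floor_le zero_le

theorem nextIndex_mono (n : ℕ) : Monotone (nextIndex n) := fun s t h =>
  Nat.succ_le_succ (Nat.floor_mono (by gcongr))

theorem tendsto_gridTime_nextIndex (t : ℝ≥0) :
    Tendsto (fun n => gridTime n (nextIndex n t)) atTop (𝓝 t) := by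
  have h : Tendsto (fun n : ℕ => t + ((2 : ℝ≥0) ^ n)⁻¹) atTop (𝓝 (t + 0)) := by
    refine tendsto_const_nhds.add ?_
    simp_rw [← inv_pow]
    exact tendsto_pow_atTop_nhds_zero_of_lt_one (r := (2 : ℝ≥0)⁻¹)
      (by positivity) (inv_lt_one_of_one_lt₀ one_lt_two)
  rw [add_zero] at h
  exact tendsto_of_tendsto_of_tendsto_of_le_of_le tendsto_const_nhds h
    (fun n => (lt_gridTime_nextIndex n t).le) (fun n => gridTime_nextIndex_le n t)

theorem exists_gridTime_mem {s t : ℝ≥0} (h : s < t) :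
    ∃ n, s < gridTime n (nextIndex n s) ∧ gridTime n (nextIndex n s) < t := by
  obtain ⟨n, hn⟩ := ((tendsto_gridTime_nextIndex s).eventually_lt_const h).exists
  exact ⟨n, lt_gridTime_nextIndex n s, hn⟩

namespace IsDyadicPath

/-- The change count is monotone and takes values in ℕ, so it attains a minimum over times after `t`
and is constant just after `t`; a constant count means a constant path. No topology on `X` is
involved. -/
theorem exists_right_value (hy : IsDyadicPath y) (t : ℝ≥0) :
    ∃ a, ∃ s > t, ∀ n k, t < gridTime n k → gridTime n k < s → y n k = a := by
  obtain ⟨s, hs, hmin⟩ : ∃ s ∈ Set.Ioi t, ∀ r ∈ Set.Ioi t, changeCount y s ≤ changeCount y r := by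
    obtain ⟨s, hs, h⟩ := Nat.sInf_mem
      (Set.Nonempty.image (changeCount y) (⟨t + 1, lt_add_one t⟩ : (Set.Ioi t).Nonempty))
    exact ⟨s, hs, fun r hr => h ▸ Nat.sInf_le ⟨r, hr, rfl⟩⟩
  obtain ⟨m, hm1, hm2⟩ := exists_gridTime_mem (Set.mem_Ioi.1 hs)
  refine ⟨y m (nextIndex m t), s, hs, fun n k h1 h2 => hy.eq_of_changeCount_eq ?_⟩
  exact (le_antisymm (hy.changeCount_mono h2.le) (hmin _ h1)).trans
    (le_antisymm (hy.changeCount_mono hm2.le) (hmin _ hm1)).symm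

theorem exists_left_value (hy : IsDyadicPath y) {t : ℝ≥0} (ht : 0 < t) :
    ∃ a, ∃ s < t, ∀ n k, s < gridTime n k → gridTime n k < t → y n k = a := by
  have hbdd : BddAbove (changeCount y '' Set.Iio t) :=
    ⟨changeCount y t, by rintro _ ⟨r, hr, rfl⟩; exact hy.changeCount_mono (le_of_lt hr)⟩
  obtain ⟨s, hs, hsup⟩ := Nat.sSup_mem (Set.Nonempty.image _ ⟨0, ht⟩) hbdd
  have hmax : ∀ r ∈ Set.Iio t, changeCount y r ≤ changeCount y s := fun r hr =>
    hsup ▸ le_csSup hbdd ⟨r, hr, rfl⟩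
  obtain ⟨m, hm1, hm2⟩ := exists_gridTime_mem (Set.mem_Iio.1 hs)
  refine ⟨y m (nextIndex m s), s, hs, fun n k h1 h2 => hy.eq_of_changeCount_eq ?_⟩
  exact (le_antisymm (hmax _ h2) (hy.changeCount_mono h1.le)).trans
    (le_antisymm (hmax _ hm2) (hy.changeCount_mono hm1.le)).symm

/-- The value at time `t` of the right-continuous extension of a dyadic path. -/
def rightValue (hy : IsDyadicPath y) (t : ℝ≥0) : X := (hy.exists_right_value t).choose

theorem rightValue_spec (hy : IsDyadicPath y) (t : ℝ≥0) :
    ∃ s > t, ∀ n k, t < gridTime n k → gridTime n k < s → y n k = hy.rightValue t :=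
  (hy.exists_right_value t).choose_spec

/-- `nextIndex` is strictly later than `t`, so this identifies the limit from the right even when
`t` is itself a grid time. -/
theorem eventually_eq_rightValue (hy : IsDyadicPath y) (t : ℝ≥0) :
    ∀ᶠ n in atTop, y n (nextIndex n t) = hy.rightValue t := by
  obtain ⟨s, hs, h⟩ := hy.rightValue_spec t
  filter_upwards [(tendsto_gridTime_nextIndex t).eventually_lt_const hs] with n hn
  exact h n _ (lt_gridTime_nextIndex n t) hn

theorem rightValue_eq_of_const (hy : IsDyadicPath y) {r s u : ℝ≥0} {a : X}
    (h : ∀ n k, r < gridTime n k → gridTime n k < s → y n k = a) (hru : r ≤ u) (hus : u < s) :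
    hy.rightValue u = a := by
  obtain ⟨n, hn, hns⟩ := ((hy.eventually_eq_rightValue u).and
    ((tendsto_gridTime_nextIndex u).eventually_lt_const hus)).exists
  rw [← hn]
  exact h n _ (hru.trans_lt (lt_gridTime_nextIndex n u)) hns

theorem eventually_rightValue_eq_right (hy : IsDyadicPath y) (t : ℝ≥0) :
    ∀ᶠ u in 𝓝[≥] t, hy.rightValue u = hy.rightValue t := by
  obtain ⟨s, hs, h⟩ := hy.rightValue_spec t
  filter_upwards [Ico_mem_nhdsGE hs] with u hu
  exact hy.rightValue_eq_of_const h hu.1 hu.2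

theorem exists_eventually_rightValue_eq_left (hy : IsDyadicPath y) (t : ℝ≥0) :
    ∃ a, ∀ᶠ u in 𝓝[<] t, hy.rightValue u = a := by
  rcases eq_or_ne t 0 with rfl | ht
  · refine ⟨y 0 0, ?_⟩
    simp
  · obtain ⟨a, s, hs, h⟩ := hy.exists_left_value (pos_iff_ne_zero.2 ht)
    refine ⟨a, ?_⟩
    filter_upwards [Ioo_mem_nhdsLT hs] with u hu
    exact hy.rightValue_eq_of_const h hu.1.le hu.2

end IsDyadicPath

end DyadicPath

/-! ### The chains observed at dyadic times -/

section GridChain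

theorem lintegral_pair_of_isChainLaw {S : Type*} [MeasurableSpace S] {q : Kernel S S}
    [IsMarkovKernel q] {ρ : Measure (ℕ → S)} [IsProbabilityMeasure ρ] (hρ : IsChainLaw q ρ)
    (k : ℕ) : ρ.map (fun y => (y k, y (k + 1))) = (ρ.map fun y => y k) ⊗ₘ q := by
  have hm : Measurable fun y : ℕ → S => (y k, y (k + 1)) := by fun_prop
  have := Measure.isProbabilityMeasure_map (μ := ρ) hm.aemeasurable
  have := Measure.isProbabilityMeasure_map (μ := ρ) (measurable_pi_apply k).aemeasurable
  refine Measure.ext_prod fun {s t} hs ht => ?_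
  rw [Measure.compProd_apply_prod hs ht, Measure.map_apply hm (hs.prod ht),
    setLIntegral_map hs (q.measurable_coe ht) (measurable_pi_apply k)]
  have h := hρ k (fun y => s.indicator 1 (y k)) (t.indicator 1)
    ((measurable_one.indicator hs).comp (measurable_pi_apply k))
    (fun y y' hy => by simp only [hy k (Set.mem_Iic.2 le_rfl)]) (measurable_one.indicator ht)
  simp only [lintegral_indicator_one ht] at h
  rw [← lintegral_indicator_one (hm (hs.prod ht)),
    ← lintegral_indicator (measurable_pi_apply k hs)]
  refine Eq.trans (lintegral_congr fun y => ?_) (h.trans (lintegral_congr fun y => ?_))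
  · by_cases h1 : y k ∈ s <;> by_cases h2 : y (k + 1) ∈ t <;> simp [h1, h2]
  · by_cases h1 : y k ∈ s <;> simp [h1]

variable {V X : Type*} [MeasurableSpace X] [StandardBorelSpace X]
  {μ : ℝ≥0 → Kernel (V → X) (V → X)}

/-- The mesh of the level `n` grid. -/
def mesh (n : ℕ) : ℝ≥0 := (2 ^ n)⁻¹

theorem mesh_add_mesh (n : ℕ) : mesh (n + 1) + mesh (n + 1) = mesh n := by
  simp only [mesh, pow_succ]
  have : (2 : ℝ≥0) ^ n ≠ 0 := by positivity
  field_simp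
  norm_num

omit [StandardBorelSpace X] in
theorem pow_mesh {E : Type*} [MeasurableSpace E] {μ : ℝ≥0 → Kernel E E}
    (hμ : IsMarkovianFamily μ) (n j : ℕ) : (μ (mesh n)) ^ j = μ (j * mesh n) := by
  induction j with
  | zero =>
    ext1 x
    rw [pow_zero, Nat.cast_zero, zero_mul, hμ.zero]
    exact Kernel.id_apply x
  | succ j ih =>
    rw [pow_succ, ih, Nat.cast_succ, add_mul, one_mul, add_comm, ← comp_eq_of_isMarkovianFamily hμ]
    rfl

theorem measure_change_le {C : ℝ≥0} (hC : ∀ v t x, μ t x {y | y v ≠ x v} ≤ C * t)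
    (hμ : IsMarkovianFamily μ) {n : ℕ} {ρ : Measure (ℕ → V → X)} [IsProbabilityMeasure ρ]
    (hρ : IsChainLaw (μ (mesh n)) ρ) (v : V) (k : ℕ) :
    ρ {y | y (k + 1) v ≠ y k v} ≤ C * mesh n := by
  have := hμ.isMarkovKernel (mesh n)
  have hD : MeasurableSet {p : (V → X) × (V → X) | p.2 v ≠ p.1 v} :=
    (measurableSet_eq_fun ((measurable_pi_apply v).comp measurable_snd)
      ((measurable_pi_apply v).comp measurable_fst)).compl
  have hm : Measurable fun y : ℕ → V → X => (y k, y (k + 1)) := by fun_prop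
  have := Measure.isProbabilityMeasure_map (μ := ρ) (measurable_pi_apply k).aemeasurable
  have h1 : ρ {y | y (k + 1) v ≠ y k v} =
      ρ.map (fun y => (y k, y (k + 1))) {p : (V → X) × (V → X) | p.2 v ≠ p.1 v} := by
    rw [Measure.map_apply hm hD]; rfl
  rw [h1, lintegral_pair_of_isChainLaw hρ, Measure.compProd_apply hD]
  refine (lintegral_mono (g := fun _ => (C : ℝ≥0∞) * mesh n) fun z => hC v _ z).trans ?_
  simp

end GridChain

/-! ### Dyadic processes with piecewise constant coordinates -/

section DyadicProcess

variable {V X : Type*} [Countable V] [MeasurableSpace X] [StandardBorelSpace X]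
  {μ : ℝ≥0 → Kernel (V → X) (V → X)}

theorem isDyadicPath_const {X : Type*} (a : X) : IsDyadicPath fun (_ _ : ℕ) => a where
  consistent _ _ := rfl
  bounded _ := ⟨0, fun n => by simp [changes]⟩

theorem exists_dyadic_process (hμ : IsMarkovianFamily μ) {C : ℝ≥0}
    (hC : ∀ v t x, μ t x {y | y v ≠ x v} ≤ C * t) (x : V → X) :
    ∃ Z : ℕ → UniformSeq → ℕ → V → X, (∀ n, Measurable (Z n)) ∧
      (∀ n, IsChainLaw (μ (mesh n)) (uniformSeq.map (Z n))) ∧ (∀ n ω, Z n ω 0 = x) ∧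
      ∀ ω v, IsDyadicPath fun n k => Z n ω k v := by
  classical
  have := hμ.isMarkovKernel
  have : Nonempty (V → X) := ⟨x⟩
  choose ρ hρP hρ0 hρ using fun n => exists_isChainLaw (μ (mesh n)) x
  have hdbl : Measurable fun (y : ℕ → V → X) k => y (2 * k) := by fun_prop
  have hcons : ∀ n, (ρ (n + 1)).map (fun y k => y (2 * k)) = ρ n := by
    intro n
    have := Measure.isProbabilityMeasure_map (μ := ρ (n + 1)) hdbl.aemeasurable
    refine IsChainLaw.unique ?_ (hρ0 n) ((hρ (n + 1)).map_double ?_) (hρ n)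
    · rw [ae_map_iff hdbl.aemeasurable
        (measurableSet_eq_fun (measurable_pi_apply 0) measurable_const)]
      exact hρ0 (n + 1)
    · rw [comp_eq_of_isMarkovianFamily hμ, mesh_add_mesh]
  obtain ⟨Z, hZm, hZl, hZ⟩ := exists_inverse_limit ρ (fun _ y k => y (2 * k)) (fun _ => hdbl) hcons
  have hDm : ∀ v j, MeasurableSet {y : ℕ → V → X | y (j + 1) v ≠ y j v} := fun v j =>
    (measurableSet_eq_fun (by fun_prop) (by fun_prop)).compl
  have hcount : ∀ n v k ω, (changes (fun n k => Z n ω k v) n k : ℝ≥0∞) =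
      ∑ j ∈ Finset.range k, {y : ℕ → V → X | y (j + 1) v ≠ y j v}.indicator 1 (Z n ω) := by
    intro n v k ω
    simp only [changes, Nat.cast_sum]
    refine Finset.sum_congr rfl fun j _ => ?_
    by_cases h : Z n ω (j + 1) v = Z n ω j v <;> simp [h]
  have hcm : ∀ n v k, Measurable fun ω => (changes (fun n k => Z n ω k v) n k : ℝ≥0∞) := by
    intro n v k
    simp only [hcount]
    exact Finset.measurable_sum _ fun j _ => (measurable_one.indicator (hDm v j)).comp (hZm n)
  -- There are `N * 2 ^ n` steps, each changing the site with probability at most `C / 2 ^ n`, so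
  -- the level cancels.
  have hexp : ∀ n v N, ∫⁻ ω, (changes (fun n k => Z n ω k v) n (N * 2 ^ n) : ℝ≥0∞) ∂uniformSeq ≤
      N * C := by
    intro n v N
    simp only [hcount]
    have hIm : ∀ j, Measurable fun ω =>
        {y : ℕ → V → X | y (j + 1) v ≠ y j v}.indicator (1 : (ℕ → V → X) → ℝ≥0∞) (Z n ω) := fun j =>
      (measurable_one.indicator (hDm v j)).comp (hZm n)
    rw [lintegral_finsetSum _ fun j _ => hIm j]
    have : ∀ j, ∫⁻ ω, {y : ℕ → V → X | y (j + 1) v ≠ y j v}.indicator 1 (Z n ω) ∂uniformSeq ≤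
        C * mesh n := by
      intro j
      rw [← lintegral_map (measurable_one.indicator (hDm v j)) (hZm n), hZl n,
        lintegral_indicator_one (hDm v j)]
      exact measure_change_le hC hμ (hρ n) v j
    refine (Finset.sum_le_sum fun j _ => this j).trans ?_
    rw [Finset.sum_const, Finset.card_range, nsmul_eq_mul]
    have h2 : (2 : ℝ≥0) ^ n ≠ 0 := by positivity
    have h3 : ((N * 2 ^ n : ℕ) : ℝ≥0) * (C * mesh n) = N * C := by
      simp only [mesh]; push_cast; field_simp
    exact_mod_cast h3.le
  -- Fatou's lemma gives a finite liminf; since the counts increase with the level, the liminf is a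
  -- bound for all of them.
  have hfin : ∀ᵐ ω ∂uniformSeq, ∀ v N,
      liminf (fun n => (changes (fun n k => Z n ω k v) n (N * 2 ^ n) : ℝ≥0∞)) atTop < ∞ := by
    rw [ae_all_iff]; intro v
    rw [ae_all_iff]; intro N
    refine ae_lt_top (Measurable.liminf fun n => hcm n v _) (ne_of_lt ?_)
    refine (lintegral_liminf_le fun n => hcm n v _).trans_lt ?_
    refine lt_of_le_of_lt (liminf_le_of_le (a := (N * C : ℝ≥0∞)) (by isBoundedDefault)
      fun b hb => ?_) (ENNReal.mul_lt_top (by simp) ENNReal.coe_lt_top)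
    obtain ⟨n, hn⟩ := hb.exists
    exact hn.trans (hexp n v N)
  have h0 : ∀ᵐ ω ∂uniformSeq, ∀ n, Z n ω 0 = x := by
    rw [ae_all_iff]; intro n
    have := hρ0 n
    rw [← hZl n] at this
    exact ae_of_ae_map (hZm n).aemeasurable this
  have hgood : ∀ᵐ ω ∂uniformSeq, (∀ n, Z n ω 0 = x) ∧ ∀ v, IsDyadicPath fun n k => Z n ω k v := by
    filter_upwards [hZ, hfin, h0] with ω h1 h2 h3
    refine ⟨h3, fun v => ?_⟩
    have hcon : ∀ n k, Z (n + 1) ω (2 * k) v = Z n ω k v := fun n k => by rw [← h1 n]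
    refine ⟨hcon, fun N => ?_⟩
    have hmono : Monotone fun n => (changes (fun n k => Z n ω k v) n (N * 2 ^ n) : ℝ≥0∞) := by
      refine monotone_nat_of_le_succ fun n => ?_
      have := changes_le_double (y := fun n k => Z n ω k v) hcon n (N * 2 ^ n)
      rw [show 2 * (N * 2 ^ n) = N * 2 ^ (n + 1) by ring] at this
      exact_mod_cast this
    have hsup := h2 v N
    rw [(tendsto_atTop_iSup hmono).liminf_eq] at hsup
    obtain ⟨B, hB⟩ := ENNReal.exists_nat_gt hsup.ne
    exact ⟨B, fun n => by exact_mod_cast (le_iSup (fun n =>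
      (changes (fun n k => Z n ω k v) n (N * 2 ^ n) : ℝ≥0∞)) n).trans hB.le⟩
  -- On a measurable null set the process is replaced by a constant path, so that path regularity
  -- holds for every `ω` and the laws are unchanged.
  obtain ⟨t, hsub, ht, ht0⟩ := exists_measurable_superset_of_null (ae_iff.1 hgood)
  have hgood' : ∀ ω ∉ t, (∀ n, Z n ω 0 = x) ∧ ∀ v, IsDyadicPath fun n k => Z n ω k v :=
    fun ω hω => by by_contra h; exact hω (hsub h)
  refine ⟨fun n ω => if ω ∈ t then fun _ => x else Z n ω,
    fun n => Measurable.ite ht measurable_const (hZm n), fun n => ?_, fun n ω => ?_, fun ω v => ?_⟩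
  · have : (fun ω => if ω ∈ t then fun _ => x else Z n ω) =ᵐ[uniformSeq] Z n := by
      filter_upwards [measure_eq_zero_iff_ae_notMem.1 ht0] with ω hω
      simp [hω]
    rw [Measure.map_congr this, hZl]
    exact hρ n
  · by_cases h : ω ∈ t
    · simp [h]
    · simp [h, (hgood' ω h).1 n]
  · by_cases h : ω ∈ t
    · simpa [h] using isDyadicPath_const (x v)
    · simpa [h] using (hgood' ω h).2 v

end DyadicProcess

/-! ### The càdlàg process -/

section Cadlag

variable {V X : Type*} [MeasurableSpace X] {μ : ℝ≥0 → Kernel (V → X) (V → X)}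

theorem abs_semigroup_sub_semigroup_le (hμ : IsMarkovianFamily μ) {f : (V → X) → ℝ}
    (hf : f ∈ boundedMeasurable (V → X)) {L : ℝ}
    (hL : ∀ (t : ℝ≥0) x, |semigroup μ t f x - f x| ≤ L * t) (s t : ℝ≥0) (x : V → X) :
    |semigroup μ s f x - semigroup μ t f x| ≤ L * |(s : ℝ) - t| := by
  have key : ∀ s t : ℝ≥0, s ≤ t →
      |semigroup μ t f x - semigroup μ s f x| ≤ L * ((t : ℝ) - s) := by
    intro s t hst
    obtain ⟨r, rfl⟩ := exists_add_of_le hst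
    rw [semigroup_add hμ _ _ hf]
    refine (abs_semigroup_sub_le hμ _ (boundedMeasurable_semigroup hμ r hf) hf (hL r) x).trans ?_
    push_cast
    rw [add_sub_cancel_left]
  rcases le_total s t with h | h
  · rw [abs_sub_comm, abs_sub_comm (s : ℝ),
      abs_of_nonneg (a := (t : ℝ) - s) (sub_nonneg.2 (by exact_mod_cast h))]
    exact key s t h
  · rw [abs_of_nonneg (a := (s : ℝ) - t) (sub_nonneg.2 (by exact_mod_cast h))]
    exact key t s h

/-- Convergence of the semigroup along convergent times and coordinatewise eventually constant
configurations. -/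
theorem tendsto_semigroup_of_eventually_eq (hμ : IsMarkovianFamily μ) {f : (V → X) → ℝ}
    (hf : f ∈ cylinderFun V X) {L : ℝ}
    (hL : ∀ (t : ℝ≥0) x, |semigroup μ t f x - f x| ≤ L * t) {t : ℝ≥0}
    (happ : ∀ ε > 0, ∃ g ∈ cylinderFun V X, ∀ x, |semigroup μ t f x - g x| ≤ ε)
    {τ : ℕ → ℝ≥0} (hτ : Tendsto τ atTop (𝓝 t)) {z : ℕ → V → X} {w : V → X}
    (hz : ∀ v, ∀ᶠ n in atTop, z n v = w v) :
    Tendsto (fun n => semigroup μ (τ n) f (z n)) atTop (𝓝 (semigroup μ t f w)) := by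
  -- Time is varied first, by a Lipschitz bound uniform in the configuration. Then `P_t f` is
  -- approximated uniformly by a function of finitely many coordinates, on which `z n` and `w`
  -- eventually agree; this replaces Feller continuity.
  have h1 : Tendsto (fun n => semigroup μ (τ n) f (z n) - semigroup μ t f (z n)) atTop (𝓝 0) := by
    refine squeeze_zero_norm (fun n =>
      abs_semigroup_sub_semigroup_le hμ hf.1 hL (τ n) t (z n)) ?_
    have : Tendsto (fun n => (τ n : ℝ) - t) atTop (𝓝 0) := by
      simpa using (NNReal.tendsto_coe.2 hτ).sub_const (t : ℝ)
    simpa using this.abs.const_mul L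
  have h2 : Tendsto (fun n => semigroup μ t f (z n)) atTop (𝓝 (semigroup μ t f w)) := by
    rw [Metric.tendsto_nhds]
    intro ε hε
    obtain ⟨g, ⟨-, A, hA⟩, hg⟩ := happ (ε / 3) (by positivity)
    have hev : ∀ᶠ n in atTop, ∀ v ∈ A, z n v = w v :=
      (eventually_all_finset A).2 fun v _ => hz v
    filter_upwards [hev] with n hn
    have e : g (z n) = g w := hA fun v hv => hn v hv
    have a1 := hg (z n)
    have a2 := hg w
    rw [e] at a1
    rw [Real.dist_eq, abs_lt]
    rw [abs_le] at a1 a2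
    constructor <;> linarith [a1.1, a1.2, a2.1, a2.2]
  simpa using h1.add h2

theorem eventually_eq_of_cylinderFun {f : (V → X) → ℝ} (hf : f ∈ cylinderFun V X)
    {z : ℕ → V → X} {w : V → X} (hz : ∀ v, ∀ᶠ n in atTop, z n v = w v) :
    ∀ᶠ n in atTop, f (z n) = f w := by
  obtain ⟨-, A, hA⟩ := hf
  filter_upwards [(eventually_all_finset A).2 fun v _ => hz v] with n hn
  exact hA fun v hv => hn v hv

/-- The π-system of finite-dimensional events of a process up to time `s`. -/
def pastEvents {Ω : Type*} (ζ : ℝ≥0 → Ω → V → X) (s : ℝ≥0) : Set (Set Ω) :=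
  piiUnionInter (fun r => Set.preimage (ζ r) '' measurableCylinders fun _ : V => X) {r | r ≤ s}

theorem isPiSystem_pastEvents {Ω : Type*} (ζ : ℝ≥0 → Ω → V → X) (s : ℝ≥0) :
    IsPiSystem (pastEvents ζ s) := by
  refine isPiSystem_piiUnionInter _ (fun r => ?_) _
  rintro _ ⟨S, hS, rfl⟩ _ ⟨T, hT, rfl⟩ h
  exact ⟨S ∩ T, inter_mem_measurableCylinders hS hT, rfl⟩

theorem iSup_comap_le_generateFrom_pastEvents {Ω : Type*} (ζ : ℝ≥0 → Ω → V → X) (s : ℝ≥0) :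
    ⨆ r ≤ s, MeasurableSpace.pi.comap (ζ r) ≤ MeasurableSpace.generateFrom (pastEvents ζ s) := by
  refine iSup₂_le fun r hr => ?_
  rw [← generateFrom_measurableCylinders, MeasurableSpace.comap_generateFrom]
  exact MeasurableSpace.generateFrom_mono (subset_piiUnionInter (S := {r | r ≤ s})
    (π := fun r => Set.preimage (ζ r) '' measurableCylinders fun _ : V => X) hr)

theorem measurableSet_of_mem_pastEvents {Ω : Type*} [MeasurableSpace Ω] {ζ : ℝ≥0 → Ω → V → X}
    (hζ : ∀ t, Measurable (ζ t)) {s : ℝ≥0} {B : Set Ω} (hB : B ∈ pastEvents ζ s) :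
    MeasurableSet B := by
  obtain ⟨J, -, S, hS, rfl⟩ := hB
  refine Finset.measurableSet_biInter _ fun r hr => ?_
  obtain ⟨T, hT, h⟩ := hS r hr
  rw [← h]
  exact hζ r (MeasurableSet.of_mem_measurableCylinders hT)

end Cadlag

/-! ### The Markov property in the limit of dyadic grids -/

section MarkovProperty

theorem IsChainLaw.integral_multi_step {S : Type*} [MeasurableSpace S] {q : Kernel S S}
    [IsMarkovKernel q] {ρ : Measure (ℕ → S)} [IsProbabilityMeasure ρ] (hρ : IsChainLaw q ρ)
    (k j : ℕ) {G : (ℕ → S) → ℝ} {f : S → ℝ} (hG : Measurable G) (hGd : DependsOn G (Set.Iic k))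
    (hG0 : ∀ y, 0 ≤ G y) (hf : f ∈ boundedMeasurable S) (hf0 : ∀ z, 0 ≤ f z) :
    ∫ y, G y * f (y (k + j)) ∂ρ = ∫ y, G y * ∫ z, f z ∂((q ^ j) (y k)) ∂ρ := by
  have hq : Measurable fun z => ∫ z', f z' ∂((q ^ j) z) :=
    (hf.1.stronglyMeasurable.integral_kernel (κ := q ^ j)).measurable
  have hm := hf.1
  rw [integral_eq_lintegral_of_nonneg_ae (ae_of_all _ fun y => mul_nonneg (hG0 y) (hf0 _))
      (hG.mul (hm.comp (measurable_pi_apply _))).aestronglyMeasurable,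
    integral_eq_lintegral_of_nonneg_ae
      (ae_of_all _ fun y => mul_nonneg (hG0 y) (integral_nonneg hf0))
      (hG.mul (hq.comp (measurable_pi_apply _))).aestronglyMeasurable]
  have e1 : ∀ y, ENNReal.ofReal (G y * f (y (k + j))) =
      ENNReal.ofReal (G y) * ENNReal.ofReal (f (y (k + j))) := fun y => ENNReal.ofReal_mul (hG0 y)
  have e2 : ∀ y, ENNReal.ofReal (G y * ∫ z, f z ∂((q ^ j) (y k))) =
      ENNReal.ofReal (G y) * ∫⁻ z, ENNReal.ofReal (f z) ∂((q ^ j) (y k)) := fun y => by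
    rw [ENNReal.ofReal_mul (hG0 y), ofReal_integral_eq_lintegral_ofReal
      (integrable_of_boundedMeasurable hf) (ae_of_all _ hf0)]
  simp_rw [e1, e2]
  rw [hρ.multi_step k j hG.ennreal_ofReal (fun y y' h => by simp only [hGd h]) hm.ennreal_ofReal]

variable {V X : Type*} [Countable V] [TopologicalSpace X] [PolishSpace X] [MeasurableSpace X]
  [BorelSpace X] {μ : ℝ≥0 → Kernel (V → X) (V → X)}

omit [Countable V] [TopologicalSpace X] [PolishSpace X] [BorelSpace X] in
/-- The Markov property on a generating class of events, by passage to the limit from dyadic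
times. -/
theorem measure_inter_eq_of_mem_pastEvents (hμ : IsMarkovianFamily μ)
    (hL : ∀ f ∈ cylinderFun V X, ∃ L : ℝ, ∀ (t : ℝ≥0) x, |semigroup μ t f x - f x| ≤ L * t)
    (happ : ∀ t, ∀ f ∈ cylinderFun V X, ∀ ε > 0, ∃ g ∈ cylinderFun V X,
      ∀ x, |semigroup μ t f x - g x| ≤ ε)
    {Z : ℕ → UniformSeq → ℕ → V → X} (hZm : ∀ n, Measurable (Z n))
    (hZ : ∀ n, IsChainLaw (μ (mesh n)) (uniformSeq.map (Z n)))
    {ζ : ℝ≥0 → UniformSeq → V → X} (hζm : ∀ t, Measurable (ζ t))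
    (hY : ∀ t ω v, ∀ᶠ n in atTop, Z n ω (nextIndex n t) v = ζ t ω v)
    (s t : ℝ≥0) {B : Set UniformSeq} (hB : B ∈ pastEvents ζ s) {T : Set (V → X)}
    (hT : T ∈ measurableCylinders fun _ : V => X) :
    uniformSeq (B ∩ ζ (s + t) ⁻¹' T) = ∫⁻ ω in B, μ t (ζ s ω) T ∂uniformSeq := by
  have := hμ.isMarkovKernel
  have hBm := measurableSet_of_mem_pastEvents hζm hB
  have hTm : MeasurableSet T := MeasurableSet.of_mem_measurableCylinders hT
  have hcyl : ∀ S ∈ measurableCylinders (fun _ : V => X),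
      S.indicator (fun _ => (1 : ℝ)) ∈ cylinderFun V X := by
    intro S hS
    obtain ⟨A, R, hR, rfl⟩ := (mem_measurableCylinders _).1 hS
    exact indicator_cylinder_mem_cylinderFun hR
  obtain ⟨J, hJs, U, hU, hBU⟩ := hB
  have hU' : ∀ r, ∃ S ∈ measurableCylinders (fun _ : V => X), r ∈ J → ζ r ⁻¹' S = U r := by
    intro r
    by_cases hr : r ∈ J
    · obtain ⟨S, hS, h⟩ := hU r hr
      exact ⟨S, hS, fun _ => h⟩
    · exact ⟨_, univ_mem_measurableCylinders _, fun h => absurd h hr⟩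
  choose S hS hSU using hU'
  set φ : ℝ≥0 → (V → X) → ℝ := fun r => (S r).indicator fun _ => 1 with hφ
  have hφC : ∀ r, φ r ∈ cylinderFun V X := fun r => hcyl _ (hS r)
  have hind : ∀ (R : Set (V → X)) z, 0 ≤ R.indicator (fun _ => (1 : ℝ)) z ∧
      R.indicator (fun _ => (1 : ℝ)) z ≤ 1 := fun R z => by
    by_cases h : z ∈ R <;> simp [h]
  set f : (V → X) → ℝ := T.indicator fun _ => 1 with hf
  have hfC : f ∈ cylinderFun V X := hcyl T hT
  obtain ⟨L, hL⟩ := hL f hfC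
  have hprod0 : ∀ z : ℝ≥0 → V → X, 0 ≤ ∏ r ∈ J, φ r (z r) := fun z =>
    Finset.prod_nonneg fun r _ => (hind _ _).1
  have hprod1 : ∀ z : ℝ≥0 → V → X, ∏ r ∈ J, φ r (z r) ≤ 1 := fun z =>
    Finset.prod_le_one (fun r _ => (hind _ _).1) fun r _ => (hind _ _).2
  have hPf0 : ∀ τ z, 0 ≤ semigroup μ τ f z := fun τ z => integral_nonneg fun y => (hind _ _).1
  have hPf1 : ∀ τ z, semigroup μ τ f z ≤ 1 := fun τ z =>
    (abs_le.1 (abs_semigroup_le hμ τ (fun y => abs_le.2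
      ⟨by linarith [(hind T y).1], (hind T y).2⟩) z)).2
  have hPfm : ∀ τ, Measurable (semigroup μ τ f) := fun τ =>
    (boundedMeasurable_semigroup hμ τ hfC.1).1
  -- The elapsed time between the grid points following `s` and `s + t`. It need not equal `t`,
  -- which is why convergence in the time variable is needed as well.
  let τ : ℕ → ℝ≥0 := fun n => (nextIndex n (s + t) - nextIndex n s : ℕ) * mesh n
  have hτ : Tendsto τ atTop (𝓝 t) := by
    have h1 := (tendsto_gridTime_nextIndex (s + t)).sub (tendsto_gridTime_nextIndex s)
    rw [add_tsub_cancel_left] at h1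
    refine h1.congr fun n => ?_
    simp only [τ, gridTime, mesh, div_eq_mul_inv, Nat.cast_tsub, tsub_mul]
  have hlevel : ∀ n, ∫ ω, (∏ r ∈ J, φ r (Z n ω (nextIndex n r))) *
        f (Z n ω (nextIndex n (s + t))) ∂uniformSeq =
      ∫ ω, (∏ r ∈ J, φ r (Z n ω (nextIndex n r))) *
        semigroup μ (τ n) f (Z n ω (nextIndex n s)) ∂uniformSeq := by
    intro n
    have := Measure.isProbabilityMeasure_map (μ := uniformSeq) (hZm n).aemeasurable
    have hGm : Measurable fun y : ℕ → V → X => ∏ r ∈ J, φ r (y (nextIndex n r)) :=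
      Finset.measurable_prod _ fun r _ => (hφC r).1.1.comp (measurable_pi_apply _)
    have h := (hZ n).integral_multi_step (nextIndex n s) (nextIndex n (s + t) - nextIndex n s)
      (G := fun y => ∏ r ∈ J, φ r (y (nextIndex n r))) hGm
      (fun y y' h => Finset.prod_congr rfl fun r hr => by
        rw [h _ (nextIndex_mono n (hJs hr))])
      (fun y => hprod0 fun r => y (nextIndex n r)) hfC.1 fun z => (hind _ _).1
    rw [add_tsub_cancel_of_le (nextIndex_mono n le_self_add), pow_mesh hμ] at h
    have m1 : Measurable fun y : ℕ → V → X =>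
        (∏ r ∈ J, φ r (y (nextIndex n r))) * f (y (nextIndex n (s + t))) :=
      hGm.mul (hfC.1.1.comp (measurable_pi_apply _))
    have m2 : Measurable fun y : ℕ → V → X =>
        (∏ r ∈ J, φ r (y (nextIndex n r))) * semigroup μ (τ n) f (y (nextIndex n s)) :=
      hGm.mul ((hPfm _).comp (measurable_pi_apply _))
    have e1 := integral_map (μ := uniformSeq) (hZm n).aemeasurable m1.aestronglyMeasurable
    have e2 := integral_map (μ := uniformSeq) (hZm n).aemeasurable m2.aestronglyMeasurable
    rw [← e1, ← e2]
    exact h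
  have hZnm : ∀ n k, Measurable fun ω => Z n ω k := fun n k =>
    (measurable_pi_apply k).comp (hZm n)
  have hpm : ∀ n, Measurable fun ω => ∏ r ∈ J, φ r (Z n ω (nextIndex n r)) := fun n =>
    Finset.measurable_prod _ fun r _ => (hφC r).1.1.comp (hZnm n _)
  have hplim : ∀ ω, Tendsto (fun n => ∏ r ∈ J, φ r (Z n ω (nextIndex n r))) atTop
      (𝓝 (∏ r ∈ J, φ r (ζ r ω))) := fun ω =>
    tendsto_finsetProd _ fun r _ => tendsto_const_nhds.congr'
      ((eventually_eq_of_cylinderFun (hφC r) (hY r ω)).mono fun n hn => hn.symm)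
  have hlim1 : Tendsto (fun n => ∫ ω, (∏ r ∈ J, φ r (Z n ω (nextIndex n r))) *
      f (Z n ω (nextIndex n (s + t))) ∂uniformSeq) atTop
      (𝓝 (∫ ω, (∏ r ∈ J, φ r (ζ r ω)) * f (ζ (s + t) ω) ∂uniformSeq)) := by
    refine tendsto_integral_of_dominated_convergence (fun _ => 1)
      (fun n => ((hpm n).mul (hfC.1.1.comp (hZnm n _))).aestronglyMeasurable)
      (integrable_const _) (fun n => ae_of_all _ fun ω => ?_) (ae_of_all _ fun ω => ?_)
    · rw [Real.norm_eq_abs, abs_of_nonneg (mul_nonneg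
        (hprod0 fun r => Z n ω (nextIndex n r)) (hind _ _).1)]
      exact mul_le_one₀ (hprod1 fun r => Z n ω (nextIndex n r)) (hind _ _).1 (hind _ _).2
    · exact (hplim ω).mul (tendsto_const_nhds.congr'
        ((eventually_eq_of_cylinderFun hfC (hY (s + t) ω)).mono fun n hn => hn.symm))
  have hlim2 : Tendsto (fun n => ∫ ω, (∏ r ∈ J, φ r (Z n ω (nextIndex n r))) *
      semigroup μ (τ n) f (Z n ω (nextIndex n s)) ∂uniformSeq) atTop
      (𝓝 (∫ ω, (∏ r ∈ J, φ r (ζ r ω)) * semigroup μ t f (ζ s ω) ∂uniformSeq)) := by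
    refine tendsto_integral_of_dominated_convergence (fun _ => 1)
      (fun n => ((hpm n).mul ((hPfm _).comp (hZnm n _))).aestronglyMeasurable)
      (integrable_const _) (fun n => ae_of_all _ fun ω => ?_) (ae_of_all _ fun ω => ?_)
    · rw [Real.norm_eq_abs, abs_of_nonneg (mul_nonneg
        (hprod0 fun r => Z n ω (nextIndex n r)) (hPf0 _ _))]
      exact mul_le_one₀ (hprod1 fun r => Z n ω (nextIndex n r)) (hPf0 _ _) (hPf1 _ _)
    · exact (hplim ω).mul (tendsto_semigroup_of_eventually_eq hμ hfC hL (happ t f hfC) hτ (hY s ω))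
  have heq := tendsto_nhds_unique hlim1 (hlim2.congr fun n => (hlevel n).symm)
  have hBind : ∀ ω, ∏ r ∈ J, φ r (ζ r ω) = B.indicator (fun _ => 1) ω := by
    intro ω
    by_cases hω : ω ∈ B
    · rw [Set.indicator_of_mem hω]
      refine Finset.prod_eq_one fun r hr => ?_
      rw [hBU] at hω
      have : ω ∈ ζ r ⁻¹' S r := hSU r hr ▸ Set.mem_iInter₂.1 hω r hr
      exact Set.indicator_of_mem (Set.mem_preimage.1 this) _
    · rw [Set.indicator_of_notMem hω]
      rw [hBU] at hω
      simp only [Set.mem_iInter, not_forall] at hω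
      obtain ⟨r, hr, hrω⟩ := hω
      rw [← hSU r hr] at hrω
      exact Finset.prod_eq_zero hr (Set.indicator_of_notMem (mt Set.mem_preimage.2 hrω) _)
  simp only [hBind] at heq
  have h1 : ∫ ω, B.indicator (fun _ => (1 : ℝ)) ω * f (ζ (s + t) ω) ∂uniformSeq =
      uniformSeq.real (B ∩ ζ (s + t) ⁻¹' T) := by
    rw [← integral_indicator_one (hBm.inter (hζm _ hTm))]
    refine integral_congr_ae (ae_of_all _ fun ω => ?_)
    by_cases a : ω ∈ B <;> by_cases c : ζ (s + t) ω ∈ T <;> simp [a, c, hf]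
  have h2 : ∫ ω, B.indicator (fun _ => (1 : ℝ)) ω * semigroup μ t f (ζ s ω) ∂uniformSeq =
      (∫⁻ ω in B, μ t (ζ s ω) T ∂uniformSeq).toReal := by
    rw [← integral_toReal (f := fun ω => μ t (ζ s ω) T) (((μ t).measurable_coe hTm).comp (hζm s)).aemeasurable
      (ae_of_all _ fun ω => measure_lt_top _ _), ← integral_indicator hBm]
    refine integral_congr_ae (ae_of_all _ fun ω => ?_)
    have : semigroup μ t f (ζ s ω) = (μ t (ζ s ω) T).toReal := by
      simp only [semigroup, hf, integral_indicator_const _ hTm, smul_eq_mul, mul_one]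
      rfl
    by_cases a : ω ∈ B <;> simp [a, this]
  rw [h1, h2, measureReal_def] at heq
  refine (ENNReal.toReal_eq_toReal_iff' (measure_ne_top _ _) (ne_of_lt ?_)).1 heq
  calc ∫⁻ ω in B, μ t (ζ s ω) T ∂uniformSeq ≤ ∫⁻ ω in B, 1 ∂uniformSeq :=
        lintegral_mono fun ω => prob_le_one
    _ < ∞ := by simp

theorem exists_cadlag_process (hμ : IsMarkovianFamily μ) {C : ℝ≥0}
    (hC : ∀ v t x, μ t x {y | y v ≠ x v} ≤ C * t)
    (hL : ∀ f ∈ cylinderFun V X, ∃ L : ℝ, ∀ (t : ℝ≥0) x, |semigroup μ t f x - f x| ≤ L * t)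
    (happ : ∀ t, ∀ f ∈ cylinderFun V X, ∀ ε > 0, ∃ g ∈ cylinderFun V X,
      ∀ x, |semigroup μ t f x - g x| ≤ ε) (x : V → X) :
    ∃ ζ : ℝ≥0 → UniformSeq → V → X, (∀ t, Measurable (ζ t)) ∧
      (∀ ω t, ContinuousWithinAt (fun s => ζ s ω) (Set.Ici t) t) ∧
      (∀ ω t, ∃ l, Tendsto (fun s => ζ s ω) (𝓝[<] t) (𝓝 l)) ∧
      (∀ᵐ ω ∂uniformSeq, ζ 0 ω = x) ∧
      ∀ (s t : ℝ≥0) (B : Set UniformSeq) (T : Set (V → X)),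
        MeasurableSet[⨆ r ≤ s, MeasurableSpace.pi.comap (ζ r)] B → MeasurableSet T →
        uniformSeq (B ∩ ζ (s + t) ⁻¹' T) = ∫⁻ ω in B, μ t (ζ s ω) T ∂uniformSeq := by
  have := hμ.isMarkovKernel
  obtain ⟨Z, hZm, hZ, hZ0, hZd⟩ := exists_dyadic_process hμ hC x
  let ζ : ℝ≥0 → UniformSeq → V → X := fun t ω v => (hZd ω v).rightValue t
  have hY : ∀ t ω v, ∀ᶠ n in atTop, Z n ω (nextIndex n t) v = ζ t ω v := fun t ω v =>
    (hZd ω v).eventually_eq_rightValue t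
  have hZv : ∀ n k v, Measurable fun ω => Z n ω k v := fun n k v =>
    (measurable_pi_apply v).comp ((measurable_pi_apply k).comp (hZm n))
  have hζm : ∀ t, Measurable (ζ t) := fun t => measurable_pi_lambda _ fun v =>
    measurable_of_tendsto_metrizable (fun n => hZv n (nextIndex n t) v)
      (tendsto_pi_nhds.2 fun ω => tendsto_const_nhds.congr'
        ((hY t ω v).mono fun n hn => hn.symm))
  refine ⟨ζ, hζm, fun ω t => ?_, fun ω t => ?_, ?_, fun s t B T hB hT => ?_⟩
  · refine tendsto_pi_nhds.2 fun v => tendsto_const_nhds.congr' ?_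
    exact ((hZd ω v).eventually_rightValue_eq_right t).mono fun u hu => hu.symm
  · choose l hl using fun v => (hZd ω v).exists_eventually_rightValue_eq_left t
    exact ⟨l, tendsto_pi_nhds.2 fun v => tendsto_const_nhds.congr'
      ((hl v).mono fun u hu => hu.symm)⟩
  -- At time 0 the right limit reads index 1 of each level, not index 0. The probability that a site
  -- changes in the first step tends to 0 with the mesh.
  · suffices h : ∀ v, ∀ᵐ ω ∂uniformSeq, ζ 0 ω v = x v by
      filter_upwards [ae_all_iff.2 h] with ω hω
      exact funext hω
    intro v
    have hD : MeasurableSet {ω | ζ 0 ω v = x v} :=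
      measurableSet_eq_fun ((measurable_pi_apply v).comp (hζm 0)) measurable_const
    have hDn : ∀ n, MeasurableSet {ω | Z n ω 1 v ≠ x v} := fun n =>
      (measurableSet_eq_fun (hZv n 1 v) measurable_const).compl
    rw [ae_iff]
    have hle : ∀ n, uniformSeq {ω | Z n ω 1 v ≠ x v} ≤ C * mesh n := by
      intro n
      have := Measure.isProbabilityMeasure_map (μ := uniformSeq) (hZm n).aemeasurable
      have h := measure_change_le hC hμ (hZ n) v 0
      have hm : MeasurableSet {y : ℕ → V → X | y (0 + 1) v ≠ y 0 v} :=
        (measurableSet_eq_fun (by fun_prop) (by fun_prop)).compl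
      rw [Measure.map_apply (hZm n) hm] at h
      convert h using 2
      ext ω
      simp [hZ0]
    have hlim : Tendsto (fun n => (C * mesh n : ℝ≥0∞)) atTop (𝓝 0) := by
      have h : Tendsto mesh atTop (𝓝 0) := by
        unfold mesh
        simp_rw [← inv_pow]
        exact tendsto_pow_atTop_nhds_zero_of_lt_one (r := (2 : ℝ≥0)⁻¹)
          (by positivity) (inv_lt_one_of_one_lt₀ one_lt_two)
      have h2 : Tendsto (fun n => C * mesh n) atTop (𝓝 0) := by simpa using h.const_mul C
      simpa using ENNReal.tendsto_coe.2 h2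
    have hn0 : ∀ n, nextIndex n 0 = 1 := fun n => by simp [nextIndex]
    have hsub : {ω | ¬ζ 0 ω v = x v} ⊆ ⋃ N, ⋂ n ≥ N, {ω | Z n ω 1 v ≠ x v} := by
      intro ω hω
      obtain ⟨N, hN⟩ := eventually_atTop.1 (hY 0 ω v)
      refine Set.mem_iUnion.2 ⟨N, Set.mem_iInter₂.2 fun n hn => ?_⟩
      have h := hN n hn
      rw [hn0] at h
      exact fun h' => hω (h.symm.trans h')
    refine measure_mono_null hsub (measure_iUnion_null fun N => ?_)
    refine le_antisymm (ge_of_tendsto hlim (eventually_atTop.2 ⟨N, fun n hn => ?_⟩)) zero_le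
    exact (measure_mono (Set.iInter₂_subset n hn)).trans (hle n)
  -- Two extensions from generating π-systems: for a cylinder event `T`, from finite-dimensional
  -- past events to the σ-field of the past, and then, with `B` fixed, from cylinder events to all
  -- `T`.
  · have step : ∀ T ∈ measurableCylinders (fun _ : V => X),
        uniformSeq (B ∩ ζ (s + t) ⁻¹' T) = ∫⁻ ω in B, μ t (ζ s ω) T ∂uniformSeq := by
      intro T hT
      have hTm : MeasurableSet T := MeasurableSet.of_mem_measurableCylinders hT
      have hle : MeasurableSpace.generateFrom (pastEvents ζ s) ≤ MeasurableSpace.pi :=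
        MeasurableSpace.generateFrom_le fun A hA => measurableSet_of_mem_pastEvents hζm hA
      have hBm := iSup_comap_le_generateFrom_pastEvents ζ s B hB
      have hcoe : Measurable fun ω => μ t (ζ s ω) T := ((μ t).measurable_coe hTm).comp (hζm s)
      have hpre : MeasurableSet (ζ (s + t) ⁻¹' T) := hζm _ hTm
      have h := ext_on_measurableSpace_of_generate_finite MeasurableSpace.pi
        (μ := uniformSeq.restrict (ζ (s + t) ⁻¹' T))
        (ν := uniformSeq.withDensity fun ω => μ t (ζ s ω) T) (pastEvents ζ s)
        (fun A hA => by
          have hAm := measurableSet_of_mem_pastEvents hζm hA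
          rw [Measure.restrict_apply hAm, withDensity_apply _ hAm]
          exact measure_inter_eq_of_mem_pastEvents hμ hL happ hZm hZ hζm hY s t hA hT)
        hle rfl (isPiSystem_pastEvents ζ s) (by
          have hA : Set.univ ∈ pastEvents ζ s := ⟨∅, by simp, fun _ => Set.univ, by simp, by simp⟩
          have := measure_inter_eq_of_mem_pastEvents hμ hL happ hZm hZ hζm hY s t hA hT
          rw [Measure.restrict_apply MeasurableSet.univ, withDensity_apply _ MeasurableSet.univ]
          exact this) hBm
      rwa [Measure.restrict_apply (hle _ hBm), withDensity_apply _ (hle _ hBm)] at h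
    have hBm : MeasurableSet B := (iSup₂_le fun r _ => (hζm r).comap_le) B hB
    have hm : ∀ T, MeasurableSet T → ((uniformSeq.restrict B).map (ζ (s + t))) T =
        uniformSeq (B ∩ ζ (s + t) ⁻¹' T) := fun T hT => by
      rw [Measure.map_apply (hζm _) hT, Measure.restrict_apply (hζm _ hT), Set.inter_comm]
    have hm' : ∀ T, MeasurableSet T → (((uniformSeq.restrict B).map (ζ s)).bind (μ t)) T =
        ∫⁻ ω in B, μ t (ζ s ω) T ∂uniformSeq := fun T hT => by
      rw [Measure.bind_apply hT (μ t).aemeasurable, lintegral_map ((μ t).measurable_coe hT) (hζm s)]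
    have heq : (uniformSeq.restrict B).map (ζ (s + t)) =
        ((uniformSeq.restrict B).map (ζ s)).bind (μ t) := by
      refine ext_of_generate_finite _ generateFrom_measurableCylinders.symm
        isPiSystem_measurableCylinders (fun T hT => ?_) ?_
      · rw [hm T (.of_mem_measurableCylinders hT), hm' T (.of_mem_measurableCylinders hT)]
        exact step T hT
      · rw [hm _ MeasurableSet.univ, hm' _ MeasurableSet.univ]
        exact step _ (univ_mem_measurableCylinders _)
    rw [← hm T hT, ← hm' T hT, heq]

end MarkovProperty

/-! ### Independent realisation of processes with all starting points -/

section JointFamily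

variable {E : Type*} [TopologicalSpace E] [mE : MeasurableSpace E] {μ : ℝ≥0 → Kernel E E}
  {e : E → ℝ} {ζ : E → ℝ≥0 → UniformSeq → E}

omit [TopologicalSpace E] in
theorem iSup_comap_mono {I Ω : Type*} (ξ : I → ℝ≥0 → Ω → E) :
    Monotone fun s : ℝ≥0 => ⨆ x, ⨆ r ≤ s, MeasurableSpace.comap (ξ x r) mE := by
  intro s t hst
  refine iSup_mono fun x => ?_
  exact biSup_mono (f := fun r => MeasurableSpace.comap (ξ x r) mE)
    fun r (hr : r ≤ s) => hr.trans hst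

omit [TopologicalSpace E] in
theorem comap_le_iSup {I Ω : Type*} (ξ : I → ℝ≥0 → Ω → E) (x : I) {r s : ℝ≥0} (hr : r ≤ s) :
    MeasurableSpace.comap (ξ x r) mE ≤ ⨆ x, ⨆ r ≤ s, MeasurableSpace.comap (ξ x r) mE := by
  have h1 : MeasurableSpace.comap (ξ x r) mE ≤ ⨆ r ≤ s, MeasurableSpace.comap (ξ x r) mE :=
    le_iSup₂ (f := fun r (_ : r ≤ s) => MeasurableSpace.comap (ξ x r) mE) r hr
  have h2 := le_iSup (fun x => ⨆ r ≤ s, MeasurableSpace.comap (ξ x r) mE) x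
  exact h1.trans h2

/-- The filtration generated by all the processes `ω ↦ ζ x t (ω (e x))`. -/
def jointFiltration (hζm : ∀ x t, Measurable (ζ x t)) :
    Filtration ℝ≥0 (MeasurableSpace.pi : MeasurableSpace (ℝ → UniformSeq)) where
  seq s := ⨆ x, ⨆ r ≤ s,
    MeasurableSpace.comap (fun ω : ℝ → UniformSeq => ζ x r (ω (e x))) mE
  mono' := iSup_comap_mono fun x r (ω : ℝ → UniformSeq) => ζ x r (ω (e x))
  le' _ := iSup_le fun x => iSup₂_le fun r _ =>
    ((hζm x r).comp (measurable_pi_apply (e x))).comap_le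

omit [TopologicalSpace E] in
theorem measurable_jointFiltration (hζm : ∀ x t, Measurable (ζ x t)) (x : E) {r s : ℝ≥0}
    (hr : r ≤ s) :
    Measurable[jointFiltration (e := e) hζm s] fun ω : ℝ → UniformSeq => ζ x r (ω (e x)) :=
  Measurable.of_comap_le (comap_le_iSup (fun x r (ω : ℝ → UniformSeq) => ζ x r (ω (e x))) x hr)

omit [TopologicalSpace E] in
-- With all coordinates but `e x` frozen, the processes from other starting points are constants by
-- injectivity of `e`, so the joint past reduces to the past of the process from `x`.
theorem measurable_update_jointFiltration (he : Function.Injective e)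
    (hζm : ∀ x t, Measurable (ζ x t)) (x : E) (s : ℝ≥0) (ω : ℝ → UniformSeq) :
    Measurable[⨆ r ≤ s, MeasurableSpace.comap (ζ x r) mE, jointFiltration (e := e) hζm s]
      fun u => Function.update ω (e x) u := by
  refine Measurable.of_le_map (iSup_le fun x' => iSup₂_le fun r hr => ?_)
  rw [← MeasurableSpace.comap_le_iff_le_map, MeasurableSpace.comap_comp]
  by_cases h : x' = x
  · subst h
    refine le_iSup₂_of_le r hr (le_of_eq ?_)
    congr 1
    ext u
    simp
  · have hne : e x' ≠ e x := he.ne h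
    have : (fun ω : ℝ → UniformSeq => ζ x' r (ω (e x'))) ∘
        (fun u => Function.update ω (e x) u) = fun _ => ζ x' r (ω (e x')) := by
      ext u
      simp [hne]
    rw [this, MeasurableSpace.comap_const]
    exact bot_le

omit [TopologicalSpace E] in
-- Processes from different starting points read different coordinates of a product space, so the
-- joint past carries no extra information: resample coordinate `e x` and apply `hM` to the sections
-- of `B`.
theorem measure_inter_eq_of_jointFiltration (he : Function.Injective e)
    (hζm : ∀ x t, Measurable (ζ x t))
    (hM : ∀ x (s t : ℝ≥0) (B : Set UniformSeq) (T : Set E),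
      MeasurableSet[⨆ r ≤ s, MeasurableSpace.comap (ζ x r) mE] B → MeasurableSet T →
      uniformSeq (B ∩ ζ x (s + t) ⁻¹' T) = ∫⁻ ω in B, μ t (ζ x s ω) T ∂uniformSeq)
    (x : E) (s t : ℝ≥0) {B : Set (ℝ → UniformSeq)}
    (hB : MeasurableSet[jointFiltration (e := e) hζm s] B) {T : Set E} (hT : MeasurableSet T) :
    Measure.infinitePi (fun _ : ℝ => uniformSeq)
        (B ∩ (fun ω : ℝ → UniformSeq => ζ x (s + t) (ω (e x))) ⁻¹' T) =
      ∫⁻ ω in B, μ t (ζ x s (ω (e x))) T ∂(Measure.infinitePi fun _ : ℝ => uniformSeq) := by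
  have hBm : MeasurableSet B := (jointFiltration hζm).le s B hB
  have hξ : ∀ r, Measurable fun ω : ℝ → UniformSeq => ζ x r (ω (e x)) := fun r =>
    (hζm x r).comp (measurable_pi_apply (e x))
  have hpre := hξ (s + t) hT
  have hcoe : Measurable fun ω : ℝ → UniformSeq => μ t (ζ x s (ω (e x))) T :=
    ((μ t).measurable_coe hT).comp (hξ s)
  rw [← lintegral_indicator_one (hBm.inter hpre), ← lintegral_indicator hBm,
    lintegral_infinitePi_update _ (e x) (measurable_one.indicator (hBm.inter hpre)),
    lintegral_infinitePi_update _ (e x) (hcoe.indicator hBm)]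
  refine lintegral_congr fun ω => ?_
  have hsec := measurable_update_jointFiltration he hζm x s ω hB
  have hsecm : MeasurableSet ((fun u => Function.update ω (e x) u) ⁻¹' B) :=
    (iSup₂_le fun r _ => (hζm x r).comap_le : (⨆ r ≤ s, MeasurableSpace.comap (ζ x r) _) ≤ _) _ hsec
  have h := hM x s t _ T hsec hT
  rw [← lintegral_indicator_one (hsecm.inter (hζm x _ hT)), ← lintegral_indicator hsecm] at h
  refine (lintegral_congr fun u => ?_).trans (h.trans (lintegral_congr fun u => ?_))
  · by_cases h1 : Function.update ω (e x) u ∈ B <;> by_cases h2 : ζ x (s + t) u ∈ T <;>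
      simp [h1, h2]
  · by_cases h1 : Function.update ω (e x) u ∈ B <;> simp [h1]

/-- The copies are indexed by ℝ through `e` rather than by `E`, so that the sample space lies in
`Type` whatever the universe of `E`. -/
theorem exists_isMarkovProcessFamily [∀ t, IsMarkovKernel (μ t)] (he : Function.Injective e)
    (hζm : ∀ x t, Measurable (ζ x t))
    (hright : ∀ x ω t, ContinuousWithinAt (fun s => ζ x s ω) (Set.Ici t) t)
    (hleft : ∀ x ω t, ∃ l, Tendsto (fun s => ζ x s ω) (𝓝[<] t) (𝓝 l))
    (hinit : ∀ x, ∀ᵐ ω ∂uniformSeq, ζ x 0 ω = x)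
    (hM : ∀ x (s t : ℝ≥0) (B : Set UniformSeq) (T : Set E),
      MeasurableSet[⨆ r ≤ s, MeasurableSpace.comap (ζ x r) mE] B → MeasurableSet T →
      uniformSeq (B ∩ ζ x (s + t) ⁻¹' T) = ∫⁻ ω in B, μ t (ζ x s ω) T ∂uniformSeq) :
    ∃ (Ω : Type) (mΩ : MeasurableSpace Ω) (P : Measure Ω) (𝓕 : Filtration ℝ≥0 mΩ)
      (ξ : E → ℝ≥0 → Ω → E), IsProbabilityMeasure P ∧ IsMarkovProcessFamily P 𝓕 μ ξ := by
  refine ⟨ℝ → UniformSeq, _, Measure.infinitePi fun _ : ℝ => uniformSeq,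
    jointFiltration (e := e) hζm, fun x t ω => ζ x t (ω (e x)), inferInstance, ?_⟩
  refine ⟨fun x ω t => hright x _ t, fun x ω t => hleft x _ t,
    fun x t => measurable_jointFiltration hζm x le_rfl, fun x => ?_, fun x s t T hT => ?_⟩
  · have h := measurePreserving_eval_infinitePi (fun _ : ℝ => uniformSeq) (e x)
    exact h.quasiMeasurePreserving.ae (hinit x)
  · have hξ : ∀ r, Measurable fun ω : ℝ → UniformSeq => ζ x r (ω (e x)) := fun r =>
      (hζm x r).comp (measurable_pi_apply (e x))
    have hpre := hξ (s + t) hT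
    have hle := (jointFiltration (e := e) hζm).le s
    have hcoe : Measurable[jointFiltration (e := e) hζm s]
        fun ω : ℝ → UniformSeq => (μ t (ζ x s (ω (e x)))).real T :=
      ((μ t).measurable_coe hT).ennreal_toReal.comp (measurable_jointFiltration hζm x le_rfl)
    have hint : Integrable (fun ω : ℝ → UniformSeq => (μ t (ζ x s (ω (e x)))).real T)
        (Measure.infinitePi fun _ : ℝ => uniformSeq) :=
      .of_bound (hcoe.mono hle le_rfl).aestronglyMeasurable 1 (ae_of_all _ fun ω => by
        rw [Real.norm_of_nonneg measureReal_nonneg]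
        exact measureReal_le_one)
    refine (ae_eq_condExp_of_forall_setIntegral_eq hle ?_ (fun B _ _ => hint.integrableOn)
      (fun B hB _ => ?_) hcoe.stronglyMeasurable.aestronglyMeasurable).symm
    · exact (integrable_const 1).indicator hpre
    · rw [setIntegral_indicator hpre, setIntegral_const, smul_eq_mul, mul_one, measureReal_def,
        measure_inter_eq_of_jointFiltration he hζm hM x s t hB hT]
      exact integral_toReal (f := fun ω : ℝ → UniformSeq => μ t (ζ x s (ω (e x))) T)
        (((μ t).measurable_coe hT).comp (hξ s)).aemeasurable
        (ae_of_all _ fun ω => measure_lt_top _ _)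

end JointFamily

/-! ### Bounds linear in time derived from the generator -/

section GeneratorBounds

variable {V X : Type*} [MeasurableSpace X] {𝒢 : SimpleGraph V} {nb : V → Finset V} {b : ℕ}
  {α : ∀ v, Kernel (nbhd 𝒢 v → X) (nbhd 𝒢 v → X)} {K : ℝ≥0}
  {μ : ℝ≥0 → Kernel (V → X) (V → X)}

theorem abs_semigroup_sub_self_le (hnb : IsNbhdFinset 𝒢 nb b) (hK : ∀ v x, α v x Set.univ ≤ K)
    (hμ : IsMarkovianFamily μ) (hG : HasGeneratorOn μ (gen α Set.univ) (cylinderFun V X))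
    {A : Finset V} {f : (V → X) → ℝ} (hm : Measurable f)
    (hd : DependsOn f (A : Set V)) {M : ℝ} (h0 : 0 ≤ M) (hM : ∀ x, |f x| ≤ M) (t : ℝ≥0)
    (x : V → X) :
    |semigroup μ t f x - f x| ≤ 4 * K * (b + 1) ^ 2 * 2 ^ A.card * M * t := by
  have := isFiniteKernel_of_le hK
  have h := abs_semigroup_sub_taylor_le hμ hG cylinderFun_subset_boundedMeasurable
    (fun f hf => gen_mem_cylinderFun hnb hK _ hf) 1 ⟨⟨hm, M, hM⟩, A, hd⟩
    (abs_iterate_gen_le hnb hK _ hm hd h0 hM 1) t x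
  simp only [Finset.sum_range_one, pow_zero, Nat.factorial_zero, Nat.cast_one, div_one, one_mul,
    Function.iterate_zero_apply, pow_one, Nat.factorial_one] at h
  linarith

/-- The indicator of this event vanishes at `x` and depends on one site only, so the first-order
Taylor bound applies to it; the 8 is 4 times `2 ^ 1` for a support of one site. -/
theorem measure_change_site_le [MeasurableEq X] (hnb : IsNbhdFinset 𝒢 nb b)
    (hK : ∀ v x, α v x Set.univ ≤ K) (hμ : IsMarkovianFamily μ)
    (hG : HasGeneratorOn μ (gen α Set.univ) (cylinderFun V X)) (v : V) (t : ℝ≥0) (x : V → X) :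
    μ t x {y | y v ≠ x v} ≤ (8 * K * (b + 1) ^ 2 : ℝ≥0) * t := by
  have := hμ.isMarkovKernel t
  have hS : MeasurableSet {y : V → X | y v ≠ x v} :=
    (measurableSet_eq_fun (measurable_pi_apply v) measurable_const).compl
  have hd : DependsOn ({y : V → X | y v ≠ x v}.indicator fun _ => (1 : ℝ))
      (({v} : Finset V) : Set V) := fun y z hyz => by
    have : y v = z v := hyz v (by simp)
    by_cases h : z v = x v
    · rw [Set.indicator_of_notMem (by simpa using this.trans h),
        Set.indicator_of_notMem (by simpa using h)]
    · rw [Set.indicator_of_mem (by simpa [this] using h), Set.indicator_of_mem h]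
  have h := abs_semigroup_sub_self_le hnb hK hμ hG (measurable_const.indicator hS) hd zero_le_one
    (fun y => by by_cases hy : y v = x v <;> simp [hy]) t x
  have e1 : semigroup μ t ({y : V → X | y v ≠ x v}.indicator fun _ => (1 : ℝ)) x =
      (μ t x).real {y | y v ≠ x v} := by
    simp [semigroup, integral_indicator_const _ hS]
  rw [e1, Set.indicator_of_notMem (by simp), sub_zero, abs_of_nonneg measureReal_nonneg] at h
  rw [← ENNReal.coe_mul, ← ENNReal.ofReal_coe_nnreal,
    ← ENNReal.ofReal_toReal (measure_ne_top (μ t x) _)]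
  refine ENNReal.ofReal_le_ofReal (h.trans (le_of_eq ?_))
  rw [Finset.card_singleton]
  push_cast
  ring

end GeneratorBounds

end LocalIPS

end

/-! ### Assembly of the theorem -/

theorem theorem2p1 {V X : Type*} [Countable V]
    [TopologicalSpace X] [PolishSpace X] [MeasurableSpace X] [BorelSpace X]
    (𝒢 : SimpleGraph V) (h𝒢 : ⨆ v, (𝒢.neighborSet v).encard < ⊤)
    (α : ∀ v, Kernel (nbhd 𝒢 v → X) (nbhd 𝒢 v → X))
    (hα : ⨆ (v) (x), α v x Set.univ < ∞) :
    -- for each finite window the jump process has a well-defined transition semigroup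
    (∀ W : Finset V, ∃! μW : ℝ≥0 → Kernel (V → X) (V → X), IsWindowFamily α W μW) ∧
    ∃ μ : ℝ≥0 → Kernel (V → X) (V → X),
      -- existence and uniqueness
      (IsMarkovianFamily μ ∧ HasGeneratorOn μ (gen α Set.univ) (cylinderFun V X)) ∧
      (∀ μ' : ℝ≥0 → Kernel (V → X) (V → X),
        IsMarkovianFamily μ' ∧ HasGeneratorOn μ' (gen α Set.univ) (cylinderFun V X) → μ' = μ) ∧
      -- approximation by finite windows
      (∀ (W : ℕ → Finset V) (μW : ℕ → ℝ≥0 → Kernel (V → X) (V → X)),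
        (∀ m, IsWindowFamily α (W m) (μW m)) →
        (⋃ m, ⋂ n ≥ m, (W n : Set V)) = Set.univ →
        ∀ (t : ℝ≥0), ∀ f ∈ cylinderFun V X, ∀ x : V → X,
          Tendsto (fun m => semigroup (μW m) t f x) atTop (𝓝 (semigroup μ t f x))) ∧
      -- realisation by a Markov family of càdlàg processes
      (∃ (Ω : Type) (mΩ : MeasurableSpace Ω) (P : Measure Ω) (𝓕 : Filtration ℝ≥0 mΩ)
        (ξ : (V → X) → ℝ≥0 → Ω → V → X),
        IsProbabilityMeasure P ∧ IsMarkovProcessFamily P 𝓕 μ ξ) := by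
  obtain ⟨nb, b, hnb⟩ := exists_isNbhdFinset h𝒢
  obtain ⟨K, hK⟩ : ∃ K : ℝ≥0, ∀ v x, α v x Set.univ ≤ K := by
    refine ⟨(⨆ (v) (x), α v x Set.univ).toNNReal, fun v x => ?_⟩
    rw [ENNReal.coe_toNNReal hα.ne]
    exact le_iSup₂ (f := fun v x => α v x Set.univ) v x
  have := isFiniteKernel_of_le hK
  choose win hwin using fun W => (existsUnique_isWindowFamily hK W).exists
  obtain ⟨μ, hμP, hlim⟩ := exists_limit_kernels hnb hK hwin
  have hμ := isMarkovianFamily_of_limit hnb hK hwin hμP hlim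
  have hG := hasGeneratorOn_of_limit hnb hK hwin hlim
  refine ⟨existsUnique_isWindowFamily hK, μ, ⟨hμ, hG⟩, fun μ' h' =>
    eq_of_hasGeneratorOn_cylinderFun hnb hK h'.1 h'.2 hμ hG, fun W μW hμW hW t f hf x => ?_, ?_⟩
  · obtain rfl : μW = fun m => win (W m) := funext fun m =>
      (existsUnique_isWindowFamily hK (W m)).unique (hμW m) (hwin (W m))
    exact tendsto_semigroup_window hlim hW t hf x
  · have hL : ∀ f ∈ cylinderFun V X, ∃ L : ℝ, ∀ (t : ℝ≥0) x,
        |semigroup μ t f x - f x| ≤ L * t := by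
      rintro f ⟨⟨hm, M, hM⟩, A, hd⟩
      exact ⟨_, abs_semigroup_sub_self_le hnb hK hμ hG hm hd (abs_nonneg M)
        fun x => (hM x).trans (le_abs_self M)⟩
    have happ : ∀ t, ∀ f ∈ cylinderFun V X, ∀ ε > 0, ∃ g ∈ cylinderFun V X,
        ∀ x, |semigroup μ t f x - g x| ≤ ε := by
      intro t f hf ε hε
      obtain ⟨B, hB⟩ := hlim t f hf ε hε
      exact ⟨_, semigroup_window_mem_cylinderFun hnb hK hwin B t hf, fun x =>
        abs_sub_comm (semigroup μ t f x) _ ▸ hB B subset_rfl x⟩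
    choose ζ hζm hright hleft hinit hM using exists_cadlag_process hμ
      (measure_change_site_le hnb hK hμ hG) hL happ
    -- As a countable power of a Polish space, `V → X` is standard Borel and embeds into ℝ, which
    -- supplies the index set of the independent copies.
    exact exists_isMarkovProcessFamily (measurableEmbedding_embeddingReal (V → X)).injective
      hζm hright hleft hinit hM
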